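/- **Proposition 5.10.** Let $n>2$ and $a>0$. On $\mathbb C^{n+1}$ put $\tau(z)=|z|^2$, and let $C=\{z\neq 0:\sum z_i^2=0\}$ and $M=\{z:\sum z_i^2=1\}$. Let $g$ be the Stenzel metric on $M$ with Kähler form $i\partial\bar\partial(a\,f\circ\tau)$, where $f(\cosh w)=h_*(w)$, $(h_*'(w)^n)'=(\sinh w)^{n-1}$, $h_*'(0)=0$, $h_*'\ge 0$. Let $g_0$ be the cone metric on $C$ with Kähler form $i\partial\bar\partial(a\,C_n\tau^{1-1/n})=\frac i2\partial\bar\partial r^2$, where $r$ is its radius function and $C_n=\frac{n}{n-1}(n-1)^{-1/n}$ is the constant in $f(\tau)\sim C_n\tau^{1-1/n}$ as $\tau\to\infty$. (The metric associated with a Kähler form $\omega$ is $\omega(\cdot,J\cdot)$.) Let $\Phi(z)=z+\frac{\bar z}{2|z|^2}$, which maps $C$ to $M$. A covariant tensor $T$ defined on $C$ outside a compact set is $O(r^\lambda)$ with $g_0$-derivatives if $|\nabla_0^kT|_{g_0}=O(r^{\lambda-k})$ as $r\to\infty$ for every $k\ge 0$, where $\nabla_0$ is the Levi-Civita connection of $g_0$;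 it has rate $\lambda$ if $\lambda$ is the least number with this property. Let $h$ be the symmetric bilinear form $h=2aC_n(1-\tfrac1n)\,\tau^{-1/n-1}\,\mathrm{Re}\sum_i dz_i\otimes dz_i$ on $C$. Then: 1. $h$ is $\mathrm{SO}(n+1)$-invariant, and for every $t>0$, at the point $p_0=\sqrt t\,(\frac1{\sqrt2},\frac i{\sqrt2},0,\dots,0)$ of $C$, where $\tau=t$, it has the matrix $$\frac1\tau\,\mathrm{diag}(0,0,\,1,-1,\,\dots,\,1,-1)$$ with respect to a $g_0$-orthonormal basis $(\partial_r,J\partial_r),(X_3,Y_3),\dots,(X_{n+1},Y_{n+1})$ of $T_{p_0}C$, where $X_j,Y_j$ are a common positive rescaling of $\partial_{x_j},\partial_{y_j}$. In particular $h$ is tracefree with respect to $g_0$ (at every point of $C$). 2. $\Phi^*g-g_0$ equals $h$ to leading order: $\Phi^*g-g_0-h=O(r^{\lambda})$ with $g_0$-derivatives for some $\lambda<-2\frac n{n-1}$. 3. Both $h$ and $\Phi^*g-g_0$ have rate exactly $-2\frac{n}{n-1}$. 4. $h$ satisfies the Bianchi gauge condition relative to $g_0$: $\mathrm{div}_{g_0}h-\frac12\,d(\mathrm{tr}_{g_0}h)=0$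 on $C$. 5. The rate is optimal in the sense that no infinitesimal change of gauge improves it: if $X$ is a smooth vector field on $C$ outside a compact set and $\Phi^*g-g_0+\mathcal L_Xg_0=O(r^\lambda)$ with $g_0$-derivatives, then $\lambda\ge-2\frac n{n-1}$. -/

import Mathlib

open scoped ContDiff

noncomputable section

namespace Stenzel

/-- The Hermitian space `ℂⁿ⁺¹`; `‖z‖ ^ 2` is the function `τ(z) = |z|²`. -/
abbrev Amb (n : ℕ) := EuclideanSpace ℂ (Fin (n + 1))

/-- The complex bilinear form `∑ vᵢ wᵢ`. -/
def dot {n : ℕ} (v w : Amb n) : ℂ := ∑ i, v i * w i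

/-- Entrywise complex conjugation on `ℂⁿ⁺¹`. -/
def conjVec {n : ℕ} (z : Amb n) : Amb n := WithLp.toLp 2 fun i => (starRingEnd ℂ) (z i)

/-- The ordinary double point `∑ zᵢ² = 0`, without its apex. -/
def cone (n : ℕ) : Set (Amb n) := {z | z ≠ 0 ∧ dot z z = 0}

/-- The smoothing `∑ zᵢ² = 1`. -/
def smoothing (n : ℕ) : Set (Amb n) := {z | dot z z = 1}

/-- The tangent space at `z` (the kernel of the differential of `∑ zᵢ²`) of the quadric
`∑ zᵢ² = const` through `z ≠ 0`: the tangent space of the cone or of the smoothing. -/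
def tang {n : ℕ} (z : Amb n) : Set (Amb n) := {v | dot z v = 0}

/-! ### Kähler metrics from potentials -/

/-- The real symmetric form `g(v, w) = ω(v, i w)` associated with `ω = i ∂∂̄ φ`, namely
`2 Re ∑ φ_{j k̄} v_j w̄_k`, written through the real second derivative of `φ`.
Since `∂∂̄` commutes with restriction to complex submanifolds, its restriction to the tangent
spaces of a complex submanifold is the form associated with `i ∂∂̄ (φ|)`. -/
def kahlerForm {n : ℕ} (φ : Amb n → ℝ) (z v w : Amb n) : ℝ :=
  (fderiv ℝ (fderiv ℝ φ) z v w +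
    fderiv ℝ (fderiv ℝ φ) z (Complex.I • v) (Complex.I • w)) / 2

/-- The function `h` with `((h')ⁿ)' = sinhⁿ⁻¹`, `h'(0) = 0` and `h(0) = 0`. -/
def profile (n : ℕ) (w : ℝ) : ℝ :=
  ∫ s in (0 : ℝ)..w, (∫ u in (0 : ℝ)..s, Real.sinh u ^ (n - 1)) ^ (1 / (n : ℝ))

/-- Stenzel's potential `a • f(τ)`, `f(cosh w) = h(w)`, where `a > 0` is a scale. It is used where
`τ > 1`; on the smoothing this is the complement of the compact core sphere `τ = 1`. -/
def stenzelPotential (n : ℕ) (a : ℝ) (z : Amb n) : ℝ :=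
  a * profile n (Real.arcosh (‖z‖ ^ 2))

/-- The Stenzel metric, to be evaluated at points of the smoothing on its tangent vectors. -/
def stenzelMetric (n : ℕ) (a : ℝ) (z v w : Amb n) : ℝ := kahlerForm (stenzelPotential n a) z v w

/-- The constant `C_n` in `f(τ) ∼ C_n τ ^ (1 - 1/n)` as `τ → ∞`. -/
def leadConst (n : ℕ) : ℝ := (n : ℝ) / (n - 1) * ((n : ℝ) - 1) ^ (-(1 / (n : ℝ)))

/-- The Kähler potential `a C_n τ ^ (1 - 1/n)` of the cone metric. -/
def conePotential (n : ℕ) (a : ℝ) (z : Amb n) : ℝ :=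
  a * leadConst n * (‖z‖ ^ 2) ^ (1 - 1 / (n : ℝ))

/-- The Calabi-Yau cone metric `g₀`, to be evaluated at points of the cone on tangent vectors. -/
def coneMetric (n : ℕ) (a : ℝ) (z v w : Amb n) : ℝ := kahlerForm (conePotential n a) z v w

/-- The radius function `r` of `g₀`, determined by `ω₀ = (i/2) ∂∂̄ r²`. -/
def radius (n : ℕ) (a : ℝ) (z : Amb n) : ℝ := Real.sqrt (2 * conePotential n a z)

/-- The radial unit field `∂_r`: the scaling `r ↦ t r` of the cone is `z ↦ t ^ (n/(n-1)) z`, so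
`r ∂_r` is `n/(n-1)` times the Euler field. -/
def radial (n : ℕ) (a : ℝ) (z : Amb n) : Amb n :=
  ((n : ℝ) / ((n - 1) * radius n a z)) • z

/-! ### Tensor calculus on the cone

A covariant `q`-tensor on (an open subset of) the cone is represented by a function `T z v` of the
point `z` and of `v : Fin q → ℂⁿ⁺¹`; only points of the cone and tangent vectors matter. -/

/-- Covariant `q`-tensors. -/
abbrev Tensor (n q : ℕ) := Amb n → (Fin q → Amb n) → ℝ

/-- A bilinear form as a tensor. -/
def toTensor {n : ℕ} (b : Amb n → Amb n → Amb n → ℝ) : Tensor n 2 := fun z v => b z (v 0) (v 1)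

/-- The Euclidean orthogonal projection onto `tang z`. It extends a vector `v` to the
vector field `y ↦ proj y v` tangent to the cone. -/
def proj {n : ℕ} (z v : Amb n) : Amb n := v - (dot z v / (‖z‖ : ℂ) ^ 2) • conjVec z

/-- The Levi-Civita derivative of `g₀` on the cone: for `v` tangent at `z` and a vector field `W`
tangent to the cone, `∇_v W` is the tangent vector given by the Koszul formula in the linear
coordinates of `ℂⁿ⁺¹`. -/
def nabla (n : ℕ) (a : ℝ) (z v : Amb n) (W : Amb n → Amb n) : Amb n :=
  Classical.epsilon fun t => t ∈ tang z ∧ ∀ u ∈ tang z,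
    coneMetric n a z t u = coneMetric n a z (fderiv ℝ W z v) u +
      (fderiv ℝ (fun y => coneMetric n a y (W z) u) z v
        + fderiv ℝ (fun y => coneMetric n a y v u) z (W z)
        - fderiv ℝ (fun y => coneMetric n a y v (W z)) z u) / 2

/-- The covariant derivative `(∇_{v₀} T)(v₁, …, v_q)` by the Leibniz rule. The arguments are
projected to the tangent space, which changes nothing for tangent vectors. -/
def covDeriv (n : ℕ) (a : ℝ) {q : ℕ} (T : Tensor n q) : Tensor n (q + 1) := fun z v =>
  fderiv ℝ (fun y => T y fun i => proj y (v i.succ)) z (proj z (v 0)) -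
    ∑ i : Fin q, T z (Function.update (fun j => proj z (v j.succ)) i
      (nabla n a z (proj z (v 0)) fun y => proj y (v i.succ)))

/-- The iterated covariant derivative `∇ᵏ T`. -/
def covDerivIter (n : ℕ) (a : ℝ) {q : ℕ} (T : Tensor n q) : (k : ℕ) → Tensor n (q + k)
  | 0 => T
  | k + 1 => covDeriv n a (covDerivIter n a T k)

/-- `T = O(r ^ l)` with `g₀`-derivatives: `|∇ᵏ T|_{g₀} = O(r ^ (l - k))` near infinity for all `k`.
The pointwise norm is the norm as a multilinear form on the Euclidean space `(tang z, g₀)`, which is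
equivalent to the tensor norm with constants that depend only on the dimension and on `q + k`. -/
def HasDecay (n : ℕ) (a : ℝ) {q : ℕ} (T : Tensor n q) (l : ℝ) : Prop :=
  ∀ k : ℕ, ∃ K R : ℝ, ∀ z ∈ cone n, R < radius n a z → ∀ v : Fin (q + k) → Amb n,
    (∀ i, v i ∈ tang z) → |covDerivIter n a T k z v| ≤
      K * radius n a z ^ (l - k) * ∏ i, Real.sqrt (coneMetric n a z (v i) (v i))

/-- `T` has rate `l`: `l` is the least `m` such that `T = O(r ^ m)` with `g₀`-derivatives. -/
def HasRate (n : ℕ) (a : ℝ) {q : ℕ} (T : Tensor n q) (l : ℝ) : Prop :=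
  IsLeast {m : ℝ | HasDecay n a T m} l

/-- A `g₀`-orthonormal basis of the (real `2n`-dimensional) tangent space of the cone at `z`. -/
def IsFrame (n : ℕ) (a : ℝ) (z : Amb n) (e : Fin n × Fin 2 → Amb n) : Prop :=
  (∀ i, e i ∈ tang z) ∧ ∀ i j, coneMetric n a z (e i) (e j) = if i = j then 1 else 0

/-- The value on `w` of the Bianchi operator `tr (∇ b) - ½ d (tr b)` of a symmetric form `b`,
computed in the frame `e`; here `d (tr b) (w) = tr (∇_w b)` as `g₀` is parallel. -/
def bianchi (n : ℕ) (a : ℝ) (b : Amb n → Amb n → Amb n → ℝ) (z : Amb n)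
    (e : Fin n × Fin 2 → Amb n) (w : Amb n) : ℝ :=
  ∑ i, covDeriv n a (toTensor b) z ![e i, e i, w] -
    (∑ i, covDeriv n a (toTensor b) z ![w, e i, e i]) / 2

/-- The Lie derivative `L_X g₀`. -/
def lieMetric (n : ℕ) (a : ℝ) (X : Amb n → Amb n) (z v w : Amb n) : ℝ :=
  fderiv ℝ (fun y => coneMetric n a y v w) z (X z) +
    coneMetric n a z (fderiv ℝ X z v) w + coneMetric n a z v (fderiv ℝ X z w)

/-! ### The comparison map and the leading term -/

/-- The map `Φ(z) = z + z̄ / (2 |z|²)`. -/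
def Phi {n : ℕ} (z : Amb n) : Amb n := z + (1 / (2 * ‖z‖ ^ 2) : ℝ) • conjVec z

/-- The pullback `Φ^* g` of the Stenzel metric. -/
def pullback (n : ℕ) (a : ℝ) (z v w : Amb n) : ℝ :=
  stenzelMetric n a (Phi z) (fderiv ℝ Phi z v) (fderiv ℝ Phi z w)

/-- The difference `Φ^* g - g₀`. -/
def difference (n : ℕ) (a : ℝ) (z v w : Amb n) : ℝ := pullback n a z v w - coneMetric n a z v w

/-- The symmetric bilinear form `2 a C_n (1 - 1/n) τ ^ (-1/n - 1) Re ∑ dzᵢ ⊗ dzᵢ` on the cone.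
It is the `SO(n+1)`-invariant form that has the matrix
`τ⁻¹ diag(0, 0, 1, -1, …, 1, -1)` in the frame `frame n a t s` at `basePoint n t`. -/
def leading (n : ℕ) (a : ℝ) (z v w : Amb n) : ℝ :=
  2 * a * leadConst n * (1 - 1 / (n : ℝ)) * (‖z‖ ^ 2) ^ (-(1 / (n : ℝ)) - 1) * (dot v w).re

/-- The point `√t (1/√2, i/√2, 0, …, 0)` of the cone, at which `τ = t`. -/
def basePoint (n : ℕ) (t : ℝ) : Amb n :=
  WithLp.toLp 2 fun i : Fin (n + 1) => if i.val = 0 then (Real.sqrt (t / 2) : ℂ)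
    else if i.val = 1 then Complex.I * (Real.sqrt (t / 2) : ℂ) else 0

/-- The vectors `(∂_r, J ∂_r), (X₃, Y₃), …, (X_{n+1}, Y_{n+1})` at `basePoint n t`, where
`X_j = s ∂_{x_j}` and `Y_j = s ∂_{y_j}` for a common factor `s`. -/
def frame (n : ℕ) (a t s : ℝ) (i : Fin n × Fin 2) : Amb n :=
  (if i.2 = 0 then (1 : ℂ) else Complex.I) •
    (if i.1.val = 0 then radial n a (basePoint n t)
      else EuclideanSpace.single i.1.succ (s : ℂ))

/-- The diagonal entries of `diag(0, 0, 1, -1, …, 1, -1)`. -/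
def diagEntry {n : ℕ} (i : Fin n × Fin 2) : ℝ :=
  if i.1.val = 0 then 0 else if i.2 = 0 then 1 else -1

/-- The action of a real matrix on `ℂⁿ⁺¹`. -/
def act {n : ℕ} (A : Matrix (Fin (n + 1)) (Fin (n + 1)) ℝ) (z : Amb n) : Amb n :=
  WithLp.toLp 2 fun i => ∑ j, (A i j : ℂ) * z j

/-- `Φ` maps the cone to the smoothing. -/
theorem Phi_mem {n : ℕ} {z : Amb n} (hz : z ∈ cone n) : Phi z ∈ smoothing n := by
  obtain ⟨h0, h1⟩ := hz
  have hn : (‖z‖ : ℂ) ≠ 0 := by exact_mod_cast norm_ne_zero_iff.2 h0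
  have h2 : ∑ i, z i * (starRingEnd ℂ) (z i) = (‖z‖ : ℂ) ^ 2 := by
    have := EuclideanSpace.norm_sq_eq z
    simp_rw [Complex.mul_conj, Complex.normSq_eq_norm_sq]
    exact_mod_cast this.symm
  have h3 : ∑ i, (starRingEnd ℂ) (z i) * (starRingEnd ℂ) (z i) = 0 := by
    have := congrArg (starRingEnd ℂ) h1
    simpa [dot] using this
  have h1' : ∑ i, z i * z i = 0 := h1
  have : dot (Phi z) (Phi z) = ∑ i, z i * z i
      + (1 / (‖z‖ : ℂ) ^ 2) * ∑ i, z i * (starRingEnd ℂ) (z i)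
      + (1 / (2 * (‖z‖ : ℂ) ^ 2)) ^ 2 * ∑ i, (starRingEnd ℂ) (z i) * (starRingEnd ℂ) (z i) := by
    simp only [dot, Phi, conjVec, Finset.mul_sum, ← Finset.sum_add_distrib]
    refine Finset.sum_congr rfl fun i _ => ?_
    simp
    ring
  show dot (Phi z) (Phi z) = 1
  rw [this, h1', h2, h3]
  field_simp
  simp

end Stenzel

end

noncomputable section

namespace Stenzel

open Filter Asymptotics Topology Bornology

/-! ### Symbol classes -/

/-! Leading term. For a potential ψ(τ), the form associated with i∂∂̄ψ is 2(ψ' Re⟨v,w⟩ + ψ''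
Re(⟨z,v⟩ conj⟨z,w⟩)) (`kahlerForm_radial`). On the cone z·z = 0, so |Φ(z)|² = τ + 1/(4τ), and dΦ(v)
is v + v̄/(2τ) plus a real multiple of z̄. In ⟨dΦ v, dΦ w⟩ the cross terms of v with w̄ produce
Re(v·w)/τ; multiplied by the derivative of the cone potential this is exactly h
(`re_dot_fderiv_Phi`, `difference_eq`). Everything else is smaller by at least τ^(-1/2) relative to
h, because Stenzel's f' differs from the derivative of the cone potential only by a relative
O(τ^(-3/2)) (`symbol_stenzelDeriv_sub`).

Derivatives. All estimates are made with symbols: functions whose k-th derivative loses k powers of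
|z|. A tensor is extended to the ambient space as a multilinear form with symbol coefficients
(`TSym`). In linear coordinates the connection of g₀ has coefficients of order -1, so ∇ lowers the
order of such a tensor by one (`TSym.covDeriv`). The extension is immaterial, since ∇ differentiates
only along the cone (`AgreeOnCone.covDeriv`). As g₀ is comparable to |z|^(-2/n) times the Euclidean
metric and r to |z|^(1-1/n), an order in |z| translates into a rate in r for all derivatives at once
(`hasDecay_of_agreeOnCone`).

Algebra of h. It is a function of τ times the real part of a complex bilinear form, hence of type
(2,0)+(0,2), and such forms have zero trace over any g₀-orthonormal frame because the trace is
unchanged when the frame is multiplied by i (`IsFrame.sum_eq_zero`). In ∇h every contraction is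
either such a trace or a pairing of a tangent vector with z, so divergence and trace derivative
vanish separately (`bianchi_leading`).

Sharpness. On a suitable g₀-unit vector h equals 1/τ, a constant multiple of r^(-2n/(n-1)), which
bounds the rates from below. For a change of gauge X, consider the torus of points c(x + iy) with x
and y on unit circles in two orthogonal real planes. If F and S are its two coordinate fields, then
(L_X g₀)(F,F) - (L_X g₀)(S,S) is a positive constant times a divergence on the torus, so it is
nonnegative somewhere, whatever the growth of X (`exists_lieMetric_torus_le`). But h is positive on
F and negative on S by the same amount everywhere, so the Lie derivative cannot cancel h at that
point (`rate_le_of_gauge`). -/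

/-- A filter of punctured neighbourhoods of infinity. -/
class EndFilter {E : Type} [NormedAddCommGroup E] (ℓ : Filter E) : Prop where
  norm_tendsto : Tendsto (fun x : E => ‖x‖) ℓ atTop
  nhds : ∀ p : E → Prop, (∀ᶠ x in ℓ, p x) → ∀ᶠ x in ℓ, ∀ᶠ y in 𝓝 x, p y

instance : EndFilter (atTop : Filter ℝ) where
  norm_tendsto := tendsto_norm_atTop_atTop
  nhds p hp := by
    obtain ⟨R, hR⟩ := eventually_atTop.1 hp
    filter_upwards [eventually_gt_atTop R] with x hx
    filter_upwards [lt_mem_nhds hx] with y hy using hR y hy.le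

theorem eventually_cobounded_iff {E : Type} [NormedAddCommGroup E] {p : E → Prop} :
    (∀ᶠ x in cobounded E, p x) ↔ ∃ R : ℝ, ∀ x, R < ‖x‖ → p x := by
  rw [← comap_norm_atTop, eventually_comap]
  constructor
  · intro h
    obtain ⟨R, hR⟩ := eventually_atTop.1 h
    exact ⟨R, fun x hx => hR _ hx.le x rfl⟩
  · rintro ⟨R, hR⟩
    filter_upwards [eventually_gt_atTop R] with b hb x hx using hR x (hx ▸ hb)

instance {E : Type} [NormedAddCommGroup E] : EndFilter (cobounded E) where
  norm_tendsto := tendsto_norm_cobounded_atTop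
  nhds p hp := by
    obtain ⟨R, hR⟩ := eventually_cobounded_iff.1 hp
    refine eventually_cobounded_iff.2 ⟨R, fun x hx => ?_⟩
    filter_upwards [(continuous_norm.tendsto x).eventually (lt_mem_nhds hx)] with y hy using hR y hy

section

variable {E F G H : Type} [NormedAddCommGroup E] [NormedSpace ℝ E]
  [NormedAddCommGroup F] [NormedSpace ℝ F] [NormedAddCommGroup G] [NormedSpace ℝ G]
  [NormedAddCommGroup H] [NormedSpace ℝ H] {ℓ : Filter E}

/-- `f` and its derivatives of order at most `k` are those of a symbol of order `m` along `ℓ`. -/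
def Sym (ℓ : Filter E) :
    ℕ → ∀ {F : Type} [NormedAddCommGroup F] [NormedSpace ℝ F], ℝ → (E → F) → Prop
  | 0, _, _, _, m, f => f =O[ℓ] fun x => ‖x‖ ^ m
  | k + 1, F, _, _, m, f => (f =O[ℓ] fun x => ‖x‖ ^ m) ∧ ∃ f' : E → (E →L[ℝ] F),
      (∀ᶠ x in ℓ, HasFDerivAt f (f' x) x) ∧ Sym ℓ k (m - 1) f'

theorem Sym.isBigO {k : ℕ} {m : ℝ} {f : E → F} (h : Sym ℓ k m f) : f =O[ℓ] fun x => ‖x‖ ^ m := by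
  cases k with
  | zero => exact h
  | succ k => exact h.1

theorem Sym.pred {k : ℕ} {m : ℝ} {f : E → F} (h : Sym ℓ (k + 1) m f) : Sym ℓ k m f := by
  induction k generalizing m F with
  | zero => exact h.1
  | succ k ih =>
    obtain ⟨h0, f', h1, h2⟩ := h
    exact ⟨h0, f', h1, ih h2⟩

omit [NormedSpace ℝ E] in
theorem isBigO_norm_rpow [EndFilter ℓ] {m m' : ℝ} (h : m ≤ m') :
    (fun x : E => ‖x‖ ^ m) =O[ℓ] fun x => ‖x‖ ^ m' := by
  refine IsBigO.of_bound 1 ?_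
  filter_upwards [(EndFilter.norm_tendsto (ℓ := ℓ)).eventually (eventually_ge_atTop 1)] with x hx
  rw [Real.norm_of_nonneg (by positivity), Real.norm_of_nonneg (by positivity), one_mul]
  exact Real.rpow_le_rpow_of_exponent_le hx h

omit [NormedSpace ℝ E] in
theorem eventually_norm_pos [EndFilter ℓ] : ∀ᶠ x in ℓ, 0 < ‖x‖ :=
  (EndFilter.norm_tendsto (ℓ := ℓ)).eventually (eventually_gt_atTop 0)

omit [NormedSpace ℝ E] in
theorem norm_rpow_mul [EndFilter ℓ] (m m' : ℝ) :
    (fun x : E => ‖x‖ ^ m * ‖x‖ ^ m') =ᶠ[ℓ] fun x => ‖x‖ ^ (m + m') := by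
  filter_upwards [eventually_norm_pos] with x hx using (Real.rpow_add hx _ _).symm

theorem Sym.mono [EndFilter ℓ] {k : ℕ} {m m' : ℝ} {f : E → F} (h : Sym ℓ k m f) (hm : m ≤ m') :
    Sym ℓ k m' f := by
  induction k generalizing m m' F with
  | zero => exact IsBigO.trans h (isBigO_norm_rpow hm)
  | succ k ih =>
    obtain ⟨h0, f', h1, h2⟩ := h
    exact ⟨h0.trans (isBigO_norm_rpow hm), f', h1, ih h2 (by linarith)⟩

theorem Sym.zero (k : ℕ) (m : ℝ) : Sym ℓ k m (fun _ => (0 : F)) := by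
  induction k generalizing m F with
  | zero => exact isBigO_zero _ _
  | succ k ih =>
    exact ⟨isBigO_zero _ _, fun _ => 0, Eventually.of_forall fun x => hasFDerivAt_const _ _, ih _⟩

theorem Sym.const [EndFilter ℓ] (k : ℕ) (c : F) : Sym ℓ k 0 (fun _ => c) := by
  have h0 : (fun _ : E => c) =O[ℓ] fun x => ‖x‖ ^ (0 : ℝ) := by
    simpa using isBigO_const_const c (one_ne_zero (α := ℝ)) ℓ
  cases k with
  | zero => exact h0
  | succ k =>
    exact ⟨h0, fun _ => 0, Eventually.of_forall fun x => hasFDerivAt_const _ _, Sym.zero _ _⟩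

theorem Sym.add {k : ℕ} {m : ℝ} {f g : E → F} (hf : Sym ℓ k m f) (hg : Sym ℓ k m g) :
    Sym ℓ k m (fun x => f x + g x) := by
  induction k generalizing m F with
  | zero => exact IsBigO.add hf hg
  | succ k ih =>
    obtain ⟨h0, f', h1, h2⟩ := hf
    obtain ⟨k0, g', k1, k2⟩ := hg
    refine ⟨h0.add k0, fun x => f' x + g' x, ?_, ih h2 k2⟩
    filter_upwards [h1, k1] with x hx kx using hx.add kx

theorem Sym.clm (L : F →L[ℝ] G) {k : ℕ} {m : ℝ} {f : E → F} (hf : Sym ℓ k m f) :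
    Sym ℓ k m (fun x => L (f x)) := by
  induction k generalizing m F G with
  | zero => exact (L.isBigO_comp _ _).trans hf
  | succ k ih =>
    obtain ⟨h0, f', h1, h2⟩ := hf
    refine ⟨(L.isBigO_comp _ _).trans h0, fun x => L.comp (f' x), ?_,
      ih (ContinuousLinearMap.compL ℝ E F G L) h2⟩
    filter_upwards [h1] with x hx using L.hasFDerivAt.comp x hx

omit [NormedSpace ℝ E] in
theorem isBigO_bilin [EndFilter ℓ] (B : F →L[ℝ] G →L[ℝ] H) {m m' : ℝ} {f : E → F} {g : E → G}
    (h : f =O[ℓ] fun x => ‖x‖ ^ m) (h' : g =O[ℓ] fun x => ‖x‖ ^ m') :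
    (fun x => B (f x) (g x)) =O[ℓ] fun x => ‖x‖ ^ (m + m') := by
  have h1 : (fun x => B (f x) (g x)) =O[ℓ] fun x => ‖f x‖ * ‖g x‖ :=
    IsBigO.of_bound ‖B‖ <| Eventually.of_forall fun x => by
      rw [Real.norm_of_nonneg (by positivity), ← mul_assoc]
      exact B.le_opNorm₂ _ _
  exact h1.trans ((h.norm_left.mul h'.norm_left).trans_eventuallyEq (norm_rpow_mul m m'))

/-- Leibniz rule: each derivative falls on one factor and lowers its order by one, while the other
factor is only needed to depth k, which `Sym.pred` supplies. -/
theorem Sym.bilin [EndFilter ℓ] (B : F →L[ℝ] G →L[ℝ] H) {k : ℕ} {m m' : ℝ} {f : E → F} {g : E → G}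
    (hf : Sym ℓ k m f) (hg : Sym ℓ k m' g) : Sym ℓ k (m + m') (fun x => B (f x) (g x)) := by
  induction k generalizing m m' F G H with
  | zero => exact isBigO_bilin B hf hg
  | succ k ih =>
    have hf0 := hf.pred
    have hg0 := hg.pred
    obtain ⟨h0, f', h1, h2⟩ := hf
    obtain ⟨k0, g', k1, k2⟩ := hg
    refine ⟨isBigO_bilin B h0 k0,
      fun x => B.precompR E (f x) (g' x) + B.precompL E (f' x) (g x), ?_, ?_⟩
    · filter_upwards [h1, k1] with x hx kx using B.hasFDerivAt_of_bilinear hx kx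
    · refine Sym.add ?_ ?_
      · convert ih (B.precompR E) hf0 k2 using 1; ring
      · convert ih (B.precompL E) h2 hg0 using 1; ring

/-- Transferring derivatives needs equality on a neighbourhood of each far point, not just at the
point; this is the purpose of `EndFilter.nhds`. -/
theorem Sym.congr [EndFilter ℓ] {k : ℕ} {m : ℝ} {f g : E → F} (hf : Sym ℓ k m f) (h : f =ᶠ[ℓ] g) :
    Sym ℓ k m g := by
  cases k with
  | zero => exact h.symm.trans_isBigO hf
  | succ k =>
    obtain ⟨h0, f', h1, h2⟩ := hf
    refine ⟨h.symm.trans_isBigO h0, f', ?_, h2⟩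
    filter_upwards [h1, EndFilter.nhds _ h] with x hx hy
    exact hx.congr_of_eventuallyEq (hy.mono fun _ h => h.symm)

/-- Symbols of order `m`: the derivatives of order `k` are `O(‖x‖ ^ (m - k))`. -/
def Symbol (ℓ : Filter E) (m : ℝ) (f : E → F) : Prop := ∀ k, Sym ℓ k m f

theorem Symbol.isBigO {m : ℝ} {f : E → F} (h : Symbol ℓ m f) : f =O[ℓ] fun x => ‖x‖ ^ m :=
  (h 0).isBigO

theorem Symbol.mono [EndFilter ℓ] {m m' : ℝ} {f : E → F} (h : Symbol ℓ m f) (hm : m ≤ m') :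
    Symbol ℓ m' f := fun k => (h k).mono hm

theorem Symbol.zero (m : ℝ) : Symbol ℓ m (fun _ => (0 : F)) := fun k => Sym.zero k m

theorem Symbol.const [EndFilter ℓ] (c : F) : Symbol ℓ 0 (fun _ => c) := fun k => Sym.const k c

theorem Symbol.add {m : ℝ} {f g : E → F} (hf : Symbol ℓ m f) (hg : Symbol ℓ m g) :
    Symbol ℓ m (fun x => f x + g x) := fun k => (hf k).add (hg k)

theorem Symbol.clm (L : F →L[ℝ] G) {m : ℝ} {f : E → F} (hf : Symbol ℓ m f) :
    Symbol ℓ m (fun x => L (f x)) := fun k => (hf k).clm L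

theorem Symbol.bilin [EndFilter ℓ] (B : F →L[ℝ] G →L[ℝ] H) {m m' : ℝ} {f : E → F} {g : E → G}
    (hf : Symbol ℓ m f) (hg : Symbol ℓ m' g) : Symbol ℓ (m + m') (fun x => B (f x) (g x)) :=
  fun k => (hf k).bilin B (hg k)

theorem Symbol.congr [EndFilter ℓ] {m : ℝ} {f g : E → F} (hf : Symbol ℓ m f) (h : f =ᶠ[ℓ] g) :
    Symbol ℓ m g := fun k => (hf k).congr h

theorem Symbol.neg {m : ℝ} {f : E → F} (hf : Symbol ℓ m f) : Symbol ℓ m (fun x => -f x) :=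
  hf.clm (-ContinuousLinearMap.id ℝ F)

theorem Symbol.sub {m : ℝ} {f g : E → F} (hf : Symbol ℓ m f) (hg : Symbol ℓ m g) :
    Symbol ℓ m (fun x => f x - g x) := by
  simpa [sub_eq_add_neg] using hf.add hg.neg

theorem Symbol.sum {ι : Type} (s : Finset ι) {m : ℝ} {f : ι → E → F}
    (hf : ∀ i ∈ s, Symbol ℓ m (f i)) : Symbol ℓ m (fun x => ∑ i ∈ s, f i x) := by
  classical
  induction s using Finset.induction_on with
  | empty => simpa using Symbol.zero m
  | insert i s hi ih =>
    simp only [Finset.sum_insert hi]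
    exact (hf i (by simp)).add (ih fun j hj => hf j (by simp [hj]))

theorem Symbol.smul [EndFilter ℓ] {m m' : ℝ} {f : E → ℝ} {g : E → F}
    (hf : Symbol ℓ m f) (hg : Symbol ℓ m' g) : Symbol ℓ (m + m') (fun x => f x • g x) :=
  hf.bilin (ContinuousLinearMap.lsmul ℝ ℝ) hg

theorem Symbol.mul [EndFilter ℓ] {m m' : ℝ} {f g : E → ℝ}
    (hf : Symbol ℓ m f) (hg : Symbol ℓ m' g) : Symbol ℓ (m + m') (fun x => f x * g x) :=
  hf.bilin (ContinuousLinearMap.mul ℝ ℝ) hg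

theorem Symbol.const_mul [EndFilter ℓ] (c : ℝ) {m : ℝ} {g : E → ℝ} (hg : Symbol ℓ m g) :
    Symbol ℓ m (fun x => c * g x) := hg.clm (ContinuousLinearMap.mul ℝ ℝ c)

theorem Symbol.prod [EndFilter ℓ] {ι : Type} (s : Finset ι) {m : ι → ℝ} {f : ι → E → ℝ}
    (hf : ∀ i ∈ s, Symbol ℓ (m i) (f i)) : Symbol ℓ (∑ i ∈ s, m i) (fun x => ∏ i ∈ s, f i x) := by
  classical
  induction s using Finset.induction_on with
  | empty => simpa using Symbol.const (1 : ℝ)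
  | insert i s hi ih =>
    simp only [Finset.prod_insert hi, Finset.sum_insert hi]
    exact (hf i (by simp)).mul (ih fun j hj => hf j (by simp [hj]))

theorem Symbol.id [EndFilter ℓ] : Symbol ℓ 1 (fun x : E => x) := by
  intro k
  have h0 : (fun x : E => x) =O[ℓ] fun x => ‖x‖ ^ (1 : ℝ) := by
    simpa using (isBigO_refl (fun x : E => x) ℓ).norm_right
  cases k with
  | zero => exact h0
  | succ k =>
    refine ⟨h0, fun _ => ContinuousLinearMap.id ℝ E,
      Eventually.of_forall fun x => hasFDerivAt_id _, ?_⟩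
    rw [sub_self]
    exact Sym.const _ _

theorem Symbol.of_hasFDerivAt {m : ℝ} {f : E → F} {f' : E → (E →L[ℝ] F)}
    (h0 : f =O[ℓ] fun x => ‖x‖ ^ m) (h1 : ∀ᶠ x in ℓ, HasFDerivAt f (f' x) x)
    (h2 : Symbol ℓ (m - 1) f') : Symbol ℓ m f
  | 0 => h0
  | k + 1 => ⟨h0, f', h1, h2 k⟩

theorem Symbol.differentiableAt {m : ℝ} {f : E → F} (h : Symbol ℓ m f) :
    ∀ᶠ x in ℓ, DifferentiableAt ℝ f x := by
  obtain ⟨-, f', h1, -⟩ := h 1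
  exact h1.mono fun x hx => hx.differentiableAt

theorem Symbol.fderiv [EndFilter ℓ] {m : ℝ} {f : E → F} (h : Symbol ℓ m f) :
    Symbol ℓ (m - 1) (fderiv ℝ f) := by
  intro k
  obtain ⟨-, f', h1, h2⟩ := h (k + 1)
  exact h2.congr (h1.mono fun x hx => hx.fderiv.symm)

theorem Symbol.of_hasDerivAt {ℓ : Filter ℝ} {m : ℝ} {f f' : ℝ → F}
    (h0 : f =O[ℓ] fun x => ‖x‖ ^ m) (h1 : ∀ᶠ x in ℓ, HasDerivAt f (f' x) x)
    (h2 : Symbol ℓ (m - 1) f') : Symbol ℓ m f :=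
  Symbol.of_hasFDerivAt h0 (h1.mono fun _ hx => hx.hasFDerivAt)
    (h2.clm ((ContinuousLinearMap.toSpanSingletonCLE (𝕜 := ℝ) (E := F)).toContinuousLinearMap))

theorem Symbol.deriv {ℓ : Filter ℝ} [EndFilter ℓ] {m : ℝ} {f : ℝ → F} (h : Symbol ℓ m f) :
    Symbol ℓ (m - 1) (deriv f) :=
  h.fderiv.clm (ContinuousLinearMap.apply ℝ F (1 : ℝ))

/-- Composition of symbols. -/
theorem Symbol.comp [EndFilter ℓ] {E₁ : Type} [NormedAddCommGroup E₁] [NormedSpace ℝ E₁]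
    {ℓ₁ : Filter E₁} [EndFilter ℓ₁] {m s : ℝ} {f : E₁ → F} {g : E → E₁} (hf : Symbol ℓ₁ m f)
    (hg : Symbol ℓ s g) (hlim : Tendsto g ℓ ℓ₁)
    (hb : (fun x => ‖g x‖) =Θ[ℓ] fun x => ‖x‖ ^ s) : Symbol ℓ (m * s) (fun x => f (g x)) := by
  -- The exponent may be negative, so an upper bound on g alone would not do; hence the two-sided
  -- comparison `hb`.
  have hO : ∀ m : ℝ, (fun x => ‖g x‖ ^ m) =O[ℓ] fun x => ‖x‖ ^ (m * s) := fun m => by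
    have h := (hb.rpow (r := m) (Eventually.of_forall fun x => norm_nonneg _)
      (Eventually.of_forall fun x => by positivity)).1
    refine h.trans_eventuallyEq (Eventually.of_forall fun x => ?_)
    simp only [← Real.rpow_mul (norm_nonneg x), mul_comm]
  intro k
  induction k generalizing m F with
  | zero => exact ((hf.isBigO).comp_tendsto hlim).trans (hO m)
  | succ k ih =>
    have hf1 := hf.fderiv
    refine ⟨((hf.isBigO).comp_tendsto hlim).trans (hO m),
      fun x => (_root_.fderiv ℝ f (g x)).comp (_root_.fderiv ℝ g x), ?_, ?_⟩
    · filter_upwards [hlim.eventually hf.differentiableAt, hg.differentiableAt] with x hx hy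
      exact hx.hasFDerivAt.comp x hy.hasFDerivAt
    · have := (ih hf1).bilin (ContinuousLinearMap.compL ℝ E E₁ F) (hg.fderiv k)
      have h2 : (m - 1) * s + (s - 1) = m * s - 1 := by ring
      rw [h2] at this
      exact this

end

/-! ### Symbols on the half-line -/

theorem symbol_rpow (m : ℝ) : Symbol atTop m (fun x : ℝ => x ^ m) := by
  have h0 : ∀ m : ℝ, (fun x : ℝ => x ^ m) =O[atTop] fun x : ℝ => ‖x‖ ^ m := fun m => by
    refine EventuallyEq.isBigO ?_
    filter_upwards [eventually_ge_atTop 0] with x hx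
    rw [Real.norm_of_nonneg hx]
  have h1 : ∀ m : ℝ, ∀ᶠ x : ℝ in atTop, HasFDerivAt (fun x : ℝ => x ^ m)
      (ContinuousLinearMap.toSpanSingletonCLE (𝕜 := ℝ) (E := ℝ) (m * x ^ (m - 1))) x := fun m => by
    filter_upwards [eventually_gt_atTop 0] with x hx
    exact (Real.hasDerivAt_rpow_const (Or.inl hx.ne')).hasFDerivAt
  intro k
  induction k generalizing m with
  | zero => exact h0 m
  | succ k ih =>
    exact ⟨h0 m, _, h1 m, ((ih (m - 1)).clm (ContinuousLinearMap.mul ℝ ℝ m)).clm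
      (ContinuousLinearMap.toSpanSingletonCLE (𝕜 := ℝ) (E := ℝ)).toContinuousLinearMap⟩

/-- Since e tends to 0, differentiability of y ↦ (1+y)^s at 0 bounds the value by e. The derivative
is s(1+e)^(s-1) e', a symbol of order 0 times one of order m - 1. -/
theorem symbol_one_add_rpow {m : ℝ} (hm : m < 0) {e : ℝ → ℝ} (he : Symbol atTop m e) (s : ℝ) :
    Symbol atTop m (fun x => (1 + e x) ^ s - 1) := by
  have hlim : Tendsto e atTop (𝓝 0) := by
    refine he.isBigO.trans_tendsto ?_
    have := (tendsto_rpow_neg_atTop (neg_pos.2 hm)).comp tendsto_norm_atTop_atTop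
    simpa [Function.comp_def] using this
  have hpos : ∀ᶠ x in atTop, 0 < 1 + e x := by
    filter_upwards [hlim.eventually (lt_mem_nhds (show (-1 : ℝ) < 0 by norm_num))] with x hx
    linarith
  have hd : ∀ s : ℝ, ∀ᶠ x in atTop, HasDerivAt (fun x => (1 + e x) ^ s)
      (s * ((1 + e x) ^ (s - 1) * deriv e x)) x := fun s => by
    filter_upwards [hpos, he.differentiableAt] with x hx hy
    convert (hy.hasDerivAt.const_add 1).rpow_const (p := s) (Or.inl hx.ne') using 1
    ring
  have hS : ∀ s : ℝ, Symbol atTop 0 (fun x => (1 + e x) ^ s) := by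
    have hO : ∀ s : ℝ, (fun x => (1 + e x) ^ s) =O[atTop] fun x : ℝ => ‖x‖ ^ (0 : ℝ) := fun s => by
      have h1 : Tendsto (fun x => (1 + e x) ^ s) atTop (𝓝 1) := by
        have := (hlim.const_add 1).rpow_const (p := s) (Or.inl (by norm_num))
        simpa using this
      simpa using h1.isBigO_one ℝ
    intro s k
    -- The exponent must vary in the induction, since each derivative replaces s by s - 1.
    induction k generalizing s with
    | zero => exact hO s
    | succ k ih =>
      refine ⟨hO s, _, (hd s).mono fun x hx => hx.hasFDerivAt, ?_⟩
      have h2 := (ih (s - 1)).bilin (ContinuousLinearMap.mul ℝ ℝ) (he.deriv k)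
      have h3 := (h2.mono (show 0 + (m - 1) ≤ 0 - 1 by linarith)).clm
        (ContinuousLinearMap.mul ℝ ℝ s)
      exact h3.clm (ContinuousLinearMap.toSpanSingletonCLE (𝕜 := ℝ) (E := ℝ)).toContinuousLinearMap
  refine Symbol.of_hasDerivAt ?_ ((hd s).mono fun x hx => hx.sub_const 1) ?_
  · have h1 : HasDerivAt (fun y : ℝ => (1 + y) ^ s) (s * (1 + 0) ^ (s - 1)) 0 := by
      have := ((hasDerivAt_id (0 : ℝ)).const_add 1).rpow_const (p := s) (Or.inl (by norm_num))
      simpa using this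
    have h2 := h1.isBigO_sub.comp_tendsto hlim
    refine IsBigO.trans ?_ he.isBigO
    simpa [Function.comp_def] using h2
  · refine ((((hS (s - 1)).mul he.deriv)).const_mul s).mono ?_
    linarith

/-- Integration of a symbol bound. -/
theorem isBigO_of_deriv {m : ℝ} (hm : 0 < m) {g g' : ℝ → ℝ}
    (hg : ∀ᶠ x in atTop, HasDerivAt g (g' x) x) (hO : g' =O[atTop] fun x : ℝ => ‖x‖ ^ (m - 1)) :
    g =O[atTop] fun x : ℝ => ‖x‖ ^ m := by
  obtain ⟨C, hC⟩ := hO.bound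
  obtain ⟨R, hR⟩ := eventually_atTop.1 (hg.and (hC.and (eventually_ge_atTop 1)))
  have hR1 : 1 ≤ R := (hR R le_rfl).2.2
  have key : ∀ x, R ≤ x → ‖g x‖ ≤ ‖g R‖ + C / m * (x ^ m - R ^ m) := by
    intro x hx
    have hpos : ∀ y ∈ Set.Icc R x, HasDerivAt (fun x => ‖g R‖ + C / m * (x ^ m - R ^ m))
        (C / m * (m * y ^ (m - 1))) y := fun y hy =>
      (((Real.hasDerivAt_rpow_const (Or.inl (by linarith [hy.1]))).sub_const _).const_mul _).const_add _
    have := image_norm_le_of_norm_deriv_right_le_deriv_boundary' (f := g) (f' := g') (a := R) (b := x)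
      (B := fun x => ‖g R‖ + C / m * (x ^ m - R ^ m)) (B' := fun x => C / m * (m * x ^ (m - 1)))
      (fun y hy => (hR y hy.1).1.continuousAt.continuousWithinAt)
      (fun y hy => (hR y hy.1).1.hasDerivWithinAt) (by simp)
      (fun y hy => (hpos y hy).continuousAt.continuousWithinAt)
      (fun y hy => (hpos y ⟨hy.1, hy.2.le⟩).hasDerivWithinAt)
      (fun y hy => by
        have h2 := (hR y hy.1).2.1
        have hy1 : 1 ≤ y := (hR y hy.1).2.2
        rw [Real.norm_of_nonneg (by linarith : (0:ℝ) ≤ y),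
          Real.norm_of_nonneg (by positivity : (0:ℝ) ≤ y ^ (m - 1))] at h2
        calc _ ≤ _ := h2
          _ = _ := by field_simp)
    exact this ⟨hx, le_rfl⟩
  refine IsBigO.of_bound (‖g R‖ + |C / m|) ?_
  filter_upwards [eventually_ge_atTop R] with x hx
  have hx1 : 1 ≤ x := hR1.trans hx
  rw [Real.norm_of_nonneg (by linarith : (0:ℝ) ≤ x),
    Real.norm_of_nonneg (by positivity : (0:ℝ) ≤ x ^ m)]
  -- Here m > 0 matters: the constant of integration is absorbed into x^m.
  have h1 : 1 ≤ x ^ m := Real.one_le_rpow hx1 hm.le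
  have h2 : 0 ≤ R ^ m := by positivity
  have h3 : R ^ m ≤ x ^ m := Real.rpow_le_rpow (by linarith) hx hm.le
  calc ‖g x‖ ≤ ‖g R‖ + C / m * (x ^ m - R ^ m) := key x hx
    _ ≤ ‖g R‖ * x ^ m + |C / m| * x ^ m := by
      refine add_le_add (le_mul_of_one_le_right (norm_nonneg _) h1) ?_
      refine (mul_le_mul_of_nonneg_right (le_abs_self _) (by linarith)).trans ?_
      exact mul_le_mul_of_nonneg_left (by linarith) (abs_nonneg _)
    _ = _ := by ring

end Stenzel

end

noncomputable section

namespace Stenzel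

open Filter Asymptotics Topology Bornology

/-! ### The profile at infinity -/

/-- `∫ sinhⁿ⁻¹` as a function of `τ = cosh w`. -/
def sinhIntegral (n : ℕ) (x : ℝ) : ℝ := ∫ u in (0 : ℝ)..Real.arcosh x, Real.sinh u ^ (n - 1)

/-- The derivative of Stenzel's potential `f` as a function of `τ`. -/
def stenzelDeriv (n : ℕ) (x : ℝ) : ℝ := sinhIntegral n x ^ (1 / (n : ℝ)) * (√(x ^ 2 - 1))⁻¹

/-- The derivative of the cone potential `C_n τ ^ (1 - 1/n)` as a function of `τ`. -/
def coneDeriv (n : ℕ) (x : ℝ) : ℝ := ((n : ℝ) - 1) ^ (-(1 / (n : ℝ))) * x ^ (-(1 / (n : ℝ)))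

/-- With sinh w = √(x² - 1), the integrand contributes the power n - 1 of this root and the
derivative of `arcosh` removes one factor. -/
theorem hasDerivAt_sinhIntegral {n : ℕ} (hn : 2 < n) {x : ℝ} (hx : 1 < x) :
    HasDerivAt (sinhIntegral n) ((x ^ 2 - 1) ^ (((n : ℝ) - 2) / 2)) x := by
  have hc : Continuous fun u : ℝ => Real.sinh u ^ (n - 1) := by fun_prop
  have h1 := (hc.integral_hasStrictDerivAt 0 (Real.arcosh x)).hasDerivAt.comp x
    (Real.hasDerivAt_arcosh hx)
  have hpos : 0 < x ^ 2 - 1 := by nlinarith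
  refine h1.congr_deriv ?_
  rw [Real.sinh_arcosh hx.le]
  obtain ⟨m, rfl⟩ : ∃ m, n = m + 2 := ⟨n - 2, by omega⟩
  have h2 : m + 2 - 1 = m + 1 := by omega
  rw [h2, pow_succ, mul_assoc, mul_inv_cancel₀ (Real.sqrt_ne_zero'.2 hpos), mul_one,
    Real.sqrt_eq_rpow, ← Real.rpow_natCast, ← Real.rpow_mul hpos.le]
  congr 1
  push_cast
  ring

theorem hasDerivAt_profile {n : ℕ} {x : ℝ} (hx : 1 < x) :
    HasDerivAt (fun x => profile n (Real.arcosh x)) (stenzelDeriv n x) x := by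
  have hc : Continuous fun s : ℝ => (∫ u in (0 : ℝ)..s, Real.sinh u ^ (n - 1)) ^ (1 / (n : ℝ)) := by
    refine Continuous.rpow_const ?_ fun _ => Or.inr (by positivity)
    exact intervalIntegral.continuous_primitive
      (fun a b => (by fun_prop : Continuous fun u : ℝ => Real.sinh u ^ (n - 1)).intervalIntegrable a b) 0
  exact (hc.integral_hasStrictDerivAt 0 (Real.arcosh x)).hasDerivAt.comp x
    (Real.hasDerivAt_arcosh hx)

theorem symbol_one_sub_rpow (s : ℝ) :
    Symbol atTop (-2) (fun x : ℝ => (1 + -x ^ (-2 : ℝ)) ^ s - 1) :=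
  symbol_one_add_rpow (by norm_num) (symbol_rpow (-2)).neg s

theorem one_add_neg_rpow {x : ℝ} (hx : 1 < x) : x ^ 2 - 1 = x ^ (2 : ℝ) * (1 + -x ^ (-2 : ℝ)) := by
  have h0 : 0 < x := by linarith
  rw [mul_add, mul_neg, ← Real.rpow_add h0]
  norm_num
  ring

theorem one_add_neg_rpow_pos {x : ℝ} (hx : 1 < x) : 0 < 1 + -x ^ (-2 : ℝ) := by
  have := Real.rpow_lt_one_of_one_lt_of_neg hx (show (-2 : ℝ) < 0 by norm_num)
  linarith

theorem sq_sub_one_rpow {x : ℝ} (hx : 1 < x) (s : ℝ) :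
    (x ^ 2 - 1) ^ s = x ^ (2 * s) * (1 + -x ^ (-2 : ℝ)) ^ s := by
  have h0 : 0 < x := by linarith
  rw [one_add_neg_rpow hx, Real.mul_rpow (by positivity) (one_add_neg_rpow_pos hx).le,
    ← Real.rpow_mul h0.le]

/-- The derivative of the difference has order n - 4. For n = 3 that is -1 and integration produces
a logarithm; giving away half a power, to n - 5/2 > 0, treats all n uniformly and still suffices for
the remainder. -/
theorem symbol_sinhIntegral_sub {n : ℕ} (hn : 2 < n) : Symbol atTop ((n : ℝ) - 5 / 2)
    (fun x => sinhIntegral n x - x ^ ((n : ℝ) - 1) / ((n : ℝ) - 1)) := by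
  have hn' : (3 : ℝ) ≤ n := by exact_mod_cast hn
  have h1 : Symbol atTop ((n : ℝ) - 4)
      (fun x : ℝ => (x ^ 2 - 1) ^ (((n : ℝ) - 2) / 2) - x ^ ((n : ℝ) - 2)) := by
    have h2 := (symbol_rpow ((n : ℝ) - 2)).mul (symbol_one_sub_rpow (((n : ℝ) - 2) / 2))
    have h3 : (n : ℝ) - 2 + -2 = n - 4 := by ring
    rw [h3] at h2
    refine h2.congr ?_
    filter_upwards [eventually_gt_atTop 1] with x hx
    rw [sq_sub_one_rpow hx]
    ring_nf
  have h2 : ∀ᶠ x : ℝ in atTop, HasDerivAt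
      (fun x => sinhIntegral n x - x ^ ((n : ℝ) - 1) / ((n : ℝ) - 1))
      ((x ^ 2 - 1) ^ (((n : ℝ) - 2) / 2) - x ^ ((n : ℝ) - 2)) x := by
    filter_upwards [eventually_gt_atTop 1] with x hx
    refine (hasDerivAt_sinhIntegral hn hx).sub ?_
    have h3 := (Real.hasDerivAt_rpow_const (x := x) (p := (n : ℝ) - 1)
      (Or.inl (by linarith))).div_const ((n : ℝ) - 1)
    refine h3.congr_deriv ?_
    have : (n : ℝ) - 1 ≠ 0 := by linarith
    rw [mul_div_right_comm, div_self this, one_mul]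
    ring_nf
  have h3 := h1.mono (show (n : ℝ) - 4 ≤ (n - 5 / 2) - 1 by linarith)
  exact Symbol.of_hasDerivAt (isBigO_of_deriv (by linarith) h2 h3.isBigO) h2 h3

theorem symbol_coneDeriv (n : ℕ) : Symbol atTop (-(1 / (n : ℝ))) (coneDeriv n) :=
  (symbol_rpow _).const_mul _

/-- Up to the factor `coneDeriv`, `stenzelDeriv` is (1+e)^(1/n) (1 - x^(-2))^(-1/2), where e is the
relative error of `sinhIntegral`, of order -3/2. The difference is then `coneDeriv` times A + B +
AB, where A and B are the deviations of the two factors from 1. -/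
theorem symbol_stenzelDeriv_sub {n : ℕ} (hn : 2 < n) : Symbol atTop (-(1 / (n : ℝ)) - 3 / 2)
    (fun x => stenzelDeriv n x - coneDeriv n x) := by
  have hn' : (3 : ℝ) ≤ n := by exact_mod_cast hn
  have hn1 : 0 < (n : ℝ) - 1 := by linarith
  set e : ℝ → ℝ := fun x => ((n : ℝ) - 1) *
    ((sinhIntegral n x - x ^ ((n : ℝ) - 1) / ((n : ℝ) - 1)) * x ^ (1 - (n : ℝ))) with he
  have hes : Symbol atTop (-(3 / 2)) e := by
    have := ((symbol_sinhIntegral_sub hn).mul (symbol_rpow (1 - (n : ℝ)))).const_mul ((n : ℝ) - 1)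
    convert this using 1
    ring
  have hlim : Tendsto e atTop (𝓝 0) := by
    refine hes.isBigO.trans_tendsto ?_
    have := (tendsto_rpow_neg_atTop (show (0 : ℝ) < 3 / 2 by norm_num)).comp tendsto_norm_atTop_atTop
    simpa [Function.comp_def] using this
  have hpos : ∀ᶠ x in atTop, 0 < 1 + e x := by
    filter_upwards [hlim.eventually (lt_mem_nhds (show (-1 : ℝ) < 0 by norm_num))] with x hx
    linarith
  have hA := symbol_one_add_rpow (by norm_num) hes (1 / (n : ℝ))
  have hB := (symbol_one_sub_rpow (-(1 / 2))).mono (show (-2 : ℝ) ≤ -(3 / 2) by norm_num)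
  have hC := (hA.mul hB).mono (show -(3 / 2) + -(3 / 2) ≤ -(3 / 2 : ℝ) by norm_num)
  have hD := (symbol_coneDeriv n).mul ((hA.add hB).add hC)
  have h3 : -(1 / (n : ℝ)) + -(3 / 2) = -(1 / (n : ℝ)) - 3 / 2 := by ring
  rw [h3] at hD
  refine hD.congr ?_
  filter_upwards [eventually_gt_atTop 1, hpos] with x hx hex
  have hx0 : 0 < x := by linarith
  have hK : sinhIntegral n x = ((n : ℝ) - 1)⁻¹ * x ^ ((n : ℝ) - 1) * (1 + e x) := by
    have h5 : x ^ (1 - (n : ℝ)) = (x ^ ((n : ℝ) - 1))⁻¹ := by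
      rw [← Real.rpow_neg hx0.le]; ring_nf
    have h6 : x ^ ((n : ℝ) - 1) ≠ 0 := by positivity
    simp only [he, h5]
    field_simp
    ring
  have hS : (√(x ^ 2 - 1))⁻¹ = x ^ (-1 : ℝ) * (1 + -x ^ (-2 : ℝ)) ^ (-(1 / 2) : ℝ) := by
    have h7 : 0 ≤ x ^ 2 - 1 := by nlinarith
    rw [Real.sqrt_eq_rpow, ← Real.rpow_neg h7, sq_sub_one_rpow hx]
    norm_num
  have hF : sinhIntegral n x ^ (1 / (n : ℝ)) = ((n : ℝ) - 1) ^ (-(1 / (n : ℝ))) *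
      x ^ (1 - 1 / (n : ℝ)) * (1 + e x) ^ (1 / (n : ℝ)) := by
    rw [hK, Real.mul_rpow (by positivity) hex.le, Real.mul_rpow (by positivity) (by positivity),
      Real.inv_rpow hn1.le, ← Real.rpow_neg hn1.le, ← Real.rpow_mul hx0.le]
    congr 3
    field_simp
  have hx1 : x ^ (1 - 1 / (n : ℝ)) * x ^ (-1 : ℝ) = x ^ (-(1 / (n : ℝ))) := by
    rw [← Real.rpow_add hx0]; ring_nf
  simp only [stenzelDeriv, coneDeriv, hF, hS]
  rw [← hx1]
  ring

theorem symbol_stenzelDeriv {n : ℕ} (hn : 2 < n) :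
    Symbol atTop (-(1 / (n : ℝ))) (stenzelDeriv n) := by
  have := ((symbol_stenzelDeriv_sub hn).mono (by linarith)).add (symbol_coneDeriv n)
  simpa using this

/-- `|Φ(z)|²` as a function of `τ = |z|²` on the cone. -/
def shift (x : ℝ) : ℝ := x + 1 / (4 * x)

theorem symbol_shift : Symbol atTop 1 shift := by
  have h1 := Symbol.id.add (((symbol_rpow (-1)).const_mul (1 / 4)).mono (show (-1 : ℝ) ≤ 1 by norm_num))
  refine h1.congr ?_
  filter_upwards [eventually_gt_atTop 0] with x hx
  rw [Real.rpow_neg_one, shift]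
  field_simp

theorem tendsto_shift : Tendsto shift atTop atTop := by
  refine tendsto_atTop_mono' _ ?_ tendsto_id
  filter_upwards [eventually_gt_atTop 0] with x hx
  have : 0 < 1 / (4 * x) := by positivity
  simp only [shift, id]
  linarith

theorem isTheta_shift : (fun x => ‖shift x‖) =Θ[atTop] fun x : ℝ => ‖x‖ ^ (1 : ℝ) := by
  refine ⟨symbol_shift.isBigO.norm_left, IsBigO.of_bound 1 ?_⟩
  filter_upwards [eventually_gt_atTop 0] with x hx
  have : 0 < 1 / (4 * x) := by positivity
  simp only [shift, Real.rpow_one, one_mul, Real.norm_eq_abs, abs_abs]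
  exact abs_le_abs (by linarith) (by linarith)

/-- Factoring `shift x` as x(1 + x^(-2)/4) shows a relative change of order -2. -/
theorem symbol_shift_rpow_sub (m : ℝ) :
    Symbol atTop (m - 2) (fun x : ℝ => shift x ^ m - x ^ m) := by
  have h := (symbol_rpow m).mul (symbol_one_add_rpow (by norm_num)
    ((symbol_rpow (-2)).const_mul (1 / 4)) m)
  refine Symbol.congr (f := fun x : ℝ => x ^ m * ((1 + 1 / 4 * x ^ (-2 : ℝ)) ^ m - 1))
    (by simpa [sub_eq_add_neg] using h) ?_
  filter_upwards [eventually_gt_atTop 0] with x hx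
  have h1 : shift x = x * (1 + 1 / 4 * x ^ (-2 : ℝ)) := by
    rw [shift, Real.rpow_neg hx.le]
    norm_num
    field_simp
  rw [h1, Real.mul_rpow hx.le (by positivity)]
  ring

theorem Symbol.comp_shift {m : ℝ} {f : ℝ → ℝ} (hf : Symbol atTop m f) :
    Symbol atTop m (fun x => f (shift x)) := by
  simpa using hf.comp symbol_shift tendsto_shift isTheta_shift

theorem symbol_stenzelDeriv_shift_sub {n : ℕ} (hn : 2 < n) :
    Symbol atTop (-(1 / (n : ℝ)) - 3 / 2) (fun x => stenzelDeriv n (shift x) - coneDeriv n x) := by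
  have h1 := (symbol_stenzelDeriv_sub hn).comp_shift
  have h2 := ((symbol_shift_rpow_sub (-(1 / (n : ℝ)))).const_mul
    (((n : ℝ) - 1) ^ (-(1 / (n : ℝ))))).mono (show _ ≤ -(1 / (n : ℝ)) - 3 / 2 by linarith)
  convert h1.add h2 using 2
  simp only [coneDeriv]
  ring

/-- The second derivative of the cone potential. -/
def coneDeriv₂ (n : ℕ) (x : ℝ) : ℝ :=
  -(1 / (n : ℝ)) * ((n : ℝ) - 1) ^ (-(1 / (n : ℝ))) * x ^ (-(1 / (n : ℝ)) - 1)

theorem hasDerivAt_coneDeriv {n : ℕ} {x : ℝ} (hx : 0 < x) :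
    HasDerivAt (coneDeriv n) (coneDeriv₂ n x) x := by
  have := (Real.hasDerivAt_rpow_const (x := x) (p := -(1 / (n : ℝ))) (Or.inl hx.ne')).const_mul
    (((n : ℝ) - 1) ^ (-(1 / (n : ℝ))))
  refine this.congr_deriv ?_
  simp only [coneDeriv₂]
  ring

/-- No formula for the second derivative of Stenzel's potential is needed: differentiating the
symbol estimate for the first derivative gives it. -/
theorem symbol_deriv_stenzelDeriv_shift_sub {n : ℕ} (hn : 2 < n) :
    Symbol atTop (-(1 / (n : ℝ)) - 5 / 2)
      (fun x => deriv (stenzelDeriv n) (shift x) - coneDeriv₂ n x) := by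
  have h0 : Symbol atTop (-(1 / (n : ℝ)) - 5 / 2)
      (fun x => deriv (stenzelDeriv n) x - coneDeriv₂ n x) := by
    have h1 := (symbol_stenzelDeriv_sub hn).deriv.mono
      (show _ ≤ -(1 / (n : ℝ)) - 5 / 2 by linarith)
    refine h1.congr ?_
    filter_upwards [eventually_gt_atTop 0, (symbol_stenzelDeriv hn).differentiableAt] with x hx hy
    exact (hy.hasDerivAt.sub (hasDerivAt_coneDeriv hx)).deriv
  have h2 := ((symbol_shift_rpow_sub (-(1 / (n : ℝ)) - 1)).const_mul
    (-(1 / (n : ℝ)) * ((n : ℝ) - 1) ^ (-(1 / (n : ℝ))))).mono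
    (show _ ≤ -(1 / (n : ℝ)) - 5 / 2 by linarith)
  convert h0.comp_shift.add h2 using 2
  simp only [coneDeriv₂]
  ring

end Stenzel

end

noncomputable section

namespace Stenzel

open Filter Asymptotics Topology Bornology ComplexConjugate

/-! ### The bilinear form and conjugation -/

section Algebra

variable {n : ℕ}

theorem dot_comm (v w : Amb n) : dot v w = dot w v := by simp only [dot, mul_comm]

@[simp] theorem dot_add_left (u v w : Amb n) : dot (u + v) w = dot u w + dot v w := by
  simp [dot, add_mul, Finset.sum_add_distrib]

@[simp] theorem dot_add_right (u v w : Amb n) : dot u (v + w) = dot u v + dot u w := by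
  simp [dot, mul_add, Finset.sum_add_distrib]

@[simp] theorem dot_smul_left (c : ℂ) (v w : Amb n) : dot (c • v) w = c * dot v w := by
  simp [dot, Finset.mul_sum, mul_assoc]

@[simp] theorem dot_smul_right (c : ℂ) (v w : Amb n) : dot v (c • w) = c * dot v w := by
  simp [dot, Finset.mul_sum, mul_left_comm]

@[simp] theorem dot_neg_left (v w : Amb n) : dot (-v) w = -dot v w := by simp [dot]

@[simp] theorem dot_neg_right (v w : Amb n) : dot v (-w) = -dot v w := by simp [dot]

@[simp] theorem dot_sub_left (u v w : Amb n) : dot (u - v) w = dot u w - dot v w := by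
  simp [sub_eq_add_neg]

@[simp] theorem dot_sub_right (u v w : Amb n) : dot u (v - w) = dot u v - dot u w := by
  simp [sub_eq_add_neg]

@[simp] theorem dot_zero_left (v : Amb n) : dot 0 v = 0 := by simp [dot]

theorem real_smul_eq (r : ℝ) (v : Amb n) : r • v = (r : ℂ) • v := by
  ext i; simp

@[simp] theorem dot_real_smul_left (c : ℝ) (v w : Amb n) : dot (c • v) w = c * dot v w := by
  rw [real_smul_eq, dot_smul_left]

@[simp] theorem dot_real_smul_right (c : ℝ) (v w : Amb n) : dot v (c • w) = c * dot v w := by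
  rw [real_smul_eq, dot_smul_right]

@[simp] theorem conjVec_add (v w : Amb n) : conjVec (v + w) = conjVec v + conjVec w := by
  ext i; simp [conjVec]

@[simp] theorem conjVec_smul (c : ℂ) (v : Amb n) : conjVec (c • v) = conj c • conjVec v := by
  ext i; simp [conjVec]

@[simp] theorem conjVec_real_smul (c : ℝ) (v : Amb n) : conjVec (c • v) = c • conjVec v := by
  rw [real_smul_eq, conjVec_smul, Complex.conj_ofReal, ← real_smul_eq]

@[simp] theorem conjVec_neg (v : Amb n) : conjVec (-v) = -conjVec v := by
  ext i; simp [conjVec]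

@[simp] theorem conjVec_sub (v w : Amb n) : conjVec (v - w) = conjVec v - conjVec w := by
  simp [sub_eq_add_neg]

@[simp] theorem conjVec_conjVec (v : Amb n) : conjVec (conjVec v) = v := by
  ext i; simp [conjVec]

theorem dot_conjVec_conjVec (v w : Amb n) : dot (conjVec v) (conjVec w) = conj (dot v w) := by
  simp [dot, conjVec]

theorem conj_dot (v w : Amb n) : conj (dot v w) = dot (conjVec v) (conjVec w) :=
  (dot_conjVec_conjVec v w).symm

theorem dot_conjVec_eq_inner (z v : Amb n) : dot (conjVec z) v = inner ℂ z v := by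
  rw [PiLp.inner_apply]
  exact Finset.sum_congr rfl fun i _ => mul_comm _ _

theorem dot_conjVec_self (z : Amb n) : dot (conjVec z) z = ((‖z‖ ^ 2 : ℝ) : ℂ) := by
  rw [dot_conjVec_eq_inner, inner_self_eq_norm_sq_to_K]
  norm_cast

theorem dot_conjVec_right (v z : Amb n) : dot v (conjVec z) = dot (conjVec z) v := dot_comm _ _

theorem conj_dot_conjVec (z v : Amb n) : conj (dot (conjVec z) v) = dot (conjVec v) z := by
  rw [conj_dot, conjVec_conjVec, dot_comm]

theorem norm_dot_conjVec_le (z v : Amb n) : ‖dot (conjVec z) v‖ ≤ ‖z‖ * ‖v‖ := by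
  rw [dot_conjVec_eq_inner]; exact norm_inner_le_norm _ _

theorem re_dot_conjVec_comm (z v : Amb n) : (dot (conjVec z) v).re = (dot (conjVec v) z).re := by
  rw [← conj_dot_conjVec, Complex.conj_re]

@[simp] theorem norm_conjVec (z : Amb n) : ‖conjVec z‖ = ‖z‖ := by
  simp [EuclideanSpace.norm_eq, conjVec]

/-- `dot` as a continuous real bilinear map. -/
def dotR (n : ℕ) : Amb n →L[ℝ] Amb n →L[ℝ] ℂ :=
  (LinearMap.mk₂ ℝ dot dot_add_left (fun c v w => by simp) dot_add_right
    (fun c v w => by simp)).toContinuousBilinearMap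

@[simp] theorem dotR_apply (v w : Amb n) : dotR n v w = dot v w := rfl

/-- `conjVec` as a continuous real linear map. -/
def conjR (n : ℕ) : Amb n →L[ℝ] Amb n :=
  LinearMap.toContinuousLinearMap
    { toFun := conjVec, map_add' := conjVec_add, map_smul' := fun c v => by simp }

@[simp] theorem conjR_apply (v : Amb n) : conjR n v = conjVec v := rfl

/-- The real part of the Hermitian product. -/
def reHerm (n : ℕ) : Amb n →L[ℝ] Amb n →L[ℝ] ℝ :=
  (LinearMap.mk₂ ℝ (fun v w : Amb n => (dot (conjVec v) w).re) (by intros; simp) (by intros; simp)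
    (by intros; simp) (by intros; simp)).toContinuousBilinearMap

@[simp] theorem reHerm_apply (v w : Amb n) : reHerm n v w = (dot (conjVec v) w).re := rfl

/-- The imaginary part of the Hermitian product. -/
def imHerm (n : ℕ) : Amb n →L[ℝ] Amb n →L[ℝ] ℝ :=
  (LinearMap.mk₂ ℝ (fun v w : Amb n => (dot (conjVec v) w).im) (by intros; simp) (by intros; simp)
    (by intros; simp) (by intros; simp)).toContinuousBilinearMap

@[simp] theorem imHerm_apply (v w : Amb n) : imHerm n v w = (dot (conjVec v) w).im := rfl

theorem norm_sq_eq_reHerm (z : Amb n) : ‖z‖ ^ 2 = reHerm n z z := by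
  rw [reHerm_apply, dot_conjVec_self, Complex.ofReal_re]

theorem hasFDerivAt_norm_sq (z : Amb n) :
    HasFDerivAt (fun y : Amb n => ‖y‖ ^ 2) ((2 : ℝ) • reHerm n z) z := by
  have h := (reHerm n).hasFDerivAt_of_bilinear (hasFDerivAt_id z) (hasFDerivAt_id z)
  simp only [norm_sq_eq_reHerm]
  refine h.congr_fderiv ?_
  ext v
  simp [re_dot_conjVec_comm v z]
  ring

end Algebra

/-! ### The metrics -/

/-- The Hessian of ψ(τ) contains 4ψ'' Re⟨z,v⟩ Re⟨z,w⟩. Replacing v, w by iv, iw turns the real parts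
into imaginary parts up to sign, so the average completes this product to Re(⟨z,v⟩ conj⟨z,w⟩). -/
theorem kahlerForm_radial {n : ℕ} {ψ ψ₁ : ℝ → ℝ} {ψ₂ : ℝ} {z : Amb n}
    (h1 : ∀ᶠ x in 𝓝 (‖z‖ ^ 2), HasDerivAt ψ (ψ₁ x) x) (h2 : HasDerivAt ψ₁ ψ₂ (‖z‖ ^ 2))
    (v w : Amb n) : kahlerForm (fun y : Amb n => ψ (‖y‖ ^ 2)) z v w =
      2 * (ψ₁ (‖z‖ ^ 2) * (dot (conjVec v) w).re +
        ψ₂ * (dot (conjVec z) v * conj (dot (conjVec z) w)).re) := by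
  have hc : Tendsto (fun y : Amb n => ‖y‖ ^ 2) (𝓝 z) (𝓝 (‖z‖ ^ 2)) :=
    (by fun_prop : Continuous fun y : Amb n => ‖y‖ ^ 2).tendsto z
  have h3 : fderiv ℝ (fun y : Amb n => ψ (‖y‖ ^ 2)) =ᶠ[𝓝 z]
      fun y => ψ₁ (‖y‖ ^ 2) • ((2 : ℝ) • reHerm n y) := by
    filter_upwards [hc.eventually h1] with y hy
    exact (hy.comp_hasFDerivAt y (hasFDerivAt_norm_sq y)).fderiv
  have h4 : HasFDerivAt (fun y : Amb n => ψ₁ (‖y‖ ^ 2) • ((2 : ℝ) • reHerm n y))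
      (ψ₁ (‖z‖ ^ 2) • ((2 : ℝ) • reHerm n) +
        (ψ₂ • ((2 : ℝ) • reHerm n z)).smulRight ((2 : ℝ) • reHerm n z)) z :=
    (h2.comp_hasFDerivAt z (hasFDerivAt_norm_sq z)).smul ((2 : ℝ) • reHerm n).hasFDerivAt
  rw [kahlerForm, h3.fderiv_eq, h4.fderiv]
  simp
  ring

theorem leadConst_mul {n : ℕ} (hn : 2 < n) :
    leadConst n * (1 - 1 / (n : ℝ)) = ((n : ℝ) - 1) ^ (-(1 / (n : ℝ))) := by
  have hn' : (3 : ℝ) ≤ n := by exact_mod_cast hn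
  have h1 : (n : ℝ) - 1 ≠ 0 := by linarith
  rw [leadConst]
  field_simp

theorem coneDeriv_pos {n : ℕ} (hn : 2 < n) {x : ℝ} (hx : 0 < x) : 0 < coneDeriv n x := by
  have hn' : (3 : ℝ) ≤ n := by exact_mod_cast hn
  have h1 : 0 < (n : ℝ) - 1 := by linarith
  rw [coneDeriv]
  positivity

theorem coneDeriv₂_eq {n : ℕ} {x : ℝ} (hx : 0 < x) :
    coneDeriv₂ n x = -(1 / (n * x)) * coneDeriv n x := by
  rw [coneDeriv₂, coneDeriv, Real.rpow_sub_one hx.ne']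
  field_simp

theorem hasDerivAt_coneDeriv₂ {n : ℕ} (hn : 2 < n) {x : ℝ} (hx : 0 < x) :
    HasDerivAt (coneDeriv₂ n) ((n + 1) / (n ^ 2 * x ^ 2) * coneDeriv n x) x := by
  have hn' : (0 : ℝ) < n := by exact_mod_cast (by omega : 0 < n)
  have h := (Real.hasDerivAt_rpow_const (x := x) (p := -(1 / (n : ℝ)) - 1) (Or.inl hx.ne')).const_mul
    (-(1 / (n : ℝ)) * ((n : ℝ) - 1) ^ (-(1 / (n : ℝ))))
  refine h.congr_deriv ?_
  rw [Real.rpow_sub_one hx.ne', Real.rpow_sub_one hx.ne', coneDeriv]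
  field_simp
  ring

section Metric

variable {n : ℕ} (hn : 2 < n) (a : ℝ)

include hn

theorem coneMetric_eq' {z : Amb n} (hz : z ≠ 0) (v w : Amb n) : coneMetric n a z v w =
    2 * a * (coneDeriv n (‖z‖ ^ 2) * (dot (conjVec v) w).re +
        coneDeriv₂ n (‖z‖ ^ 2) * (dot (conjVec z) v * conj (dot (conjVec z) w)).re) := by
  have hpos : 0 < ‖z‖ ^ 2 := by positivity
  have h1 : ∀ᶠ x in 𝓝 (‖z‖ ^ 2), HasDerivAt (fun x => a * leadConst n * x ^ (1 - 1 / (n : ℝ)))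
      (a * coneDeriv n x) x := by
    filter_upwards [lt_mem_nhds hpos] with x hx
    have := (Real.hasDerivAt_rpow_const (x := x) (p := 1 - 1 / (n : ℝ)) (Or.inl hx.ne')).const_mul
      (a * leadConst n)
    refine this.congr_deriv ?_
    rw [coneDeriv, ← leadConst_mul hn]
    ring_nf
  have := kahlerForm_radial h1 ((hasDerivAt_coneDeriv hpos).const_mul a) v w
  rw [coneMetric]
  refine Eq.trans this ?_
  ring

theorem coneMetric_eq {z : Amb n} (hz : z ≠ 0) (v w : Amb n) : coneMetric n a z v w =
    2 * a * coneDeriv n (‖z‖ ^ 2) * ((dot (conjVec v) w).re -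
        1 / (n * ‖z‖ ^ 2) * (dot (conjVec z) v * conj (dot (conjVec z) w)).re) := by
  rw [coneMetric_eq' hn a hz, coneDeriv₂_eq (by positivity)]
  ring

theorem coneMetric_comm {z : Amb n} (hz : z ≠ 0) (v w : Amb n) :
    coneMetric n a z v w = coneMetric n a z w v := by
  rw [coneMetric_eq hn a hz, coneMetric_eq hn a hz, re_dot_conjVec_comm v w]
  simp only [Complex.mul_re, Complex.conj_re, Complex.conj_im]
  ring

/-- By Cauchy–Schwarz the negative second term of g₀ consumes at most the fraction 1/n of the first.
Neither z on the cone nor v tangent is needed. -/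
theorem coneMetric_self_ge {a : ℝ} (ha : 0 < a) {z : Amb n} (hz : z ≠ 0) (v : Amb n) :
    2 * a * coneDeriv n (‖z‖ ^ 2) * ((1 - 1 / n) * ‖v‖ ^ 2) ≤ coneMetric n a z v v := by
  have hpos : 0 < ‖z‖ ^ 2 := by positivity
  have hn' : (0 : ℝ) < n := by exact_mod_cast (by omega : 0 < n)
  have hF := coneDeriv_pos hn hpos
  rw [coneMetric_eq hn a hz, dot_conjVec_self, Complex.mul_conj, Complex.ofReal_re, Complex.ofReal_re,
    Complex.normSq_eq_norm_sq]
  refine mul_le_mul_of_nonneg_left ?_ (by positivity)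
  have h1 : ‖dot (conjVec z) v‖ ^ 2 ≤ (‖z‖ * ‖v‖) ^ 2 :=
    pow_le_pow_left₀ (norm_nonneg _) (norm_dot_conjVec_le z v) 2
  have h2 : 1 / (n * ‖z‖ ^ 2) * ‖dot (conjVec z) v‖ ^ 2 ≤ 1 / (n * ‖z‖ ^ 2) * (‖z‖ * ‖v‖) ^ 2 :=
    mul_le_mul_of_nonneg_left h1 (by positivity)
  have h3 : 1 / (n * ‖z‖ ^ 2) * (‖z‖ * ‖v‖) ^ 2 = 1 / n * ‖v‖ ^ 2 := by field_simp
  linarith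

/-- The derivative enters the Koszul formula and the Lie derivative only through its values, so the
linear map itself stays existential. -/
theorem hasFDerivAt_coneMetric {z : Amb n} (hz : z ≠ 0) (w u : Amb n) :
    ∃ L : Amb n →L[ℝ] ℝ, HasFDerivAt (fun y => coneMetric n a y w u) L z ∧ ∀ v, L v =
      2 * a * coneDeriv n (‖z‖ ^ 2) * (
        -(1 / (n * ‖z‖ ^ 2)) * (2 * (dot (conjVec z) v).re * (dot (conjVec w) u).re +
          (dot (conjVec v) w * conj (dot (conjVec z) u) +
            dot (conjVec z) w * conj (dot (conjVec v) u)).re)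
        + (n + 1) / (n ^ 2 * (‖z‖ ^ 2) ^ 2) * (2 * (dot (conjVec z) v).re) *
          (dot (conjVec z) w * conj (dot (conjVec z) u)).re) := by
  have hpos : 0 < ‖z‖ ^ 2 := by positivity
  have hQ := hasFDerivAt_norm_sq z
  have h1 := (hasDerivAt_coneDeriv (n := n) hpos).comp_hasFDerivAt z hQ
  have h2 := (hasDerivAt_coneDeriv₂ hn hpos).comp_hasFDerivAt z hQ
  have hr : ∀ u : Amb n, HasFDerivAt (fun y : Amb n => (dot (conjVec y) u).re)
    ((reHerm n).flip u) z := fun u => ((reHerm n).flip u).hasFDerivAt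
  have hi : ∀ u : Amb n, HasFDerivAt (fun y : Amb n => (dot (conjVec y) u).im)
    ((imHerm n).flip u) z := fun u => ((imHerm n).flip u).hasFDerivAt
  have h3 := ((h1.mul_const (dot (conjVec w) u).re).add
    (h2.mul (((hr w).mul (hr u)).add ((hi w).mul (hi u))))).const_mul (2 * a)
  refine ⟨_, h3.congr_of_eventuallyEq ?_, ?_⟩
  · filter_upwards [isOpen_ne.mem_nhds hz] with y hy
    rw [coneMetric_eq' hn a hy]
    simp
  · intro v
    simp [coneDeriv₂_eq hpos]
    ring

end Metric

/-! ### The projection and the Levi-Civita connection -/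

section Connection

variable {n : ℕ}

theorem norm_sq_ofReal_ne {z : Amb n} (hz : z ≠ 0) : ((‖z‖ : ℂ)) ^ 2 ≠ 0 := by
  have : ‖z‖ ≠ 0 := norm_ne_zero_iff.2 hz
  exact_mod_cast pow_ne_zero 2 this

theorem dot_conjVec_self' (z : Amb n) : dot (conjVec z) z = (‖z‖ : ℂ) ^ 2 := by
  rw [dot_conjVec_self]; push_cast; rfl

theorem proj_mem {z : Amb n} (hz : z ≠ 0) (v : Amb n) : proj z v ∈ tang z := by
  have := norm_sq_ofReal_ne hz
  simp [tang, proj, dot_conjVec_right, dot_conjVec_self', this]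

theorem proj_of_mem {z v : Amb n} (hv : v ∈ tang z) : proj z v = v := by
  have : dot z v = 0 := hv
  simp [proj, this]

theorem proj_add (z v w : Amb n) : proj z (v + w) = proj z v + proj z w := by
  simp only [proj, dot_add_right, add_div, add_smul]; abel

theorem proj_smul (z : Amb n) (c : ℂ) (v : Amb n) : proj z (c • v) = c • proj z v := by
  simp only [proj, dot_smul_right, smul_sub, smul_smul, mul_div_assoc]

theorem proj_real_smul (z : Amb n) (c : ℝ) (v : Amb n) : proj z (c • v) = c • proj z v := by
  simp only [real_smul_eq, proj_smul]

theorem proj_conjVec {z : Amb n} (hz : z ≠ 0) : proj z (conjVec z) = 0 := by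
  have := norm_sq_ofReal_ne hz
  simp [proj, dot_conjVec_right, dot_conjVec_self', this]

/-- Hermitian products with tangent vectors only see the projection. -/
theorem dot_conjVec_proj {z u : Amb n} (hu : u ∈ tang z) (d : Amb n) :
    dot (conjVec (proj z d)) u = dot (conjVec d) u := by
  have : dot z u = 0 := hu
  simp [proj, this]

theorem tang_add {z v w : Amb n} (hv : v ∈ tang z) (hw : w ∈ tang z) : v + w ∈ tang z := by
  have h1 : dot z v = 0 := hv
  have h2 : dot z w = 0 := hw
  simp [tang, h1, h2]

theorem tang_smul {z v : Amb n} (c : ℂ) (hv : v ∈ tang z) : c • v ∈ tang z := by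
  have h1 : dot z v = 0 := hv
  simp [tang, h1]

/-! ### The inverse metric and the explicit Levi-Civita derivative -/

/-- The projected position vector. -/
def projSelf (z : Amb n) : Amb n := proj z z

/-- The denominator in the inverse of `g₀` on the tangent space. -/
def metricDen (n : ℕ) (z : Amb n) : ℝ := n * ‖z‖ ^ 2 - ‖projSelf z‖ ^ 2

/-- The inverse of the endomorphism that represents `g₀`, up to a conformal factor. -/
def metricInv (z y : Amb n) : Amb n :=
  y + (dot (conjVec (projSelf z)) y / metricDen n z) • projSelf z

theorem norm_projSelf_sq {z : Amb n} (hz : z ≠ 0) :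
    ‖projSelf z‖ ^ 2 = ‖z‖ ^ 2 - ‖dot z z‖ ^ 2 / ‖z‖ ^ 2 := by
  have h := norm_sq_ofReal_ne hz
  have h1 : ((‖projSelf z‖ ^ 2 : ℝ) : ℂ) = ((‖z‖ ^ 2 - ‖dot z z‖ ^ 2 / ‖z‖ ^ 2 : ℝ) : ℂ) := by
    rw [← dot_conjVec_self, projSelf, dot_conjVec_proj (proj_mem hz z)]
    simp [proj, dot_conjVec_self', dot_conjVec_conjVec]
    rw [← Complex.mul_conj']
    ring
  exact_mod_cast h1

/-- A bound on and off the cone, which makes the inverse metric a symbol on a full neighbourhood of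
infinity. -/
theorem metricDen_ge {z : Amb n} (hz : z ≠ 0) : (n - 1) * ‖z‖ ^ 2 ≤ metricDen n z := by
  have : 0 ≤ ‖dot z z‖ ^ 2 / ‖z‖ ^ 2 := by positivity
  rw [metricDen, norm_projSelf_sq hz]
  linarith

theorem metricDen_pos (hn : 2 < n) {z : Amb n} (hz : z ≠ 0) : 0 < metricDen n z := by
  have hn' : (3 : ℝ) ≤ n := by exact_mod_cast hn
  have h1 : 0 < ‖z‖ ^ 2 := by positivity
  refine lt_of_lt_of_le ?_ (metricDen_ge hz)
  exact mul_pos (by linarith) h1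

theorem metricInv_mem {z y : Amb n} (hz : z ≠ 0) (hy : y ∈ tang z) : metricInv z y ∈ tang z :=
  tang_add hy (tang_smul _ (proj_mem hz z))

theorem dot_conjVec_of_mem {z y : Amb n} (hy : y ∈ tang z) :
    dot (conjVec z) y = dot (conjVec (projSelf z)) y := (dot_conjVec_proj hy z).symm

/-- On tangent vectors z may be replaced by its projection ζ, so g₀ is, up to the factor
2a·`coneDeriv`, the rank-one perturbation Id - ζζ*/(nτ). The Sherman–Morrison formula inverts it as
Id + ζζ*/(nτ - |ζ|²). -/
theorem coneMetric_metricInv (hn : 2 < n) (a : ℝ) {z y u : Amb n} (hz : z ≠ 0) (hy : y ∈ tang z)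
    (hu : u ∈ tang z) : coneMetric n a z (metricInv z y) u =
      2 * a * coneDeriv n (‖z‖ ^ 2) * (dot (conjVec y) u).re := by
  have hden := (metricDen_pos hn hz).ne'
  have hn' : (n : ℝ) ≠ 0 := by exact_mod_cast (by omega : n ≠ 0)
  have hτ : ‖z‖ ^ 2 ≠ 0 := by positivity
  rw [coneMetric_eq hn a hz]
  congr 1
  rw [dot_conjVec_of_mem (metricInv_mem hz hy), dot_conjVec_of_mem hu]
  set ζ := projSelf z
  have h1 : dot (conjVec ζ) ζ = ((n * ‖z‖ ^ 2 - metricDen n z : ℝ) : ℂ) := by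
    rw [dot_conjVec_self]; simp [metricDen, ζ]
  have h2 : dot (conjVec (metricInv z y)) u = dot (conjVec y) u +
      conj (dot (conjVec ζ) y) / metricDen n z * dot (conjVec ζ) u := by
    simp [metricInv, ζ]
  have h3 : dot (conjVec ζ) (metricInv z y) =
      ((n * ‖z‖ ^ 2 / metricDen n z : ℝ) : ℂ) * dot (conjVec ζ) y := by
    have : (metricDen n z : ℂ) ≠ 0 := by exact_mod_cast hden
    simp only [metricInv, dot_add_right, dot_smul_right]
    change _ + _ / _ * dot (conjVec ζ) ζ = _
    rw [h1]
    push_cast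
    field_simp
    ring
  rw [h2, h3, mul_assoc, Complex.re_ofReal_mul]
  have h4 : conj (dot (conjVec ζ) y) / (metricDen n z : ℂ) * dot (conjVec ζ) u =
      ((1 / metricDen n z : ℝ) : ℂ) * (conj (dot (conjVec ζ) y) * dot (conjVec ζ) u) := by
    push_cast; ring
  rw [h4, Complex.add_re, Complex.re_ofReal_mul]
  simp only [Complex.mul_re, Complex.conj_re, Complex.conj_im]
  field_simp
  ring

/-- The Levi-Civita derivative in terms of `d = D_v W`. -/
def christoffel (z v w d : Amb n) : Amb n :=
  metricInv z (proj z d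
    - (1 / (n * ‖z‖ ^ 2 : ℝ) : ℝ) • (dot (conjVec z) d • projSelf z
        + dot (conjVec z) v • w + dot (conjVec z) w • v)
    + ((n + 1) / (n ^ 2 * (‖z‖ ^ 2) ^ 2) : ℝ) •
        ((dot (conjVec z) v * dot (conjVec z) w) • projSelf z))

theorem christoffel_arg_mem {z v w : Amb n} (hz : z ≠ 0) (hv : v ∈ tang z) (hw : w ∈ tang z)
    (d : Amb n) : proj z d
    - (1 / (n * ‖z‖ ^ 2 : ℝ) : ℝ) • (dot (conjVec z) d • projSelf z
        + dot (conjVec z) v • w + dot (conjVec z) w • v)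
    + ((n + 1) / (n ^ 2 * (‖z‖ ^ 2) ^ 2) : ℝ) •
        ((dot (conjVec z) v * dot (conjVec z) w) • projSelf z) ∈ tang z := by
  have h1 : dot z v = 0 := hv
  have h2 : dot z w = 0 := hw
  have h3 : dot z (projSelf z) = 0 := proj_mem hz z
  have h4 : dot z (proj z d) = 0 := proj_mem hz d
  simp [tang, h1, h2, h3, h4]

/-- The choice in `nabla` is a genuine one: the explicit tangent vector satisfies the Koszul
identity, and two solutions differ by a tangent vector of g₀-length zero, which vanishes by
positivity. -/
theorem nabla_eq (hn : 2 < n) {a : ℝ} (ha : 0 < a) {z v : Amb n} {W : Amb n → Amb n} (hz : z ≠ 0)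
    (hv : v ∈ tang z) (hW : W z ∈ tang z) :
    nabla n a z v W = christoffel z v (W z) (fderiv ℝ W z v) := by
  have key : christoffel z v (W z) (fderiv ℝ W z v) ∈ tang z ∧ ∀ u ∈ tang z,
      coneMetric n a z (christoffel z v (W z) (fderiv ℝ W z v)) u =
        coneMetric n a z (fderiv ℝ W z v) u +
      (fderiv ℝ (fun y => coneMetric n a y (W z) u) z v
        + fderiv ℝ (fun y => coneMetric n a y v u) z (W z)
        - fderiv ℝ (fun y => coneMetric n a y v (W z)) z u) / 2 := by
    refine ⟨metricInv_mem hz (christoffel_arg_mem hz hv hW _), fun u hu => ?_⟩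
    rw [christoffel, coneMetric_metricInv hn a hz (christoffel_arg_mem hz hv hW _) hu]
    obtain ⟨L1, h1, h1'⟩ := hasFDerivAt_coneMetric hn a hz (W z) u
    obtain ⟨L2, h2, h2'⟩ := hasFDerivAt_coneMetric hn a hz v u
    obtain ⟨L3, h3, h3'⟩ := hasFDerivAt_coneMetric hn a hz v (W z)
    rw [h1.fderiv, h2.fderiv, h3.fderiv, h1', h2', h3', coneMetric_eq hn a hz]
    generalize W z = w at *
    generalize fderiv ℝ W z v = d
    simp only [conjVec_add, conjVec_sub, conjVec_real_smul, conjVec_smul, dot_add_left, dot_sub_left,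
      dot_real_smul_left, dot_smul_left, dot_conjVec_proj hu, ← dot_conjVec_of_mem hu]
    rw [← conj_dot_conjVec v u, ← conj_dot_conjVec w u, ← conj_dot_conjVec v w]
    simp only [Complex.add_re, Complex.sub_re, Complex.re_ofReal_mul]
    simp only [Complex.mul_re, Complex.mul_im, Complex.conj_re, Complex.conj_im,
      map_mul]
    ring
  have huniq : ∀ t, (t ∈ tang z ∧ ∀ u ∈ tang z,
      coneMetric n a z t u = coneMetric n a z (fderiv ℝ W z v) u +
      (fderiv ℝ (fun y => coneMetric n a y (W z) u) z v
        + fderiv ℝ (fun y => coneMetric n a y v u) z (W z)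
        - fderiv ℝ (fun y => coneMetric n a y v (W z)) z u) / 2) →
      t = christoffel z v (W z) (fderiv ℝ W z v) := by
    rintro t ⟨ht, h⟩
    set c := christoffel z v (W z) (fderiv ℝ W z v)
    have hm : t - c ∈ tang z := by
      have h1 : dot z t = 0 := ht
      have h2 : dot z c = 0 := key.1
      simp [tang, h1, h2]
    have h0 : coneMetric n a z (t - c) (t - c) = 0 := by
      have h1 := (h _ hm).trans (key.2 _ hm).symm
      rw [coneMetric_eq hn a hz] at h1 ⊢
      rw [coneMetric_eq hn a hz] at h1
      simp only [conjVec_sub, dot_sub_left, dot_sub_right, map_sub, Complex.sub_re, Complex.mul_re,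
        Complex.conj_re, Complex.conj_im, Complex.sub_im] at h1 ⊢
      linear_combination h1
    have h1 := coneMetric_self_ge hn ha hz (t - c)
    have hF := coneDeriv_pos hn (show 0 < ‖z‖ ^ 2 by positivity)
    have hn' : (3 : ℝ) ≤ n := by exact_mod_cast hn
    have h2 : 0 < 1 - 1 / (n : ℝ) := by
      rw [sub_pos, div_lt_one (by linarith)]; linarith
    rw [h0] at h1
    by_contra hne
    have h3 : 0 < ‖t - c‖ ^ 2 := by
      have := sub_ne_zero.2 hne
      positivity
    have : 0 < 2 * a * coneDeriv n (‖z‖ ^ 2) * ((1 - 1 / n) * ‖t - c‖ ^ 2) := by positivity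
    linarith
  exact huniq _ (Classical.epsilon_spec (p := fun t => t ∈ tang z ∧ ∀ u ∈ tang z,
      coneMetric n a z t u = coneMetric n a z (fderiv ℝ W z v) u +
      (fderiv ℝ (fun y => coneMetric n a y (W z) u) z v
        + fderiv ℝ (fun y => coneMetric n a y v u) z (W z)
        - fderiv ℝ (fun y => coneMetric n a y v (W z)) z u) / 2) ⟨_, key⟩)

end Connection

end Stenzel

end

noncomputable section

namespace Stenzel

open Filter Asymptotics Topology Bornology ComplexConjugate

/-! ### Symbols on the ambient space -/

section Ambient

variable {n : ℕ}

theorem Symbol.dot {m m' : ℝ} {v w : Amb n → Amb n} (hv : Symbol (cobounded _) m v)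
    (hw : Symbol (cobounded _) m' w) :
    Symbol (cobounded _) (m + m') (fun z => Stenzel.dot (v z) (w z)) :=
  hv.bilin (dotR n) hw

theorem Symbol.conjVec {m : ℝ} {v : Amb n → Amb n} (hv : Symbol (cobounded _) m v) :
    Symbol (cobounded _) m (fun z => Stenzel.conjVec (v z)) :=
  hv.clm (conjR n)

theorem Symbol.csmul {m m' : ℝ} {c : Amb n → ℂ} {w : Amb n → Amb n} (hc : Symbol (cobounded _) m c)
    (hw : Symbol (cobounded _) m' w) : Symbol (cobounded _) (m + m') (fun z => c z • w z) :=
  hc.bilin (ContinuousLinearMap.lsmul ℝ ℂ) hw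

theorem Symbol.cmul {m m' : ℝ} {c d : Amb n → ℂ} (hc : Symbol (cobounded _) m c)
    (hd : Symbol (cobounded _) m' d) : Symbol (cobounded _) (m + m') (fun z => c z * d z) :=
  hc.bilin (ContinuousLinearMap.mul ℝ ℂ) hd

theorem Symbol.re {m : ℝ} {c : Amb n → ℂ} (hc : Symbol (cobounded _) m c) :
    Symbol (cobounded _) m (fun z => (c z).re) := hc.clm Complex.reCLM

theorem Symbol.conj {m : ℝ} {c : Amb n → ℂ} (hc : Symbol (cobounded _) m c) :
    Symbol (cobounded _) m (fun z => conj (c z)) :=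
  hc.clm (Complex.conjCLE : ℂ →L[ℝ] ℂ)

theorem Symbol.norm_sq {m : ℝ} {v : Amb n → Amb n} (hv : Symbol (cobounded _) m v) :
    Symbol (cobounded _) (m + m) (fun z => ‖v z‖ ^ 2) := by
  simp only [norm_sq_eq_reHerm]
  exact hv.bilin (reHerm n) hv

/-- Composition of a symbol on the half-line with a function comparable to `τ`. -/
theorem Symbol.comp_quadratic {m : ℝ} {f : ℝ → ℝ} (hf : Symbol atTop m f) {σ : Amb n → ℝ}
    (hσ : Symbol (cobounded _) 2 σ) {c : ℝ} (hc : 0 < c)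
    (hb : ∀ᶠ z in cobounded (Amb n), c * ‖z‖ ^ 2 ≤ σ z) :
    Symbol (cobounded _) (2 * m) (fun z => f (σ z)) := by
  have h2 : Tendsto (fun z : Amb n => c * ‖z‖ ^ 2) (cobounded _) atTop :=
    ((tendsto_pow_atTop two_ne_zero).comp tendsto_norm_cobounded_atTop).const_mul_atTop hc
  have h := hf.comp hσ (tendsto_atTop_mono' _ hb h2) ⟨hσ.isBigO.norm_left, ?_⟩
  · rwa [mul_comm] at h
  · refine IsBigO.of_bound c⁻¹ ?_
    filter_upwards [hb] with z hz
    have h3 : 0 ≤ σ z := le_trans (by positivity) hz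
    have h4 : ‖z‖ ^ (2 : ℝ) = ‖z‖ ^ 2 := by norm_cast
    rw [norm_norm, Real.norm_of_nonneg h3, h4, Real.norm_of_nonneg (by positivity),
      inv_mul_eq_div, le_div_iff₀ hc, mul_comm]
    exact hz

theorem symbol_id : Symbol (cobounded _) 1 (fun z : Amb n => z) := Symbol.id

theorem symbol_norm_sq : Symbol (cobounded _) 2 (fun z : Amb n => ‖z‖ ^ 2) := by
  have := (symbol_id (n := n)).norm_sq
  norm_num at this
  exact this

theorem Symbol.comp_norm_sq {m : ℝ} {f : ℝ → ℝ} (hf : Symbol atTop m f) :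
    Symbol (cobounded _) (2 * m) (fun z : Amb n => f (‖z‖ ^ 2)) :=
  hf.comp_quadratic symbol_norm_sq one_pos (Eventually.of_forall fun z => by simp)

theorem symbol_inv : Symbol atTop (-1) (fun x : ℝ => x⁻¹) :=
  (symbol_rpow (-1)).congr (Eventually.of_forall fun x => Real.rpow_neg_one x)

theorem symbol_inv_norm_sq : Symbol (cobounded _) (-2) (fun z : Amb n => (‖z‖ ^ 2)⁻¹) := by
  simpa using (symbol_inv.comp_norm_sq (n := n))

theorem eventually_ne_zero : ∀ᶠ z in cobounded (Amb n), z ≠ 0 :=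
  eventually_norm_pos.mono fun _ h => norm_pos_iff.1 h

theorem proj_eq (z v : Amb n) : proj z v = v - (‖z‖ ^ 2)⁻¹ • (dot z v • conjVec z) := by
  rw [proj, real_smul_eq, smul_smul, Complex.ofReal_inv, Complex.ofReal_pow, inv_mul_eq_div]

theorem Symbol.proj {m : ℝ} {v : Amb n → Amb n} (hv : Symbol (cobounded _) m v) :
    Symbol (cobounded _) m (fun z => Stenzel.proj z (v z)) := by
  simp only [proj_eq]
  refine hv.sub ?_
  have := symbol_inv_norm_sq.smul ((symbol_id.dot hv).csmul (symbol_id (n := n)).conjVec)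
  exact this.mono (by linarith)

theorem symbol_proj (v : Amb n) : Symbol (cobounded _) 0 (fun z => proj z v) :=
  (Symbol.const v).proj

theorem symbol_projSelf : Symbol (cobounded _) 1 (fun z : Amb n => projSelf z) := symbol_id.proj

theorem symbol_metricDen_inv (hn : 2 < n) :
    Symbol (cobounded _) (-2) (fun z : Amb n => (metricDen n z)⁻¹) := by
  have hn' : (3 : ℝ) ≤ n := by exact_mod_cast hn
  have h1 : Symbol (cobounded _) 2 (fun z : Amb n => metricDen n z) := by
    have := (symbol_norm_sq.const_mul (n : ℝ)).sub
      ((symbol_projSelf (n := n)).norm_sq.mono (show (1 : ℝ) + 1 ≤ 2 by norm_num))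
    exact this
  have := symbol_inv.comp_quadratic h1 (c := n - 1) (by linarith)
    (eventually_ne_zero.mono fun z hz => metricDen_ge hz)
  simpa using this

theorem Symbol.metricInv (hn : 2 < n) {m : ℝ} {v : Amb n → Amb n} (hv : Symbol (cobounded _) m v) :
    Symbol (cobounded _) m (fun z => Stenzel.metricInv z (v z)) := by
  have h := (symbol_metricDen_inv hn).smul (((symbol_projSelf (n := n)).conjVec.dot hv).csmul
    symbol_projSelf)
  refine (hv.add (h.mono (by linarith))).congr (Eventually.of_forall fun z => ?_)
  simp only [Stenzel.metricInv, real_smul_eq, smul_smul, Complex.ofReal_inv]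
  rw [inv_mul_eq_div]

/-- Every correction to D_v W carries one power of |z| less than the product of the arguments: the
factors τ^(-1) and τ^(-2) come with one and three factors of z respectively. -/
theorem Symbol.christoffel (hn : 2 < n) {v w d : Amb n → Amb n} (hv : Symbol (cobounded _) 0 v)
    (hw : Symbol (cobounded _) 0 w) (hd : Symbol (cobounded _) (-1) d) :
    Symbol (cobounded _) (-1) (fun z => Stenzel.christoffel z (v z) (w z) (d z)) := by
  have hz := (symbol_id (n := n)).conjVec
  have h1 : Symbol (cobounded _) 1 (fun z : Amb n => Stenzel.dot (Stenzel.conjVec z) (d z) • projSelf z +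
      Stenzel.dot (Stenzel.conjVec z) (v z) • w z + Stenzel.dot (Stenzel.conjVec z) (w z) • v z) :=
    ((((hz.dot hd).csmul symbol_projSelf).mono (by norm_num)).add
      (((hz.dot hv).csmul hw).mono (by norm_num))).add (((hz.dot hw).csmul hv).mono (by norm_num))
  have h2 := ((hz.dot hv).cmul (hz.dot hw)).csmul (symbol_projSelf (n := n))
  have h3 := ((symbol_inv_norm_sq (n := n)).const_mul ((n : ℝ)⁻¹)).smul h1
  have h4 := (((symbol_inv_norm_sq (n := n)).mul symbol_inv_norm_sq).const_mul
    (((n : ℝ) + 1) / n ^ 2)).smul h2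
  refine Symbol.metricInv hn ?_
  refine ((hd.proj.sub (h3.mono (by norm_num))).add (h4.mono (by norm_num))).congr
    (Eventually.of_forall fun z => ?_)
  have e1 : (1 / (n * ‖z‖ ^ 2) : ℝ) = (n : ℝ)⁻¹ * (‖z‖ ^ 2)⁻¹ := by rw [one_div, mul_inv]
  have e2 : ((n + 1) / (n ^ 2 * (‖z‖ ^ 2) ^ 2) : ℝ) =
      ((n : ℝ) + 1) / n ^ 2 * ((‖z‖ ^ 2)⁻¹ * (‖z‖ ^ 2)⁻¹) := by
    rw [← mul_inv, ← sq, div_mul_eq_div_div, div_eq_mul_inv _ ((‖z‖ ^ 2) ^ 2)]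
  simp only [e1, e2]

theorem hasFDerivAt_proj {z : Amb n} (hz : z ≠ 0) (v : Amb n) :
    ∃ L : Amb n →L[ℝ] Amb n, HasFDerivAt (fun y => proj y v) L z ∧ ∀ u, L u =
      -((‖z‖ ^ 2)⁻¹ • (dot z v • conjVec u + dot u v • conjVec z) -
        (2 * (dot (conjVec z) u).re / (‖z‖ ^ 2) ^ 2) • (dot z v • conjVec z)) := by
  have hpos : ‖z‖ ^ 2 ≠ 0 := by positivity
  have h1 : HasFDerivAt (fun y => dot y v • conjVec y) _ z :=
    (ContinuousLinearMap.lsmul ℝ ℂ : ℂ →L[ℝ] Amb n →L[ℝ] Amb n).hasFDerivAt_of_bilinear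
      ((dotR n).flip v).hasFDerivAt (conjR n).hasFDerivAt
  have h2 := (hasDerivAt_inv hpos).comp_hasFDerivAt z (hasFDerivAt_norm_sq z)
  have h3 := (h2.smul h1).const_sub v
  refine ⟨_, h3.congr_of_eventuallyEq (Eventually.of_forall fun y => proj_eq y v), fun u => ?_⟩
  simp
  module

theorem differentiableAt_proj {z : Amb n} (hz : z ≠ 0) (v : Amb n) :
    DifferentiableAt ℝ (fun y => proj y v) z := by
  obtain ⟨L, h, -⟩ := hasFDerivAt_proj hz v
  exact h.differentiableAt

/-- The Levi-Civita derivative of projected constant vector fields. -/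
def conn (n : ℕ) (z u v : Amb n) : Amb n :=
  christoffel z (proj z u) (proj z v) (fderiv ℝ (fun y => proj y v) z (proj z u))

theorem nabla_proj (hn : 2 < n) {a : ℝ} (ha : 0 < a) {z : Amb n} (hz : z ≠ 0) (u v : Amb n) :
    nabla n a z (proj z u) (fun y => proj y v) = conn n z u v :=
  nabla_eq hn ha hz (proj_mem hz u) (proj_mem hz v)

theorem conn_mem {z : Amb n} (hz : z ≠ 0) (u v : Amb n) : conn n z u v ∈ tang z :=
  metricInv_mem hz (christoffel_arg_mem hz (proj_mem hz u) (proj_mem hz v) _)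

theorem symbol_conn (hn : 2 < n) (u v : Amb n) :
    Symbol (cobounded _) (-1) (fun z => conn n z u v) := by
  refine (symbol_proj u).christoffel hn (symbol_proj v) ?_
  have := (symbol_proj v).fderiv.bilin (ContinuousLinearMap.id ℝ (Amb n →L[ℝ] Amb n)) (symbol_proj u)
  simpa using this

theorem metricInv_add (z y y' : Amb n) : metricInv z (y + y') = metricInv z y + metricInv z y' := by
  simp only [metricInv, dot_add_right, add_div, add_smul]; abel

theorem metricInv_real_smul (z : Amb n) (c : ℝ) (y : Amb n) :
    metricInv z (c • y) = c • metricInv z y := by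
  simp only [metricInv, real_smul_eq, dot_smul_right, smul_add, smul_smul, mul_div_assoc]

/-- `conn` as a bilinear map. -/
def connL (n : ℕ) {z : Amb n} (hz : z ≠ 0) : Amb n →ₗ[ℝ] Amb n →ₗ[ℝ] Amb n := by
  have hd : ∀ v w : Amb n, fderiv ℝ (fun y => proj y (v + w)) z =
      fderiv ℝ (fun y => proj y v) z + fderiv ℝ (fun y => proj y w) z := fun v w => by
    simp only [proj_add]
    exact fderiv_add (differentiableAt_proj hz v) (differentiableAt_proj hz w)
  have hs : ∀ (c : ℝ) (v : Amb n), fderiv ℝ (fun y => proj y (c • v)) z =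
      c • fderiv ℝ (fun y => proj y v) z := fun c v => by
    simp only [proj_real_smul]
    exact fderiv_const_smul (differentiableAt_proj hz v) c
  refine LinearMap.mk₂ ℝ (conn n z) ?_ ?_ ?_ ?_
  · intro u u' v
    simp only [conn, christoffel, proj_add, map_add, ← metricInv_add, dot_add_right]
    congr 1
    module
  · intro c u v
    simp only [conn, christoffel, proj_real_smul, map_smul, ← metricInv_real_smul,
      dot_real_smul_right]
    congr 1
    simp only [real_smul_eq]
    module
  · intro u v v'
    simp only [conn, christoffel, hd, add_apply]
    simp only [proj_add, ← metricInv_add, dot_add_right]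
    congr 1
    module
  · intro c u v
    simp only [conn, christoffel, hs, smul_apply]
    simp only [proj_real_smul, ← metricInv_real_smul, dot_real_smul_right]
    congr 1
    simp only [real_smul_eq]
    module

@[simp] theorem connL_apply {z : Amb n} (hz : z ≠ 0) (u v : Amb n) :
    connL n hz u v = conn n z u v := rfl

/-- `proj z` as a linear map. -/
def projL (z : Amb n) : Amb n →ₗ[ℝ] Amb n where
  toFun := proj z
  map_add' := proj_add z
  map_smul' := proj_real_smul z

@[simp] theorem projL_apply (z v : Amb n) : projL z v = proj z v := rfl

end Ambient

end Stenzel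

end

noncomputable section

namespace Stenzel

open Filter Asymptotics Topology Bornology ComplexConjugate

/-! ### Tensors with symbol coefficients -/

section TensorSymbols

variable {n q : ℕ}

/-- A real basis of the ambient space. -/
def ambBasis (n : ℕ) : Module.Basis (Fin (Module.finrank ℝ (Amb n))) ℝ (Amb n) :=
  Module.finBasis ℝ (Amb n)

/-- The coordinates with respect to `ambBasis`. -/
def coordL (n : ℕ) (j : Fin (Module.finrank ℝ (Amb n))) : Amb n →L[ℝ] ℝ :=
  LinearMap.toContinuousLinearMap ((ambBasis n).coord j)

/-- Tensors that are multilinear near infinity, with coefficients that are symbols of order `l`. -/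
def TSym (l : ℝ) (T : Tensor n q) : Prop :=
  ∃ c : (Fin q → Fin (Module.finrank ℝ (Amb n))) → Amb n → ℝ,
    (∀ I, Symbol (cobounded _) l (c I)) ∧
    ∀ᶠ z in cobounded (Amb n), ∀ v, T z v = ∑ I, c I z * ∏ i, coordL n (I i) (v i)

theorem multilinear_expand (M : MultilinearMap ℝ (fun _ : Fin q => Amb n) ℝ) (v : Fin q → Amb n) :
    M v = ∑ I : Fin q → Fin (Module.finrank ℝ (Amb n)),
      M (fun i => ambBasis n (I i)) * ∏ i, coordL n (I i) (v i) := by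
  have h1 : v = fun i => ∑ j, coordL n j (v i) • ambBasis n j := by
    funext i
    exact ((ambBasis n).sum_repr (v i)).symm
  conv_lhs => rw [h1]
  rw [M.map_sum]
  refine Finset.sum_congr rfl fun I _ => ?_
  rw [M.map_smul_univ (fun i => coordL n (I i) (v i)) (fun i => ambBasis n (I i)), smul_eq_mul,
    mul_comm]

theorem TSym.of_multilinear {l : ℝ} {T : Tensor n q}
    (h : ∀ᶠ z in cobounded (Amb n), ∃ M : MultilinearMap ℝ (fun _ : Fin q => Amb n) ℝ, ∀ v, T z v = M v)
    (hs : ∀ v, Symbol (cobounded _) l (fun z => T z v)) : TSym l T := by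
  refine ⟨fun I z => T z fun i => ambBasis n (I i), fun I => hs _, ?_⟩
  filter_upwards [h] with z ⟨M, hM⟩ v
  simp only [hM]
  exact multilinear_expand M v

theorem TSym.multilinear {l : ℝ} {T : Tensor n q} (h : TSym l T) :
    ∀ᶠ z in cobounded (Amb n), ∃ M : MultilinearMap ℝ (fun _ : Fin q => Amb n) ℝ, ∀ v, T z v = M v := by
  obtain ⟨c, -, hT⟩ := h
  filter_upwards [hT] with z hz
  refine ⟨∑ I, c I z • (MultilinearMap.mkPiAlgebra ℝ (Fin q) ℝ).compLinearMap
    (fun i => (coordL n (I i) : Amb n →ₗ[ℝ] ℝ)), fun v => ?_⟩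
  rw [hz, sum_apply]
  simp

theorem TSym.eval {l : ℝ} {T : Tensor n q} (h : TSym l T) {m : Fin q → ℝ} {W : Fin q → Amb n → Amb n}
    (hW : ∀ i, Symbol (cobounded _) (m i) (W i)) :
    Symbol (cobounded _) (l + ∑ i, m i) (fun z => T z fun i => W i z) := by
  obtain ⟨c, hc, hT⟩ := h
  have h1 := Symbol.sum Finset.univ fun I _ => (hc I).mul
    (Symbol.prod Finset.univ fun i _ => (hW i).clm (coordL n (I i)))
  exact h1.congr (hT.mono fun z hz => (hz _).symm)

theorem TSym.mono {l l' : ℝ} {T : Tensor n q} (h : TSym l T) (hl : l ≤ l') : TSym l' T := by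
  obtain ⟨c, hc, hT⟩ := h
  exact ⟨c, fun I => (hc I).mono hl, hT⟩

theorem TSym.add {l : ℝ} {T T' : Tensor n q} (h : TSym l T) (h' : TSym l T') :
    TSym l (fun z v => T z v + T' z v) := by
  obtain ⟨c, hc, hT⟩ := h
  obtain ⟨c', hc', hT'⟩ := h'
  refine ⟨fun I z => c I z + c' I z, fun I => (hc I).add (hc' I), ?_⟩
  filter_upwards [hT, hT'] with z hz hz' v
  rw [hz, hz', ← Finset.sum_add_distrib]
  simp only [add_mul]

theorem TSym.sub {l : ℝ} {T T' : Tensor n q} (h : TSym l T) (h' : TSym l T') :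
    TSym l (fun z v => T z v - T' z v) := by
  obtain ⟨c, hc, hT⟩ := h
  obtain ⟨c', hc', hT'⟩ := h'
  refine ⟨fun I z => c I z - c' I z, fun I => (hc I).sub (hc' I), ?_⟩
  filter_upwards [hT, hT'] with z hz hz' v
  rw [hz, hz', ← Finset.sum_sub_distrib]
  simp only [sub_mul]

theorem TSym.differentiableAt {l : ℝ} {T : Tensor n q} (h : TSym l T) :
    ∀ᶠ z in cobounded (Amb n), ∀ v : Fin q → Amb n,
      DifferentiableAt ℝ (fun y => T y fun i => proj y (v i)) z := by
  obtain ⟨c, hc, hT⟩ := h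
  have h1 : ∀ᶠ z in cobounded (Amb n), ∀ I, DifferentiableAt ℝ (c I) z :=
    eventually_all.2 fun I => (hc I).differentiableAt
  filter_upwards [h1, EndFilter.nhds _ hT, eventually_ne_zero] with z h1 h2 h3 v
  refine DifferentiableAt.congr_of_eventuallyEq (f := fun y =>
    ∑ I, c I y * ∏ i, coordL n (I i) (proj y (v i))) ?_ (h2.mono fun y hy => hy _)
  refine DifferentiableAt.fun_sum fun I _ => (h1 I).mul ?_
  have h4 : ∀ i ∈ (Finset.univ : Finset (Fin q)),
      DifferentiableAt ℝ (fun y => coordL n (I i) (proj y (v i))) z := fun i _ =>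
    (coordL n (I i)).differentiableAt.comp z (differentiableAt_proj h3 (v i))
  exact (HasFDerivAt.finsetProd fun i hi => (h4 i hi).hasFDerivAt).differentiableAt

theorem TSym.bound {l : ℝ} {T : Tensor n q} (h : TSym l T) :
    ∃ K : ℝ, 0 ≤ K ∧ ∀ᶠ z in cobounded (Amb n), ∀ v, |T z v| ≤ K * ‖z‖ ^ l * ∏ i, ‖v i‖ := by
  obtain ⟨c, hc, hT⟩ := h
  choose C hC using fun I => (hc I).isBigO.bound
  have hC' := eventually_all.2 hC
  refine ⟨∑ I, |C I| * ∏ i, ‖coordL n (I i)‖, by positivity, ?_⟩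
  filter_upwards [hT, hC'] with z hz hb v
  rw [hz, Finset.sum_mul, Finset.sum_mul]
  refine (Finset.abs_sum_le_sum_abs _ _).trans (Finset.sum_le_sum fun I _ => ?_)
  rw [abs_mul, Finset.abs_prod]
  have h1 : |c I z| ≤ |C I| * ‖z‖ ^ l := by
    have := hb I
    rw [Real.norm_eq_abs, Real.norm_of_nonneg (by positivity)] at this
    exact this.trans (mul_le_mul_of_nonneg_right (le_abs_self _) (by positivity))
  have h2 : ∏ i, |coordL n (I i) (v i)| ≤ ∏ i, (‖coordL n (I i)‖ * ‖v i‖) :=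
    Finset.prod_le_prod (fun _ _ => abs_nonneg _) fun i _ => (coordL n (I i)).le_opNorm _
  rw [Finset.prod_mul_distrib] at h2
  calc _ ≤ (|C I| * ‖z‖ ^ l) * ((∏ i, ‖coordL n (I i)‖) * ∏ i, ‖v i‖) :=
        mul_le_mul h1 h2 (Finset.prod_nonneg fun _ _ => abs_nonneg _) (by positivity)
    _ = _ := by ring

/-- The derivative of a tensor along projected constant fields, as a multilinear map. -/
def derivMultilinear {T : Tensor n q} {z : Amb n}
    (hM : ∀ᶠ y in 𝓝 z, ∃ M : MultilinearMap ℝ (fun _ : Fin q => Amb n) ℝ, ∀ v, T y v = M v)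
    (hd : ∀ v : Fin q → Amb n, DifferentiableAt ℝ (fun y => T y fun i => proj y (v i)) z) :
    MultilinearMap ℝ (fun _ : Fin q => Amb n) (Amb n →L[ℝ] ℝ) where
  toFun v := fderiv ℝ (fun y => T y fun i => proj y (v i)) z
  map_update_add' := by
    intro inst v i x x'
    -- The field quantifies over all decidability instances; fixing the canonical one makes the
    -- updates agree with those of `M`.
    obtain rfl : inst = instDecidableEqFin q := Subsingleton.elim _ _
    rw [← fderiv_add (hd _) (hd _)]
    refine Filter.EventuallyEq.fderiv_eq ?_
    filter_upwards [hM] with y ⟨M, hM⟩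
    have := (M.compLinearMap fun _ => projL y).map_update_add v i x x'
    change T y _ = T y _ + T y _
    rw [hM, hM, hM]
    exact this
  map_update_smul' := by
    intro inst v i c x
    obtain rfl : inst = instDecidableEqFin q := Subsingleton.elim _ _
    rw [← fderiv_const_smul (hd _)]
    refine Filter.EventuallyEq.fderiv_eq ?_
    filter_upwards [hM] with y ⟨M, hM⟩
    have := (M.compLinearMap fun _ => projL y).map_update_smul v i c x
    change T y _ = c • T y _
    rw [hM, hM]
    exact this

theorem covDeriv_eq (hn : 2 < n) {a : ℝ} (ha : 0 < a) (T : Tensor n q) {z : Amb n} (hz : z ≠ 0)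
    (v : Fin (q + 1) → Amb n) : covDeriv n a T z v =
    fderiv ℝ (fun y => T y fun i => proj y (v i.succ)) z (proj z (v 0)) -
    ∑ i : Fin q, T z (Function.update (fun j => proj z (v j.succ)) i (conn n z (v 0) (v i.succ))) := by
  simp only [covDeriv, nabla_proj hn ha hz]

/-- Linearity in the direction v₀ is separated from multilinearity in the remaining slots by
currying. Multilinearity of T is required on a neighbourhood because T gets differentiated. -/
theorem covDeriv_multilinear (hn : 2 < n) {a : ℝ} (ha : 0 < a) {T : Tensor n q} {z : Amb n} (hz : z ≠ 0)
    (hM : ∀ᶠ y in 𝓝 z, ∃ M : MultilinearMap ℝ (fun _ : Fin q => Amb n) ℝ, ∀ v, T y v = M v)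
    (hd : ∀ v : Fin q → Amb n, DifferentiableAt ℝ (fun y => T y fun i => proj y (v i)) z) :
    ∃ M : MultilinearMap ℝ (fun _ : Fin (q + 1) => Amb n) ℝ, ∀ v, covDeriv n a T z v = M v := by
  obtain ⟨M, hMz⟩ := hM.self_of_nhds
  have hupd : ∀ (i : Fin q) (N : Amb n →ₗ[ℝ] Amb n) (v : Fin q → Amb n),
      (M.compLinearMap (Function.update (fun _ => projL z) i N)) v =
        M (Function.update (fun j => proj z (v j)) i (N (v i))) := fun i N v => by
    rw [MultilinearMap.compLinearMap_apply]
    congr 1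
    funext j
    by_cases hj : j = i
    · subst hj; simp
    · simp [hj]
  let f : Amb n →ₗ[ℝ] MultilinearMap ℝ (fun _ : Fin q => Amb n) ℝ :=
    { toFun := fun u => (LinearMap.applyₗ (proj z u) ∘ₗ ContinuousLinearMap.coeLM ℝ).compMultilinearMap
          (derivMultilinear hM hd) -
        ∑ i, M.compLinearMap (Function.update (fun _ => projL z) i (connL n hz u))
      map_add' := by
        intro u u'
        ext v
        simp only [add_apply, sub_apply, sum_apply, hupd, map_add,
          LinearMap.add_apply, MultilinearMap.map_update_add, Finset.sum_add_distrib,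
          LinearMap.compMultilinearMap_apply, LinearMap.comp_apply, LinearMap.applyₗ_apply_apply,
          proj_add]
        ring
      map_smul' := by
        intro c u
        ext v
        simp only [smul_apply, sub_apply, sum_apply, hupd, map_smul,
          LinearMap.smul_apply, MultilinearMap.map_update_smul, ← Finset.smul_sum, RingHom.id_apply,
          LinearMap.compMultilinearMap_apply, LinearMap.comp_apply, LinearMap.applyₗ_apply_apply,
          proj_real_smul, smul_sub] }
  refine ⟨f.uncurryLeft, fun v => ?_⟩
  rw [covDeriv_eq hn ha T hz, LinearMap.uncurryLeft_apply]
  simp only [f, LinearMap.coe_mk, AddHom.coe_mk, sub_apply, sum_apply, hupd, hMz]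
  rfl

/-- Both parts of the Leibniz rule lose one order: the derivative because projected constant fields
are symbols of order 0, the connection terms because one argument is replaced by a symbol of order
-1. -/
theorem TSym.covDeriv (hn : 2 < n) {a : ℝ} (ha : 0 < a) {l : ℝ} {T : Tensor n q} (h : TSym l T) :
    TSym (l - 1) (Stenzel.covDeriv n a T) := by
  refine TSym.of_multilinear ?_ fun v => ?_
  · filter_upwards [eventually_ne_zero, EndFilter.nhds _ h.multilinear, h.differentiableAt]
      with z hz hM hd using covDeriv_multilinear hn ha hz hM hd
  · have h1 : Symbol (cobounded _) l (fun y => T y fun i => proj y (v i.succ)) := by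
      simpa using h.eval (fun i => symbol_proj (v i.succ))
    have h2 := h1.fderiv.bilin (ContinuousLinearMap.id ℝ (Amb n →L[ℝ] ℝ)) (symbol_proj (v 0))
    have h3 : ∀ i ∈ (Finset.univ : Finset (Fin q)), Symbol (cobounded _) (l - 1) (fun z => T z
        (Function.update (fun j => proj z (v j.succ)) i (conn n z (v 0) (v i.succ)))) := fun i _ => by
      have h4 := h.eval (m := Function.update (fun _ => 0) i (-1))
        (W := Function.update (fun j z => proj z (v j.succ)) i (fun z => conn n z (v 0) (v i.succ)))
        (fun j => by
          by_cases hj : j = i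
          · subst hj; simpa using symbol_conn hn _ _
          · simpa [hj] using symbol_proj _)
      rw [Finset.sum_update_of_mem (Finset.mem_univ i)] at h4
      simp only [Finset.sum_const_zero, add_zero] at h4
      refine h4.congr (Eventually.of_forall fun z => ?_)
      dsimp only
      congr 1
      funext j
      by_cases hj : j = i
      · subst hj; simp
      · simp [hj]
    have h5 := (h2.mono (show l - 1 + 0 ≤ l - 1 by linarith)).sub (Symbol.sum Finset.univ h3)
    exact h5.congr (eventually_ne_zero.mono fun z hz => (covDeriv_eq hn ha T hz v).symm)

theorem TSym.covDerivIter (hn : 2 < n) {a : ℝ} (ha : 0 < a) {l : ℝ} {T : Tensor n q} (h : TSym l T)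
    (k : ℕ) : TSym (l - k) (Stenzel.covDerivIter n a T k) := by
  induction k with
  | zero =>
    rw [Nat.cast_zero, sub_zero]
    exact h
  | succ k ih =>
    have := ih.covDeriv hn ha
    rw [sub_sub] at this
    exact_mod_cast this

/-! ### Restriction to the cone -/

/-- The derivative is computed along a curve that stays in the cone and has velocity v at z. -/
theorem fderiv_eq_zero_of_cone {f : Amb n → ℝ} {z v : Amb n} (hz : z ∈ cone n) (hv : v ∈ tang z)
    (hf : DifferentiableAt ℝ f z) (h0 : ∀ᶠ y in 𝓝 z, y ∈ cone n → f y = 0) : fderiv ℝ f z v = 0 := by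
  obtain ⟨hz0, hzz⟩ := hz
  have hvz : dot z v = 0 := hv
  have hτ := norm_sq_ofReal_ne hz0
  -- Correct the line z + sv by a multiple k of z̄. Since z̄·z̄ = 0, the cone equation is linear in
  -- k: s² v·v = 2k(|z|² + s⟨z,v⟩). Thus k = s² v·v / D(s) is of second order and leaves the
  -- velocity unchanged.
  set D : ℝ → ℂ := fun s => 2 * ((‖z‖ : ℂ) ^ 2 + s * dot (conjVec z) v) with hD
  set γ : ℝ → Amb n := fun s => z + s • v - ((s : ℂ) ^ 2 * dot v v / D s) • conjVec z with hγ
  have hs : HasDerivAt (fun s : ℝ => (s : ℂ)) 1 0 := Complex.ofRealCLM.hasDerivAt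
  have hD' : HasDerivAt D (2 * (1 * dot (conjVec z) v)) 0 :=
    ((hs.mul_const _).const_add _).const_mul 2
  have hD0 : D 0 ≠ 0 := by simp [hD, hτ]
  have h1 : HasDerivAt (fun s : ℝ => (s : ℂ) ^ 2 * dot v v / D s) 0 0 := by
    have := ((hs.pow 2).mul_const (dot v v)).div hD' hD0
    refine this.congr_deriv ?_
    simp
  have hγ' : HasDerivAt γ v 0 := by
    have h2 : HasDerivAt (fun s : ℝ => s • v) ((1 : ℝ) • v) 0 := (hasDerivAt_id 0).smul_const v
    have h3 : HasDerivAt (fun s : ℝ => ((s : ℂ) ^ 2 * dot v v / D s) • conjVec z)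
      ((0 : ℂ) • conjVec z) 0 := h1.smul_const (conjVec z)
    have := (h2.const_add z).sub h3
    refine this.congr_deriv ?_
    simp
  have hγ0 : γ 0 = z := by simp [hγ]
  have hcone : ∀ᶠ s in 𝓝 (0 : ℝ), γ s ∈ cone n := by
    have e1 : ∀ᶠ s in 𝓝 (0 : ℝ), γ s ≠ 0 :=
      hγ'.continuousAt.eventually_ne (by rwa [hγ0])
    have e2 : ∀ᶠ s in 𝓝 (0 : ℝ), D s ≠ 0 := hD'.continuousAt.eventually_ne hD0
    filter_upwards [e1, e2] with s h1 h2
    refine ⟨h1, ?_⟩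
    have h3 : dot v z = 0 := by rw [dot_comm, hvz]
    have h4 : dot (conjVec z) (conjVec z) = 0 := by rw [dot_conjVec_conjVec, hzz, map_zero]
    simp only [hγ, dot_add_left, dot_add_right, dot_sub_left, dot_sub_right, dot_smul_left,
      dot_smul_right, dot_real_smul_left, dot_real_smul_right, hzz, hvz, h3, h4, dot_conjVec_right,
      dot_conjVec_self']
    have h5 : (‖z‖ : ℂ) ^ 2 + s * dot (conjVec z) v ≠ 0 := right_ne_zero_of_mul h2
    simp only [hD]
    field_simp
    ring
  have h6 : (fun s => f (γ s)) =ᶠ[𝓝 0] fun _ => 0 := by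
    have : Tendsto γ (𝓝 0) (𝓝 z) := by
      have := hγ'.continuousAt.tendsto
      rwa [hγ0] at this
    filter_upwards [hcone, this.eventually h0] with s h1 h2 using h2 h1
  have h7 : HasDerivAt (fun s => f (γ s)) (fderiv ℝ f z v) 0 := by
    have h8 : HasFDerivAt f (fderiv ℝ f z) (γ 0) := by rw [hγ0]; exact hf.hasFDerivAt
    exact h8.comp_hasDerivAt 0 hγ'
  exact h7.unique ((hasDerivAt_const 0 (0 : ℝ)).congr_of_eventuallyEq h6)

/-- Agreement of tensors on the cone near infinity. -/
def AgreeOnCone (T T' : Tensor n q) : Prop :=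
  ∀ᶠ z in cobounded (Amb n), z ∈ cone n → ∀ v, (∀ i, v i ∈ tang z) → T z v = T' z v

/-- The difference vanishes on the cone, and the covariant derivative differentiates it only in a
tangent direction; the connection terms involve only tangent arguments. The orders l and l' play no
role beyond providing differentiability. -/
theorem AgreeOnCone.covDeriv (hn : 2 < n) {a : ℝ} (ha : 0 < a) {l l' : ℝ} {T T' : Tensor n q}
    (hT : TSym l T) (hT' : TSym l' T') (h : AgreeOnCone T T') :
    AgreeOnCone (Stenzel.covDeriv n a T) (Stenzel.covDeriv n a T') := by
  filter_upwards [EndFilter.nhds _ h, hT.differentiableAt, hT'.differentiableAt] with z h1 h2 h3 hz v hv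
  rw [covDeriv_eq hn ha T hz.1, covDeriv_eq hn ha T' hz.1]
  congr 1
  · rw [← sub_eq_zero, ← sub_apply, ← fderiv_sub (h2 _) (h3 _)]
    refine fderiv_eq_zero_of_cone hz (proj_mem hz.1 _) ((h2 _).sub (h3 _)) ?_
    filter_upwards [h1] with y hy hyc
    exact sub_eq_zero.2 (hy hyc _ fun i => proj_mem hyc.1 _)
  · refine Finset.sum_congr rfl fun i _ => h1.self_of_nhds hz _ fun j => ?_
    by_cases hj : j = i
    · subst hj; simpa using conn_mem hz.1 _ _
    · simpa [hj] using proj_mem hz.1 _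

theorem AgreeOnCone.covDerivIter (hn : 2 < n) {a : ℝ} (ha : 0 < a) {l l' : ℝ} {T T' : Tensor n q}
    (hT : TSym l T) (hT' : TSym l' T') (h : AgreeOnCone T T') (k : ℕ) :
    AgreeOnCone (Stenzel.covDerivIter n a T k) (Stenzel.covDerivIter n a T' k) := by
  induction k with
  | zero => exact h
  | succ k ih => exact ih.covDeriv hn ha (hT.covDerivIter hn ha k) (hT'.covDerivIter hn ha k)

end TensorSymbols

end Stenzel

end

noncomputable section

namespace Stenzel

open Filter Asymptotics Topology Bornology ComplexConjugate

/-! ### Decay of tensors with symbol coefficients -/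

section Decay

variable {n q : ℕ}

/-- The ratio `r / |z| ^ (1 - 1/n)`. -/
def radiusConst (n : ℕ) (a : ℝ) : ℝ := √(2 * a * leadConst n)

theorem leadConst_pos (hn : 2 < n) : 0 < leadConst n := by
  have hn' : (3 : ℝ) ≤ n := by exact_mod_cast hn
  have h1 : 0 < (n : ℝ) - 1 := by linarith
  rw [leadConst]
  positivity

theorem radiusConst_pos (hn : 2 < n) {a : ℝ} (ha : 0 < a) : 0 < radiusConst n a := by
  have := leadConst_pos hn
  exact Real.sqrt_pos.2 (by positivity)

theorem exponent_pos (hn : 2 < n) : 0 < 1 - 1 / (n : ℝ) := by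
  have hn' : (3 : ℝ) ≤ n := by exact_mod_cast hn
  rw [sub_pos, div_lt_one (by linarith)]
  linarith

theorem radius_eq (hn : 2 < n) {a : ℝ} (ha : 0 < a) (z : Amb n) :
    radius n a z = radiusConst n a * ‖z‖ ^ (1 - 1 / (n : ℝ)) := by
  have := leadConst_pos hn
  have h1 : 2 * conePotential n a z = 2 * a * leadConst n * (‖z‖ ^ (1 - 1 / (n : ℝ))) ^ 2 := by
    rw [conePotential, ← Real.rpow_pow_comm (norm_nonneg z)]
    ring
  rw [radius, h1, Real.sqrt_mul (by positivity), Real.sqrt_sq (by positivity), radiusConst]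

theorem exists_radius_bound (hn : 2 < n) {a : ℝ} (ha : 0 < a) {p : Amb n → Prop}
    (h : ∀ᶠ z in cobounded (Amb n), p z) : ∃ R, ∀ z, R < radius n a z → p z := by
  obtain ⟨R, hR⟩ := eventually_cobounded_iff.1 h
  -- The truncation at 0 makes the base nonnegative, as monotonicity of real powers requires.
  refine ⟨radiusConst n a * max R 0 ^ (1 - 1 / (n : ℝ)), fun z hz => hR z ?_⟩
  rw [radius_eq hn ha] at hz
  have h1 := lt_of_mul_lt_mul_left hz (radiusConst_pos hn ha).le
  exact (le_max_left _ _).trans_lt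
    ((Real.rpow_lt_rpow_iff (le_max_right _ _) (norm_nonneg z) (exponent_pos hn)).1 h1)

/-- g₀ dominates a multiple of τ^(-1/n) times the Euclidean metric, so passing to g₀-norms costs
|z|^(1/n) in each slot. -/
theorem norm_le_coneMetric (hn : 2 < n) {a : ℝ} (ha : 0 < a) : ∃ C : ℝ, 0 ≤ C ∧ ∀ z : Amb n, z ≠ 0 →
    ∀ v, ‖v‖ ≤ C * ‖z‖ ^ (1 / (n : ℝ)) * √(coneMetric n a z v v) := by
  have hn' : (3 : ℝ) ≤ n := by exact_mod_cast hn
  have hn1 : 0 < (n : ℝ) - 1 := by linarith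
  have hp := exponent_pos hn
  set c : ℝ := 2 * a * ((n : ℝ) - 1) ^ (-(1 / (n : ℝ))) * (1 - 1 / n) with hc
  have hc0 : 0 < c := by positivity
  refine ⟨(√c)⁻¹, by positivity, fun z hz v => ?_⟩
  have hz' : 0 < ‖z‖ := norm_pos_iff.2 hz
  have h1 := coneMetric_self_ge hn ha hz v
  have h2 : 2 * a * coneDeriv n (‖z‖ ^ 2) * ((1 - 1 / n) * ‖v‖ ^ 2) =
      (√c * (‖z‖ ^ (1 / (n : ℝ)))⁻¹ * ‖v‖) ^ 2 := by
    rw [mul_pow, mul_pow, Real.sq_sqrt hc0.le, ← Real.rpow_neg hz'.le,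
      Real.rpow_pow_comm hz'.le, coneDeriv, hc]
    ring
  rw [h2] at h1
  have h3 := Real.le_sqrt_of_sq_le h1
  have h4 : 0 < ‖z‖ ^ (1 / (n : ℝ)) := by positivity
  have h5 : 0 < √c := Real.sqrt_pos.2 hc0
  calc ‖v‖ = (√c)⁻¹ * ‖z‖ ^ (1 / (n : ℝ)) * (√c * (‖z‖ ^ (1 / (n : ℝ)))⁻¹ * ‖v‖) := by
        field_simp
    _ ≤ _ := mul_le_mul_of_nonneg_left h3 (by positivity)

/-- The q slots cost |z|^(q/n), and r is a multiple of |z|^(1-1/n), whence the rate. Each covariant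
derivative lowers the order by 1 but adds a slot costing 1/n; the net loss 1 - 1/n in |z| is exactly
one power of r. The tensor T₀ itself may have a worse ambient order, since only its values on the
cone are estimated. -/
theorem hasDecay_of_agreeOnCone (hn : 2 < n) {a : ℝ} (ha : 0 < a) {l l₀ : ℝ} {T T₀ : Tensor n q}
    (hT : TSym l T) (hT₀ : TSym l₀ T₀) (h : AgreeOnCone T₀ T) :
    HasDecay n a T₀ ((l + q / n) / (1 - 1 / (n : ℝ))) := by
  intro k
  obtain ⟨C, hC0, hC⟩ := norm_le_coneMetric hn ha
  obtain ⟨K, hK0, hK⟩ := (hT.covDerivIter hn ha k).bound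
  have hp := exponent_pos hn
  have hρ := radiusConst_pos hn ha
  obtain ⟨R, hR⟩ := exists_radius_bound hn ha (hK.and ((h.covDerivIter hn ha hT₀ hT k)))
  set m := (l + q / n) / (1 - 1 / (n : ℝ)) with hm
  refine ⟨K * C ^ (q + k) * radiusConst n a ^ (-(m - k)), R, fun z hz hzR v hv => ?_⟩
  obtain ⟨h1, h2⟩ := hR z hzR
  have hz' : 0 < ‖z‖ := norm_pos_iff.2 hz.1
  rw [h2 hz v hv]
  have h3 : ∏ i, ‖v i‖ ≤ ∏ i, (C * ‖z‖ ^ (1 / (n : ℝ)) * √(coneMetric n a z (v i) (v i))) :=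
    Finset.prod_le_prod (fun _ _ => norm_nonneg _) fun i _ => hC z hz.1 (v i)
  rw [Finset.prod_mul_distrib, Finset.prod_const, Finset.card_univ, Fintype.card_fin, mul_pow] at h3
  have h4 : radius n a z ^ (m - k) =
      radiusConst n a ^ (m - k) * ‖z‖ ^ (l - k + (q + k) * (1 / (n : ℝ))) := by
    rw [radius_eq hn ha, Real.mul_rpow hρ.le (by positivity), ← Real.rpow_mul hz'.le]
    congr 2
    rw [mul_sub, hm, mul_div_cancel₀ _ hp.ne']
    ring
  have h5 : (‖z‖ ^ (1 / (n : ℝ))) ^ (q + k) = ‖z‖ ^ ((q + k) * (1 / (n : ℝ))) := by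
    rw [← Real.rpow_natCast, ← Real.rpow_mul hz'.le, mul_comm]
    push_cast
    rfl
  have h6 : radiusConst n a ^ (-(m - k)) * radiusConst n a ^ (m - k) = 1 := by
    rw [← Real.rpow_add hρ, neg_add_cancel, Real.rpow_zero]
  rw [h5] at h3
  refine (h1 v).trans ((mul_le_mul_of_nonneg_left h3 (by positivity)).trans_eq ?_)
  rw [h4, Real.rpow_add hz']
  linear_combination (-(K * C ^ (q + k) * (‖z‖ ^ (l - k) * ‖z‖ ^ ((q + k) * (1 / (n : ℝ)))) *
    ∏ i, √(coneMetric n a z (v i) (v i)))) * h6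

theorem TSym.of_bilinear {l : ℝ} {b : Amb n → Amb n → Amb n → ℝ}
    (h : ∀ᶠ z in cobounded (Amb n), ∃ B : Amb n →ₗ[ℝ] Amb n →ₗ[ℝ] ℝ, ∀ v w, b z v w = B v w)
    (hs : ∀ v w, Symbol (cobounded _) l (fun z => b z v w)) : TSym l (toTensor b) := by
  refine TSym.of_multilinear (h.mono ?_) fun v => hs _ _
  rintro z ⟨B, hB⟩
  refine ⟨{ toFun := fun v => B (v 0) (v 1), map_update_add' := ?_, map_update_smul' := ?_ },
    fun v => hB _ _⟩
  · intro _ v i x y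
    fin_cases i <;> simp [Function.update]
  · intro _ v i c x
    fin_cases i <;> simp [Function.update]

end Decay

/-! ### The tensors of the comparison -/

section Comparison

variable {n : ℕ}

theorem tsym_leading (a : ℝ) : TSym (-(2 / (n : ℝ)) - 2) (toTensor (leading n a)) := by
  refine TSym.of_bilinear (Eventually.of_forall fun z => ⟨LinearMap.mk₂ ℝ (leading n a z) ?_ ?_ ?_ ?_,
    fun v w => rfl⟩) fun v w => ?_
  · intros; simp [leading]; ring
  · intros; simp [leading]; ring
  · intros; simp [leading]; ring
  · intros; simp [leading]; ring
  · have h := (((symbol_rpow (-(1 / (n : ℝ)) - 1)).comp_norm_sq (n := n)).const_mul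
      (2 * a * leadConst n * (1 - 1 / (n : ℝ)))).mul (Symbol.const (dot v w).re)
    have e : 2 * (-(1 / (n : ℝ)) - 1) + 0 = -(2 / (n : ℝ)) - 2 := by ring
    rwa [e] at h

/-- The symmetric form `2 (A Re⟨v, w⟩ + B Re (⟨ζ, v⟩ conj ⟨ζ, w⟩))`. -/
def radialForm (A B : ℝ) (ζ v w : Amb n) : ℝ :=
  2 * (A * (dot (conjVec v) w).re + B * (dot (conjVec ζ) v * conj (dot (conjVec ζ) w)).re)

theorem Symbol.radialForm {A B : Amb n → ℝ} {ζ v w : Amb n → Amb n} {m : ℝ}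
    (hA : Symbol (cobounded _) m A) (hB : Symbol (cobounded _) (m - 2) B)
    (hζ : Symbol (cobounded _) 1 ζ) (hv : Symbol (cobounded _) 0 v) (hw : Symbol (cobounded _) 0 w) :
    Symbol (cobounded _) m (fun z => Stenzel.radialForm (A z) (B z) (ζ z) (v z) (w z)) := by
  have h1 := hA.mul (hv.conjVec.dot hw).re
  have h2 := hB.mul ((hζ.conjVec.dot hv).cmul (hζ.conjVec.dot hw).conj).re
  exact ((h1.mono (by linarith)).add (h2.mono (by linarith))).const_mul 2

theorem radialForm_bilinear (A B : ℝ) (ζ : Amb n) (L : Amb n →L[ℝ] Amb n) :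
    ∃ b : Amb n →ₗ[ℝ] Amb n →ₗ[ℝ] ℝ, ∀ v w, radialForm A B ζ (L v) (L w) = b v w := by
  refine ⟨LinearMap.mk₂ ℝ (fun v w => radialForm A B ζ (L v) (L w)) ?_ ?_ ?_ ?_, fun v w => rfl⟩
  all_goals
    intros
    simp only [radialForm, map_add, map_smul, conjVec_add, conjVec_real_smul, dot_add_left,
      dot_add_right, dot_real_smul_left, dot_real_smul_right, Complex.add_re, Complex.mul_re,
      Complex.add_im, Complex.mul_im, Complex.ofReal_re, Complex.ofReal_im, smul_eq_mul,
      Complex.conj_re, Complex.conj_im, map_mul]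
    ring

theorem coneMetric_eq_radialForm (hn : 2 < n) (a : ℝ) {z : Amb n} (hz : z ≠ 0) (v w : Amb n) :
    coneMetric n a z v w =
      radialForm (a * coneDeriv n (‖z‖ ^ 2)) (a * coneDeriv₂ n (‖z‖ ^ 2)) z v w := by
  rw [coneMetric_eq' hn a hz, radialForm]
  ring

theorem symbol_coneDeriv₂ (n : ℕ) : Symbol atTop (-(1 / (n : ℝ)) - 1) (coneDeriv₂ n) :=
  (symbol_rpow _).const_mul _

theorem tsym_coneMetric (hn : 2 < n) (a : ℝ) : TSym (-(2 / (n : ℝ))) (toTensor (coneMetric n a)) := by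
  refine TSym.of_bilinear (eventually_ne_zero.mono fun z hz => ?_) fun v w => ?_
  · obtain ⟨b, hb⟩ := radialForm_bilinear (a * coneDeriv n (‖z‖ ^ 2)) (a * coneDeriv₂ n (‖z‖ ^ 2)) z
      (ContinuousLinearMap.id ℝ (Amb n))
    exact ⟨b, fun v w => (coneMetric_eq_radialForm hn a hz v w).trans (hb v w)⟩
  · refine Symbol.congr ?_ (eventually_ne_zero.mono fun z hz =>
      (coneMetric_eq_radialForm hn a hz v w).symm)
    refine Symbol.radialForm ?_ ?_ symbol_id (Symbol.const v) (Symbol.const w)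
    · exact ((symbol_coneDeriv n).comp_norm_sq.const_mul a).mono (le_of_eq (by ring))
    · exact ((symbol_coneDeriv₂ n).comp_norm_sq.const_mul a).mono (le_of_eq (by ring))

theorem Phi_eq (z : Amb n) : Phi z = z + (1 / 2 : ℝ) • ((‖z‖ ^ 2)⁻¹ • conjVec z) := by
  rw [Phi, smul_smul]
  congr 2
  rw [one_div, one_div, mul_inv]

theorem symbol_Phi : Symbol (cobounded _) 1 (fun z : Amb n => Phi z) := by
  simp only [Phi_eq]
  have h := (symbol_inv_norm_sq.smul (symbol_id (n := n)).conjVec).clm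
    ((1 / 2 : ℝ) • ContinuousLinearMap.id ℝ (Amb n))
  exact symbol_id.add (h.mono (by norm_num))

theorem symbol_fderiv_Phi (v : Amb n) : Symbol (cobounded _) 0 (fun z : Amb n => fderiv ℝ Phi z v) := by
  have := (symbol_Phi (n := n)).fderiv.clm (ContinuousLinearMap.apply ℝ (Amb n) v)
  simpa using this

/-- Off the cone |Φ(z)|² is not a function of τ; this comparison is what allows functions of |Φ(z)|²
to be treated as symbols there. -/
theorem norm_Phi_ge : ∀ᶠ z in cobounded (Amb n), 1 / 4 * ‖z‖ ^ 2 ≤ ‖Phi z‖ ^ 2 := by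
  refine eventually_cobounded_iff.2 ⟨1, fun z hz => ?_⟩
  have h1 : ‖z‖ - ‖(1 / (2 * ‖z‖ ^ 2) : ℝ) • conjVec z‖ ≤ ‖Phi z‖ := by
    have := norm_sub_norm_le z (-((1 / (2 * ‖z‖ ^ 2) : ℝ) • conjVec z))
    rwa [norm_neg, sub_neg_eq_add] at this
  have h2 : ‖(1 / (2 * ‖z‖ ^ 2) : ℝ) • conjVec z‖ ≤ 1 / 2 * ‖z‖ := by
    rw [norm_smul, norm_conjVec, Real.norm_of_nonneg (by positivity)]
    refine mul_le_mul_of_nonneg_right ?_ (norm_nonneg _)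
    refine one_div_le_one_div_of_le (by norm_num) ?_
    nlinarith
  nlinarith

theorem stenzelMetric_eq (hn : 2 < n) (a : ℝ) : ∀ᶠ x in (atTop : Filter ℝ), ∀ ζ : Amb n, ‖ζ‖ ^ 2 = x →
    ∀ v w, stenzelMetric n a ζ v w =
      radialForm (a * stenzelDeriv n x) (a * deriv (stenzelDeriv n) x) ζ v w := by
  filter_upwards [eventually_gt_atTop 1, (symbol_stenzelDeriv hn).differentiableAt] with x hx hd ζ hζ v w
  subst hζ
  exact kahlerForm_radial (ψ := fun x => a * profile n (Real.arcosh x))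
    (ψ₁ := fun x => a * stenzelDeriv n x)
    ((lt_mem_nhds hx).mono fun y hy => (hasDerivAt_profile hy).const_mul a)
    (hd.hasDerivAt.const_mul a) v w

theorem tendsto_norm_Phi : Tendsto (fun z : Amb n => ‖Phi z‖ ^ 2) (cobounded _) atTop :=
  tendsto_atTop_mono' _ norm_Phi_ge
    (((tendsto_pow_atTop two_ne_zero).comp tendsto_norm_cobounded_atTop).const_mul_atTop
      (by norm_num))

theorem pullback_eq (hn : 2 < n) (a : ℝ) : ∀ᶠ z in cobounded (Amb n), ∀ v w, pullback n a z v w =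
    radialForm (a * stenzelDeriv n (‖Phi z‖ ^ 2)) (a * deriv (stenzelDeriv n) (‖Phi z‖ ^ 2)) (Phi z)
      (fderiv ℝ Phi z v) (fderiv ℝ Phi z w) := by
  filter_upwards [tendsto_norm_Phi.eventually (stenzelMetric_eq (n := n) hn a)] with z hz v w
  exact hz _ rfl _ _

/-- A crude order without any cancellation against g₀. It only certifies that the ambient extension
is a symbol tensor; the sharp order is read off on the cone. -/
theorem tsym_pullback (hn : 2 < n) (a : ℝ) : TSym (-(2 / (n : ℝ))) (toTensor (pullback n a)) := by
  refine TSym.of_bilinear ((pullback_eq hn a).mono fun z hz => ?_) fun v w => ?_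
  · obtain ⟨b, hb⟩ := radialForm_bilinear (a * stenzelDeriv n (‖Phi z‖ ^ 2))
      (a * deriv (stenzelDeriv n) (‖Phi z‖ ^ 2)) (Phi z) (fderiv ℝ Phi z)
    exact ⟨b, fun v w => (hz v w).trans (hb v w)⟩
  · refine Symbol.congr ?_ ((pullback_eq hn a).mono fun z hz => (hz v w).symm)
    have hσ : Symbol (cobounded _) 2 (fun z : Amb n => ‖Phi z‖ ^ 2) := by
      have := (symbol_Phi (n := n)).norm_sq
      norm_num at this
      exact this
    refine Symbol.radialForm ?_ ?_ symbol_Phi (symbol_fderiv_Phi v) (symbol_fderiv_Phi w)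
    · exact (((symbol_stenzelDeriv hn).comp_quadratic hσ (by norm_num) norm_Phi_ge).const_mul a).mono
        (le_of_eq (by ring))
    · exact (((symbol_stenzelDeriv hn).deriv.comp_quadratic hσ (by norm_num) norm_Phi_ge).const_mul
        a).mono (le_of_eq (by ring))

theorem tsym_difference (hn : 2 < n) (a : ℝ) :
    TSym (-(2 / (n : ℝ))) (toTensor (difference n a)) :=
  (tsym_pullback hn a).sub (tsym_coneMetric hn a)

/-! ### The remainder on the cone -/

theorem fderiv_Phi {z : Amb n} (hz : z ≠ 0) (v : Amb n) : fderiv ℝ Phi z v =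
    v + (1 / (2 * ‖z‖ ^ 2) : ℝ) • conjVec v -
      ((dot (conjVec z) v).re / (‖z‖ ^ 2) ^ 2 : ℝ) • conjVec z := by
  have hpos : ‖z‖ ^ 2 ≠ 0 := by positivity
  have h2 := (hasDerivAt_inv hpos).comp_hasFDerivAt z (hasFDerivAt_norm_sq z)
  have h3 := (hasFDerivAt_id z).add ((h2.smul (conjR n).hasFDerivAt).const_smul (1 / 2 : ℝ))
  have h4 := h3.congr_of_eventuallyEq (Eventually.of_forall fun y => Phi_eq y)
  rw [h4.fderiv]
  simp
  module

theorem norm_Phi_sq {z : Amb n} (hz : z ∈ cone n) : ‖Phi z‖ ^ 2 = shift (‖z‖ ^ 2) := by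
  have hzz := hz.2
  have hpos : ‖z‖ ≠ 0 := norm_ne_zero_iff.2 hz.1
  have h2 : dot (conjVec z) (conjVec z) = 0 := by rw [dot_conjVec_conjVec, hzz, map_zero]
  have h1 : ((‖Phi z‖ ^ 2 : ℝ) : ℂ) = ((shift (‖z‖ ^ 2) : ℝ) : ℂ) := by
    rw [← dot_conjVec_self]
    simp only [Phi, conjVec_add, conjVec_real_smul, conjVec_conjVec, dot_add_left, dot_add_right,
      dot_real_smul_left, dot_real_smul_right, h2, hzz, dot_conjVec_right, dot_conjVec_self]
    rw [mul_zero, add_zero, zero_add, ← Complex.ofReal_mul, ← Complex.ofReal_mul,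
      ← Complex.ofReal_add, shift]
    congr 1
    field_simp
    ring
  exact_mod_cast h1

/-- The factor is the derivative of `shift` at τ, as differentiating |Φ|² requires of the real part;
the imaginary part acquires the same factor. -/
theorem dot_conjVec_fderiv_Phi {z v : Amb n} (hz : z ∈ cone n) (hv : v ∈ tang z) :
    dot (conjVec (Phi z)) (fderiv ℝ Phi z v) =
      ((1 - 1 / (4 * (‖z‖ ^ 2) ^ 2) : ℝ) : ℂ) * dot (conjVec z) v := by
  have hzz := hz.2
  have hpos : (‖z‖ : ℂ) ≠ 0 := by exact_mod_cast norm_ne_zero_iff.2 hz.1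
  have h2 : dot (conjVec z) (conjVec z) = 0 := by rw [dot_conjVec_conjVec, hzz, map_zero]
  have h3 : dot z v = 0 := hv
  have h4 : dot (conjVec z) (conjVec v) = 0 := by rw [dot_conjVec_conjVec, h3, map_zero]
  rw [fderiv_Phi hz.1]
  simp only [Phi, conjVec_add, conjVec_real_smul, conjVec_conjVec, dot_add_left, dot_add_right,
    dot_sub_right, dot_real_smul_left, dot_real_smul_right, h2, h3, h4, dot_conjVec_right,
    dot_conjVec_self']
  rw [← conj_dot_conjVec z v]
  push_cast
  rw [Complex.re_eq_add_conj]
  field_simp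
  ring

/-- The source of h: v paired with w̄/(2τ) and v̄/(2τ) paired with w add up to Re(v·w)/τ. The
contributions of the z̄-terms of dΦ cancel among themselves on the cone. -/
theorem re_dot_fderiv_Phi {z v w : Amb n} (hz : z ∈ cone n) (hv : v ∈ tang z) (hw : w ∈ tang z) :
    (dot (conjVec (fderiv ℝ Phi z v)) (fderiv ℝ Phi z w)).re =
      (1 + 1 / (4 * (‖z‖ ^ 2) ^ 2)) * (dot (conjVec v) w).re + (dot v w).re / ‖z‖ ^ 2 := by
  have hzz := hz.2
  have hpos : ‖z‖ ≠ 0 := norm_ne_zero_iff.2 hz.1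
  have h3 : dot z v = 0 := hv
  have h3' : dot v z = 0 := by rw [dot_comm, h3]
  have h6 : dot z w = 0 := hw
  have h7 : dot w z = 0 := by rw [dot_comm, h6]
  have h4 : dot (conjVec v) (conjVec w) = conj (dot v w) := dot_conjVec_conjVec _ _
  have h8 : dot (conjVec v) (conjVec z) = 0 := by rw [dot_conjVec_conjVec, h3', map_zero]
  have h5 : dot z (conjVec w) = conj (dot (conjVec z) w) := by
    rw [conj_dot, conjVec_conjVec]
  have h9 : dot v (conjVec w) = conj (dot (conjVec v) w) := by
    rw [conj_dot, conjVec_conjVec]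
  rw [fderiv_Phi hz.1, fderiv_Phi hz.1]
  simp only [conjVec_add, conjVec_sub, conjVec_real_smul, conjVec_conjVec, dot_add_left,
    dot_add_right, dot_sub_left, dot_sub_right, dot_real_smul_left, dot_real_smul_right, h6, h4,
    h5, h8, h9, dot_conjVec_right v z, dot_conjVec_right z z, dot_conjVec_self]
  simp only [Complex.add_re, Complex.sub_re, Complex.re_ofReal_mul, Complex.conj_re, Complex.zero_re,
    Complex.ofReal_re, mul_zero]
  field_simp
  ring

/-- The coefficient of `Re⟨v, w⟩` in the remainder. -/
def remA (n : ℕ) (x : ℝ) : ℝ := stenzelDeriv n (shift x) * (1 + 1 / (4 * x ^ 2)) - coneDeriv n x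

/-- The coefficient of `Re ∑ vᵢ wᵢ` in the remainder. -/
def remB (n : ℕ) (x : ℝ) : ℝ := (stenzelDeriv n (shift x) - coneDeriv n x) / x

/-- The coefficient of `Re (⟨z, v⟩ conj ⟨z, w⟩)` in the remainder. -/
def remC (n : ℕ) (x : ℝ) : ℝ :=
  deriv (stenzelDeriv n) (shift x) * (1 - 1 / (4 * x ^ 2)) ^ 2 - coneDeriv₂ n x

/-- The form `Φ^* g - g₀ - h` on the cone. -/
def remainder (n : ℕ) (a : ℝ) (z v w : Amb n) : ℝ :=
  radialForm (a * remA n (‖z‖ ^ 2)) (a * remC n (‖z‖ ^ 2)) z v w +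
    2 * a * remB n (‖z‖ ^ 2) * (dot v w).re

theorem symbol_remA (hn : 2 < n) : Symbol atTop (-(1 / (n : ℝ)) - 3 / 2) (remA n) := by
  have h := (((symbol_stenzelDeriv hn).comp_shift.mul (symbol_rpow (-2))).const_mul (1 / 4)).mono
    (show _ ≤ -(1 / (n : ℝ)) - 3 / 2 by linarith)
  refine ((symbol_stenzelDeriv_shift_sub hn).add h).congr ?_
  filter_upwards [eventually_gt_atTop 0] with x hx
  rw [remA, Real.rpow_neg hx.le, Real.rpow_two]
  field_simp
  ring

theorem symbol_remB (hn : 2 < n) : Symbol atTop (-(1 / (n : ℝ)) - 5 / 2) (remB n) := by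
  have h := ((symbol_stenzelDeriv_shift_sub hn).mul symbol_inv).mono
    (show _ ≤ -(1 / (n : ℝ)) - 5 / 2 by linarith)
  exact h

theorem symbol_remC (hn : 2 < n) : Symbol atTop (-(1 / (n : ℝ)) - 5 / 2) (remC n) := by
  have h0 : Symbol atTop (-2) (fun x : ℝ => -(1 / 2) * x ^ (-2 : ℝ) + 1 / 16 * x ^ (-4 : ℝ)) :=
    ((symbol_rpow (-2)).const_mul _).add (((symbol_rpow (-4)).const_mul _).mono (by norm_num))
  have h := ((symbol_stenzelDeriv hn).deriv.comp_shift.mul h0).mono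
    (show _ ≤ -(1 / (n : ℝ)) - 5 / 2 by linarith)
  refine ((symbol_deriv_stenzelDeriv_shift_sub hn).add h).congr ?_
  filter_upwards [eventually_gt_atTop 0] with x hx
  have e : x ^ (4 : ℝ) = x ^ 4 := by norm_cast
  rw [remC, Real.rpow_neg hx.le, Real.rpow_neg hx.le, Real.rpow_two, e]
  field_simp
  ring

/-- One power of |z| better than h. The lower order of `remC` is offset by its two factors of z, and
the `remB` term is smaller than needed. -/
theorem tsym_remainder (hn : 2 < n) (a : ℝ) :
    TSym (-(2 / (n : ℝ)) - 3) (toTensor (remainder n a)) := by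
  refine TSym.add (T := toTensor fun z v w =>
      radialForm (a * remA n (‖z‖ ^ 2)) (a * remC n (‖z‖ ^ 2)) z v w)
    (T' := toTensor fun z v w => 2 * a * remB n (‖z‖ ^ 2) * (dot v w).re) ?_ ?_
  · refine TSym.of_bilinear (Eventually.of_forall fun z => ?_) fun v w => ?_
    · exact radialForm_bilinear _ _ z (ContinuousLinearMap.id ℝ (Amb n))
    · refine Symbol.radialForm ?_ ?_ symbol_id (Symbol.const v) (Symbol.const w)
      · exact ((symbol_remA hn).comp_norm_sq.const_mul a).mono (le_of_eq (by ring))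
      · exact ((symbol_remC hn).comp_norm_sq.const_mul a).mono (le_of_eq (by ring))
  · refine TSym.of_bilinear (Eventually.of_forall fun z => ?_) fun v w => ?_
    · refine ⟨LinearMap.mk₂ ℝ (fun v w => 2 * a * remB n (‖z‖ ^ 2) * (dot v w).re) ?_ ?_ ?_ ?_,
        fun v w => rfl⟩ <;> (intros; simp; ring)
    · have := (((symbol_remB hn).comp_norm_sq (n := n)).const_mul (2 * a)).mul
        (Symbol.const (dot v w).re)
      exact this.mono (by ring_nf; linarith)

/-- The coefficient of Re(v·w) is Stenzel's f' at |Φ|² divided by τ. Replacing f' by the derivative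
of the cone potential gives precisely h; the error is `remB`. -/
theorem difference_eq (hn : 2 < n) (a : ℝ) : ∀ᶠ z in cobounded (Amb n), z ∈ cone n →
    ∀ v w, v ∈ tang z → w ∈ tang z →
      difference n a z v w = leading n a z v w + remainder n a z v w := by
  filter_upwards [pullback_eq hn a] with z h hz v w hv hw
  have hpos : 0 < ‖z‖ ^ 2 := by have := hz.1; positivity
  have hl : leading n a z v w =
      2 * a * (coneDeriv n (‖z‖ ^ 2) / ‖z‖ ^ 2) * (dot v w).re := by
    rw [leading, mul_assoc (2 * a), leadConst_mul hn, coneDeriv, Real.rpow_sub_one hpos.ne']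
    ring
  rw [difference, h, coneMetric_eq_radialForm hn a hz.1, hl, remainder, norm_Phi_sq hz, radialForm,
    re_dot_fderiv_Phi hz hv hw, dot_conjVec_fderiv_Phi hz hv, dot_conjVec_fderiv_Phi hz hw]
  have e : ∀ (c : ℝ) (x y : ℂ), (c * x * conj (c * y)).re = c ^ 2 * (x * conj y).re := by
    intro c x y
    rw [map_mul, Complex.conj_ofReal]
    have : (c : ℂ) * x * (c * conj y) = ((c ^ 2 : ℝ) : ℂ) * (x * conj y) := by push_cast; ring
    rw [this, Complex.re_ofReal_mul]
  rw [e, radialForm, radialForm, remA, remB, remC]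
  ring

theorem hasDecay_difference_sub_leading (hn : 2 < n) {a : ℝ} (ha : 0 < a) : HasDecay n a
    (toTensor fun z v w => difference n a z v w - leading n a z v w) (-3 / (1 - 1 / (n : ℝ))) := by
  have h1 : TSym (-(2 / (n : ℝ)))
      (toTensor fun z v w => difference n a z v w - leading n a z v w) :=
    (tsym_difference hn a).sub ((tsym_leading a).mono (by linarith))
  have h2 : AgreeOnCone (toTensor fun z v w => difference n a z v w - leading n a z v w)
      (toTensor (remainder n a)) := by
    filter_upwards [difference_eq hn a] with z h hz v hv
    simp only [toTensor, h hz _ _ (hv 0) (hv 1)]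
    ring
  convert hasDecay_of_agreeOnCone hn ha (tsym_remainder hn a) h1 h2 using 2
  push_cast
  ring

theorem hasDecay_leading (hn : 2 < n) {a : ℝ} (ha : 0 < a) :
    HasDecay n a (toTensor (leading n a)) (-2 / (1 - 1 / (n : ℝ))) := by
  convert hasDecay_of_agreeOnCone hn ha (tsym_leading a) (tsym_leading a)
    (Eventually.of_forall fun z _ v _ => rfl) using 2
  push_cast
  ring

theorem hasDecay_difference (hn : 2 < n) {a : ℝ} (ha : 0 < a) :
    HasDecay n a (toTensor (difference n a)) (-2 / (1 - 1 / (n : ℝ))) := by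
  have h1 : TSym (-(2 / (n : ℝ)) - 2)
      (toTensor fun z v w => leading n a z v w + remainder n a z v w) :=
    (tsym_leading a).add ((tsym_remainder hn a).mono (by linarith))
  have h2 : AgreeOnCone (toTensor (difference n a))
      (toTensor fun z v w => leading n a z v w + remainder n a z v w) := by
    filter_upwards [difference_eq hn a] with z h hz v hv
    exact h hz _ _ (hv 0) (hv 1)
  convert hasDecay_of_agreeOnCone hn ha h1 (tsym_difference hn a) h2 using 2
  push_cast
  ring

end Comparison

end Stenzel

end

noncomputable section

namespace Stenzel

open Filter Asymptotics Topology Bornology ComplexConjugate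

/-! ### Traces over orthonormal frames -/

section Frames

variable {n : ℕ}

/-- The tangent space as a complex subspace. -/
def tangSub (z : Amb n) : Submodule ℂ (Amb n) :=
  LinearMap.ker (LinearMap.mk (AddHom.mk (dot z) (dot_add_right z)) (fun c v => dot_smul_right c z v) :
    Amb n →ₗ[ℂ] ℂ)

theorem finrank_tangSub {z : Amb n} (hz : z ≠ 0) : Module.finrank ℝ (tangSub z) = 2 * n := by
  rw [finrank_real_of_complex]
  set f : Amb n →ₗ[ℂ] ℂ :=
    LinearMap.mk (AddHom.mk (dot z) (dot_add_right z)) (fun c v => dot_smul_right c z v) with hf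
  have h1 : Function.Surjective f := by
    refine LinearMap.surjective fun h => ?_
    -- The functional is nonzero because it sends z̄ to |z|².
    have h2 : f (conjVec z) = 0 := by rw [h]; rfl
    have h3 : f (conjVec z) = (‖z‖ : ℂ) ^ 2 := by
      change dot z (conjVec z) = _
      rw [dot_conjVec_right, dot_conjVec_self']
    exact norm_sq_ofReal_ne hz (h3.symm.trans h2)
  have h2 := f.finrank_range_add_finrank_ker
  rw [LinearMap.range_eq_top.2 h1, finrank_top, Module.finrank_self, finrank_euclideanSpace,
    Fintype.card_fin] at h2
  change 2 * Module.finrank ℂ (LinearMap.ker f) = 2 * n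
  omega

theorem coneMetric_bilinear (hn : 2 < n) (a : ℝ) {z : Amb n} (hz : z ≠ 0) :
    ∃ b : Amb n →ₗ[ℝ] Amb n →ₗ[ℝ] ℝ, ∀ v w, coneMetric n a z v w = b v w := by
  obtain ⟨b, hb⟩ := radialForm_bilinear (a * coneDeriv n (‖z‖ ^ 2)) (a * coneDeriv₂ n (‖z‖ ^ 2)) z
    (ContinuousLinearMap.id ℝ (Amb n))
  exact ⟨b, fun v w => (coneMetric_eq_radialForm hn a hz v w).trans (hb v w)⟩

/-- Orthonormality makes the 2n vectors linearly independent, hence a basis by the real dimension of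
the tangent space. -/
theorem IsFrame.expand (hn : 2 < n) {a : ℝ} {z : Amb n} (hz : z ≠ 0) {e : Fin n × Fin 2 → Amb n}
    (he : IsFrame n a z e) {v : Amb n} (hv : v ∈ tang z) : v = ∑ i, coneMetric n a z v (e i) • e i := by
  obtain ⟨b, hb⟩ := coneMetric_bilinear hn a hz
  have hbe : ∀ i j, b (e i) (e j) = if i = j then 1 else 0 := fun i j => by rw [← hb]; exact he.2 i j
  let ψ : (Fin n × Fin 2 → ℝ) →ₗ[ℝ] tangSub z :=
    Fintype.linearCombination ℝ (fun i => (⟨e i, he.1 i⟩ : tangSub z))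
  have hψ : ∀ c, ((ψ c : tangSub z) : Amb n) = ∑ i, c i • e i := fun c => by
    simp [ψ, Fintype.linearCombination_apply]
  have hc : ∀ c j, b (ψ c : tangSub z) (e j) = c j := fun c j => by
    rw [hψ]
    simp [hbe]
  have hinj : Function.Injective ψ := fun c c' h => funext fun j => by rw [← hc c, ← hc c', h]
  have hsurj : Function.Surjective ψ := by
    refine (LinearMap.injective_iff_surjective_of_finrank_eq_finrank ?_).1 hinj
    rw [finrank_tangSub hz]
    simp [mul_comm]
  obtain ⟨c, h⟩ := hsurj ⟨v, hv⟩
  have h1 : v = ∑ i, c i • e i := by rw [← hψ, h]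
  have h2 : ∀ j, coneMetric n a z v (e j) = c j := fun j => by rw [hb, ← hc c, h]
  simp only [h2]
  exact h1

theorem coneMetric_I_smul (hn : 2 < n) (a : ℝ) {z : Amb n} (hz : z ≠ 0) (v w : Amb n) :
    coneMetric n a z (Complex.I • v) w = -coneMetric n a z v (Complex.I • w) := by
  rw [coneMetric_eq hn a hz, coneMetric_eq hn a hz]
  simp only [conjVec_smul, dot_smul_left, dot_smul_right, map_mul, Complex.conj_I, Complex.mul_re,
    Complex.mul_im, Complex.neg_re, Complex.neg_im, Complex.I_re, Complex.I_im, Complex.conj_re,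
    Complex.conj_im]
  ring

/-- Forms of type `(2, 0) + (0, 2)` are tracefree. -/
theorem IsFrame.sum_eq_zero (hn : 2 < n) {a : ℝ} {z : Amb n} (hz : z ≠ 0)
    {e : Fin n × Fin 2 → Amb n} (he : IsFrame n a z e) (B : Amb n →ₗ[ℝ] Amb n →ₗ[ℝ] ℂ)
    (hB : ∀ v w, B (Complex.I • v) (Complex.I • w) = -B v w) : ∑ i, B (e i) (e i) = 0 := by
  have hI : ∀ i, Complex.I • e i ∈ tang z := fun i => tang_smul _ (he.1 i)
  -- Multiplication by i is a g₀-isometry of the tangent space, so the frame i·e gives the same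
  -- trace: expand i·e_i in the frame e, exchange the sums, and recognise e_j expanded in the frame
  -- i·e.
  have h1 : ∑ i, B (Complex.I • e i) (Complex.I • e i) = ∑ i, B (e i) (e i) := by
    calc ∑ i, B (Complex.I • e i) (Complex.I • e i)
        = ∑ i, ∑ j, coneMetric n a z (Complex.I • e i) (e j) • B (Complex.I • e i) (e j) := by
          refine Finset.sum_congr rfl fun i _ => ?_
          have h := congrArg (B (Complex.I • e i)) (he.expand hn hz (hI i))
          rw [map_sum] at h
          simpa only [map_smul] using h
      _ = ∑ j, ∑ i, coneMetric n a z (Complex.I • e i) (e j) • B (Complex.I • e i) (e j) :=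
          Finset.sum_comm
      _ = ∑ j, B (e j) (e j) := by
          refine Finset.sum_congr rfl fun j _ => ?_
          have h2 : e j = ∑ i, coneMetric n a z (Complex.I • e i) (e j) • (Complex.I • e i) := by
            have h3 := congrArg (fun v => -(Complex.I • v)) (he.expand hn hz (hI j))
            simp only [smul_smul, Complex.I_mul_I, neg_smul, one_smul, neg_neg, Finset.smul_sum] at h3
            refine h3.trans ?_
            rw [← Finset.sum_neg_distrib]
            refine Finset.sum_congr rfl fun i _ => ?_
            rw [coneMetric_I_smul hn a hz, coneMetric_comm hn a hz (e j), neg_smul, smul_neg, neg_neg,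
              smul_comm]
          have h := congrArg (fun v => B v (e j)) h2
          simp only [map_sum, map_smul, LinearMap.sum_apply, LinearMap.smul_apply] at h
          exact h.symm
  have h2 : ∑ i, B (Complex.I • e i) (Complex.I • e i) = -∑ i, B (e i) (e i) := by
    simp only [hB, Finset.sum_neg_distrib]
  rw [h1] at h2
  exact self_eq_neg.1 h2

theorem IsFrame.sum_dot_self (hn : 2 < n) {a : ℝ} {z : Amb n} (hz : z ≠ 0)
    {e : Fin n × Fin 2 → Amb n} (he : IsFrame n a z e) : ∑ i, dot (e i) (e i) = 0 := by
  refine he.sum_eq_zero hn hz (LinearMap.mk₂ ℝ dot dot_add_left (fun c v w => by simp) dot_add_right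
    (fun c v w => by simp)) fun v w => ?_
  simp [← mul_assoc]

theorem IsFrame.sum_dot_mul_dot (hn : 2 < n) {a : ℝ} {z : Amb n} (hz : z ≠ 0)
    {e : Fin n × Fin 2 → Amb n} (he : IsFrame n a z e) (c d : Amb n) :
    ∑ i, dot c (e i) * dot d (e i) = 0 := by
  refine he.sum_eq_zero hn hz (LinearMap.mk₂ ℝ (fun v w => dot c v * dot d w) ?_ ?_ ?_ ?_)
    fun v w => ?_
  · intros; simp; ring
  · intros; simp; ring
  · intros; simp; ring
  · intros; simp; ring
  · simp only [LinearMap.mk₂_apply, dot_smul_right]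
    linear_combination (dot c v * dot d w) * Complex.I_mul_I

/-- On tangent and non-tangent vectors alike g₀(z,·) = κ Re⟨z,·⟩, so the frame expansion of the
tangent vector z shows that the sum of Re⟨z,e_i⟩ e_i is z/κ, and z·w = 0. -/
theorem IsFrame.sum_re_mul_dot (hn : 2 < n) {a : ℝ} (ha : 0 < a) {z : Amb n} (hz : z ∈ cone n)
    {e : Fin n × Fin 2 → Amb n} (he : IsFrame n a z e) {w : Amb n} (hw : w ∈ tang z) :
    ∑ i, ((dot (conjVec z) (e i)).re : ℂ) * dot (e i) w = 0 := by
  have hz0 := hz.1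
  have hzt : z ∈ tang z := hz.2
  have hpos : 0 < ‖z‖ ^ 2 := by positivity
  have hn' : (n : ℝ) ≠ 0 := by exact_mod_cast (by omega : n ≠ 0)
  set κ : ℝ := 2 * a * coneDeriv n (‖z‖ ^ 2) * (1 - 1 / n) with hκ
  have hκ0 : κ ≠ 0 := by
    have := coneDeriv_pos hn hpos
    have := exponent_pos hn
    positivity
  have h1 : ∀ v, coneMetric n a z z v = κ * (dot (conjVec z) v).re := fun v => by
    rw [coneMetric_eq hn a hz0, dot_conjVec_self, Complex.re_ofReal_mul, Complex.conj_re, hκ]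
    field_simp
  have h2 := congrArg (fun v => dot v w) (he.expand hn hz0 hzt)
  have h3 : dot z w = ∑ i, (κ : ℂ) * (((dot (conjVec z) (e i)).re : ℂ) * dot (e i) w) := by
    refine h2.trans ?_
    have h4 : ∀ f : Fin n × Fin 2 → Amb n, dot (∑ i, f i) w = ∑ i, dot (f i) w := fun f =>
      map_sum ((dotR n).flip w) f Finset.univ
    simp only [h4, dot_real_smul_left, h1, Complex.ofReal_mul, mul_assoc]
  rw [← Finset.mul_sum] at h3
  have h5 : dot z w = 0 := hw
  rw [h5] at h3
  exact (mul_eq_zero.1 h3.symm).resolve_left (by exact_mod_cast hκ0)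

theorem sum_leading_eq_zero (hn : 2 < n) {a : ℝ} {z : Amb n} (hz : z ≠ 0)
    {e : Fin n × Fin 2 → Amb n} (he : IsFrame n a z e) : ∑ i, leading n a z (e i) (e i) = 0 := by
  simp only [leading]
  rw [← Finset.mul_sum, ← Complex.re_sum, he.sum_dot_self hn hz]
  simp

/-! ### The Bianchi gauge condition -/

/-- On the cone the derivative of the projected field is a multiple of z̄, which the projection
kills, and every multiple of z disappears on pairing with a tangent w. Only the two mixed
Christoffel terms survive. -/
theorem dot_conn {z u v w : Amb n} (hz : z ∈ cone n) (hu : u ∈ tang z) (hv : v ∈ tang z)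
    (hw : w ∈ tang z) : dot (conn n z u v) w =
      -((1 / (n * ‖z‖ ^ 2) : ℝ) : ℂ) *
        (dot (conjVec z) u * dot v w + dot (conjVec z) v * dot u w) := by
  obtain ⟨L, hL, hL'⟩ := hasFDerivAt_proj hz.1 v
  have hzt : z ∈ tang z := hz.2
  have h1 : dot z v = 0 := hv
  have h2 : dot z w = 0 := hw
  have h3 : projSelf z = z := proj_of_mem hzt
  have h4 : dot (conjVec z) (conjVec z) = 0 := by rw [dot_conjVec_conjVec, hz.2, map_zero]
  have h5 : L u = -(((‖z‖ ^ 2)⁻¹ : ℝ) • (dot u v • conjVec z)) := by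
    rw [hL', h1]; simp
  have h6 : proj z (L u) = 0 := by
    rw [h5, real_smul_eq, smul_smul, ← neg_smul, proj_smul, proj_conjVec hz.1, smul_zero]
  have h7 : dot (conjVec z) (L u) = 0 := by simp [h5, h4]
  rw [conn, proj_of_mem hu, proj_of_mem hv, hL.fderiv, christoffel, metricInv, h3, h6, h7]
  simp only [dot_add_left, dot_sub_left, dot_smul_left, dot_real_smul_left, h2, dot_zero_left,
    mul_zero]
  ring

/-- The first coefficient comes from differentiating the power of τ and the second from the
connection. The last combines -1, from differentiating the projected arguments, with 1/n from the
connection. -/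
theorem covDeriv_leading (hn : 2 < n) {a : ℝ} (ha : 0 < a) {z u v w : Amb n} (hz : z ∈ cone n)
    (hu : u ∈ tang z) (hv : v ∈ tang z) (hw : w ∈ tang z) :
    covDeriv n a (toTensor (leading n a)) z ![u, v, w] =
      2 * a * leadConst n * (1 - 1 / (n : ℝ)) * (‖z‖ ^ 2) ^ (-(1 / (n : ℝ)) - 1 - 1) *
        (-(2 * (1 / n + 1)) * ((dot (conjVec z) u).re * (dot v w).re) +
          2 / n * (dot (conjVec z) u * dot v w).re -
          (1 - 1 / n) * (dot u v * dot (conjVec z) w + dot u w * dot (conjVec z) v).re) := by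
  have hpos : 0 < ‖z‖ ^ 2 := by have := hz.1; positivity
  have hn' : (n : ℝ) ≠ 0 := by exact_mod_cast (by omega : n ≠ 0)
  set c := 2 * a * leadConst n * (1 - 1 / (n : ℝ)) with hc
  obtain ⟨Lv, hLv, hLv'⟩ := hasFDerivAt_proj hz.1 v
  obtain ⟨Lw, hLw, hLw'⟩ := hasFDerivAt_proj hz.1 w
  have hzv : dot z v = 0 := hv
  have hzw : dot z w = 0 := hw
  have h0 := ((Real.hasDerivAt_rpow_const (x := ‖z‖ ^ 2) (p := -(1 / (n : ℝ)) - 1)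
      (Or.inl hpos.ne')).comp_hasFDerivAt z (hasFDerivAt_norm_sq z)).const_mul c
  have h2 := Complex.reCLM.hasFDerivAt.comp z ((dotR n).hasFDerivAt_of_bilinear hLv hLw)
  have h3 := (h0.mul h2).congr_of_eventuallyEq (f₁ := fun y : Amb n =>
    leading n a y (proj y v) (proj y w)) (Eventually.of_forall fun y => rfl)
  have h4 : fderiv ℝ (fun y => toTensor (leading n a) y fun i => proj y (![v, w] i)) z u = _ :=
    congrArg (fun L : Amb n →L[ℝ] ℝ => L u) h3.fderiv
  rw [covDeriv_eq hn ha _ hz.1]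
  simp only [Matrix.cons_val_zero, Matrix.cons_val_succ, proj_of_mem hu, Fin.sum_univ_two]
  rw [h4]
  have e1 : toTensor (leading n a) z (Function.update (fun j => proj z (![v, w] j)) 0 (conn n z u v)) =
      leading n a z (conn n z u v) w := by
    simp [toTensor, proj_of_mem hw]
  have e2 : toTensor (leading n a) z (Function.update (fun j => proj z (![v, w] j)) 1 (conn n z u w)) =
      leading n a z v (conn n z u w) := by
    simp [toTensor, proj_of_mem hv]
  simp only [Matrix.cons_val_zero, Matrix.cons_val_one]
  rw [e1, e2]
  simp only [leading, ← hc]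
  rw [dot_comm v (conn n z u w), dot_conn hz hu hv hw, dot_conn hz hu hw hv, dot_comm w v,
    Real.rpow_sub_one hpos.ne' (-(1 / (n : ℝ)) - 1)]
  simp [hLv', hLw', hzv, hzw, proj_of_mem hv, proj_of_mem hw, dot_conjVec_right]
  have r1 : ((‖z‖ : ℂ) ^ 2).re = ‖z‖ ^ 2 := by rw [← Complex.ofReal_pow, Complex.ofReal_re]
  have r2 : ((‖z‖ : ℂ) ^ 2).im = 0 := by rw [← Complex.ofReal_pow, Complex.ofReal_im]
  have hz' : ‖z‖ ≠ 0 := norm_ne_zero_iff.2 hz.1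
  rw [r1, r2]
  generalize (‖z‖ ^ 2) ^ (-(n : ℝ)⁻¹ - 1) = P
  field_simp
  ring

/-- Each sum over the frame contains a trace of a complex bilinear form or the contraction of z with
the tangent vector w, and is zero. -/
theorem bianchi_leading (hn : 2 < n) {a : ℝ} (ha : 0 < a) {z : Amb n} (hz : z ∈ cone n)
    {e : Fin n × Fin 2 → Amb n} (he : IsFrame n a z e) {w : Amb n} (hw : w ∈ tang z) :
    bianchi n a (leading n a) z e w = 0 := by
  have s1 := he.sum_dot_self hn hz.1
  have s2 := he.sum_dot_mul_dot hn hz.1 (conjVec z) w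
  have s3 := he.sum_re_mul_dot hn ha hz hw
  have s3' : ∑ i, (dot (conjVec z) (e i)).re * (dot (e i) w).re = 0 := by
    have := congrArg Complex.re s3
    simpa only [Complex.re_sum, Complex.re_ofReal_mul, Complex.zero_re] using this
  rw [bianchi]
  simp only [covDeriv_leading hn ha hz (he.1 _) (he.1 _) hw,
    covDeriv_leading hn ha hz hw (he.1 _) (he.1 _), ← Finset.mul_sum, Finset.sum_add_distrib,
    Finset.sum_sub_distrib, ← Complex.re_sum]
  have d1 : ∑ i, dot (e i) w * dot (conjVec z) (e i) = 0 := by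
    rw [← s2]; exact Finset.sum_congr rfl fun i _ => by rw [dot_comm w, mul_comm]
  have d2 : ∑ i, dot w (e i) * dot (conjVec z) (e i) = 0 := by
    rw [← s2]; exact Finset.sum_congr rfl fun i _ => by rw [mul_comm]
  have d3 : ∑ i, dot (conjVec z) (e i) * dot (e i) w = 0 := by
    rw [← s2]; exact Finset.sum_congr rfl fun i _ => by rw [dot_comm w]
  rw [d1, d2, d3, s3', ← Finset.sum_mul, s1]
  simp

end Frames

end Stenzel

end

noncomputable section

namespace Stenzel

open Filter Asymptotics Topology Bornology ComplexConjugate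

/-! ### The explicit frame -/

section Explicit

variable {n : ℕ}

theorem dot_single_right (v : Amb n) (i : Fin (n + 1)) (c : ℂ) :
    dot v (EuclideanSpace.single i c) = v i * c := by
  simp [dot]

theorem conjVec_single (i : Fin (n + 1)) (c : ℂ) :
    conjVec (EuclideanSpace.single i c : Amb n) = EuclideanSpace.single i (conj c) := by
  ext j
  by_cases h : j = i <;> simp [conjVec, h]

theorem act_dot (A : Matrix (Fin (n + 1)) (Fin (n + 1)) ℝ) (hA : A ∈ Matrix.specialOrthogonalGroup (Fin (n + 1)) ℝ)
    -- Only AᵀA = 1 is used; the determinant is irrelevant.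
    (v w : Amb n) : dot (act A v) (act A w) = dot v w := by
  have h1 : A.transpose * A = 1 := by
    have := (Matrix.mem_specialOrthogonalGroup_iff.1 hA).1
    exact (Matrix.mem_orthogonalGroup_iff' (Fin (n + 1)) ℝ).1 this
  have h2 : ∀ j k, ∑ i, (A i j : ℂ) * A i k = if j = k then 1 else 0 := fun j k => by
    have := congrFun (congrFun h1 j) k
    rw [Matrix.mul_apply, Matrix.one_apply] at this
    simp only [Matrix.transpose_apply] at this
    have h3 := congrArg (fun x : ℝ => (x : ℂ)) this
    rw [Complex.ofReal_sum] at h3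
    simp only [Complex.ofReal_mul] at h3
    rw [h3]
    split_ifs <;> simp
  calc dot (act A v) (act A w) = ∑ i, ∑ j, ∑ k, (A i j : ℂ) * A i k * (v j * w k) := by
        simp only [dot, act, Finset.sum_mul_sum]
        refine Finset.sum_congr rfl fun i _ => Finset.sum_congr rfl fun j _ =>
          Finset.sum_congr rfl fun k _ => by ring
    _ = ∑ j, ∑ k, ∑ i, (A i j : ℂ) * A i k * (v j * w k) := by
        rw [Finset.sum_comm]
        refine Finset.sum_congr rfl fun j _ => Finset.sum_comm
    _ = dot v w := by
        simp only [← Finset.sum_mul, h2, ite_mul, one_mul, zero_mul, Finset.sum_ite_eq,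
          Finset.mem_univ, if_true, dot]

theorem conjVec_act (A : Matrix (Fin (n + 1)) (Fin (n + 1)) ℝ) (v : Amb n) :
    conjVec (act A v) = act A (conjVec v) := by
  ext i; simp [conjVec, act]

theorem leading_act (a : ℝ) {A : Matrix (Fin (n + 1)) (Fin (n + 1)) ℝ}
    (hA : A ∈ Matrix.specialOrthogonalGroup (Fin (n + 1)) ℝ) (z v w : Amb n) :
    leading n a (act A z) (act A v) (act A w) = leading n a z v w := by
  have h1 : ‖act A z‖ ^ 2 = ‖z‖ ^ 2 := by
    have : ((‖act A z‖ ^ 2 : ℝ) : ℂ) = ((‖z‖ ^ 2 : ℝ) : ℂ) := by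
      rw [← dot_conjVec_self, ← dot_conjVec_self, conjVec_act, act_dot A hA]
    exact_mod_cast this
  rw [leading, leading, h1, act_dot A hA]

theorem leading_eq (hn : 2 < n) (a : ℝ) {z : Amb n} (hz : z ≠ 0) (v w : Amb n) :
    leading n a z v w = 2 * a * coneDeriv n (‖z‖ ^ 2) / ‖z‖ ^ 2 * (dot v w).re := by
  have hpos : 0 < ‖z‖ ^ 2 := by positivity
  rw [leading, mul_assoc (2 * a), leadConst_mul hn, coneDeriv, Real.rpow_sub_one hpos.ne']
  ring

theorem basePoint_eq (hn : 2 < n) (t : ℝ) : basePoint n t =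
    EuclideanSpace.single (0 : Fin (n + 1)) ((√(t / 2) : ℝ) : ℂ) +
      EuclideanSpace.single (⟨1, by omega⟩ : Fin (n + 1)) (Complex.I * (√(t / 2) : ℝ)) := by
  ext i
  simp only [basePoint, PiLp.add_apply, PiLp.single_apply, Fin.ext_iff, Fin.val_zero]
  by_cases h0 : i.val = 0
  · simp [h0]
  · by_cases h1 : i.val = 1 <;> simp [h0, h1]

theorem dot_basePoint (hn : 2 < n) {t : ℝ} : dot (basePoint n t) (basePoint n t) = 0 := by
  conv_lhs => arg 2; rw [basePoint_eq hn]
  rw [dot_add_right, dot_single_right, dot_single_right]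
  simp only [basePoint, Fin.val_zero, if_true, one_ne_zero, if_false]
  linear_combination (√(t / 2) : ℂ) ^ 2 * Complex.I_mul_I

theorem norm_basePoint_sq (hn : 2 < n) {t : ℝ} (ht : 0 < t) : ‖basePoint n t‖ ^ 2 = t := by
  have h : ((‖basePoint n t‖ ^ 2 : ℝ) : ℂ) = (t : ℂ) := by
    rw [← dot_conjVec_self]
    conv_lhs => arg 2; rw [basePoint_eq hn]
    rw [dot_add_right, dot_single_right, dot_single_right]
    simp only [conjVec, basePoint, Fin.val_zero, if_true, one_ne_zero, if_false, map_mul,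
      Complex.conj_I, Complex.conj_ofReal]
    have h1 : ((√(t / 2) : ℝ) : ℂ) ^ 2 = ((t / 2 : ℝ) : ℂ) := by
      rw [← Complex.ofReal_pow, Real.sq_sqrt (by positivity)]
    push_cast at h1
    linear_combination (-(√(t / 2) : ℂ) ^ 2) * Complex.I_mul_I + 2 * h1
  exact_mod_cast h

theorem basePoint_mem (hn : 2 < n) {t : ℝ} (ht : 0 < t) : basePoint n t ∈ cone n := by
  refine ⟨fun h => ?_, dot_basePoint hn⟩
  have := norm_basePoint_sq hn ht
  rw [h, norm_zero] at this
  norm_num at this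
  exact ht.ne this

/-- The vectors of `frame` before multiplication by `1` or `i`. -/
def frameVec (n : ℕ) (a t s : ℝ) (j : Fin n) : Amb n :=
  if j.val = 0 then radial n a (basePoint n t) else EuclideanSpace.single j.succ (s : ℂ)

theorem basePoint_succ {t : ℝ} {j : Fin n} (hj : j.val ≠ 0) : basePoint n t j.succ = 0 := by
  simp [basePoint, hj]

/-- The scale of the vectors `X_j`, `Y_j`. -/
def frameScale (n : ℕ) (a t : ℝ) : ℝ := (√(2 * a * coneDeriv n t))⁻¹

theorem frameScale_sq (hn : 2 < n) {a t : ℝ} (ha : 0 < a) (ht : 0 < t) :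
    2 * a * coneDeriv n t * frameScale n a t ^ 2 = 1 := by
  have := coneDeriv_pos hn ht
  have h : 0 < 2 * a * coneDeriv n t := by positivity
  rw [frameScale, inv_pow, Real.sq_sqrt h.le, mul_inv_cancel₀ h.ne']

/-- This says that ∂_r has g₀-length one: on multiples of z the second term of g₀ removes the
fraction 1/n of the first. -/
theorem radial_scale_sq (hn : 2 < n) {a t : ℝ} (ha : 0 < a) (ht : 0 < t) :
    2 * a * coneDeriv n t * (1 - 1 / n) * t *
      ((n : ℝ) / ((n - 1) * radius n a (basePoint n t))) ^ 2 = 1 := by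
  have hn' : (3 : ℝ) ≤ n := by exact_mod_cast hn
  have hn1 : (n : ℝ) - 1 ≠ 0 := by linarith
  have hC := leadConst_pos hn
  have h1 : radius n a (basePoint n t) ^ 2 = 2 * (a * leadConst n * (t * t ^ (-(1 / (n : ℝ))))) := by
    rw [radius, conePotential, norm_basePoint_sq hn ht, Real.sq_sqrt (by positivity)]
    congr 2
    rw [sub_eq_add_neg, Real.rpow_add ht, Real.rpow_one]
  have h2 : 0 < t ^ (-(1 / (n : ℝ))) := by positivity
  rw [div_pow, mul_pow, h1, coneDeriv, ← leadConst_mul hn]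
  field_simp

theorem frame_gram (hn : 2 < n) (a : ℝ) {t : ℝ} (ht : 0 < t) (s : ℝ) (i j : Fin n) :
    dot (conjVec (frameVec n a t s i)) (frameVec n a t s j) =
      if i = j then (if i.val = 0 then
        ((t * ((n : ℝ) / ((n - 1) * radius n a (basePoint n t))) ^ 2 : ℝ) : ℂ) else ((s ^ 2 : ℝ) : ℂ))
      else 0 := by
  by_cases hi : i.val = 0 <;> by_cases hj : j.val = 0
  · have hij : i = j := Fin.ext (by omega)
    subst hij
    simp only [frameVec, hi, if_true, radial, conjVec_real_smul, dot_real_smul_left,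
      dot_real_smul_right, dot_conjVec_self, norm_basePoint_sq hn ht]
    push_cast
    ring
  · have hij : i ≠ j := fun h => hj (h ▸ hi)
    simp [frameVec, hi, hj, radial, dot_single_right, hij, conjVec, basePoint_succ hj]
  · have hij : i ≠ j := fun h => hi (h ▸ hj)
    rw [dot_comm]
    simp [frameVec, hi, hj, radial, conjVec_single, dot_single_right, hij, basePoint_succ hi]
  · simp only [frameVec, hi, hj, if_false, conjVec_single, dot_single_right, PiLp.single_apply,
      Complex.conj_ofReal, Fin.succ_inj, eq_comm (a := j)]
    split_ifs <;> simp [sq]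

theorem frame_dot (hn : 2 < n) (a : ℝ) {t : ℝ} (s : ℝ) (i j : Fin n) :
    dot (frameVec n a t s i) (frameVec n a t s j) =
      if i = j then (if i.val = 0 then 0 else ((s ^ 2 : ℝ) : ℂ)) else 0 := by
  by_cases hi : i.val = 0 <;> by_cases hj : j.val = 0
  · simp only [frameVec, hi, hj, if_true, radial, dot_real_smul_left, dot_real_smul_right,
      dot_basePoint hn, mul_zero, ite_self]
  · have hij : i ≠ j := fun h => hj (h ▸ hi)
    simp [frameVec, hi, hj, radial, dot_single_right, hij, basePoint_succ hj]
  · have hij : i ≠ j := fun h => hi (h ▸ hj)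
    rw [dot_comm]
    simp [frameVec, hi, hj, radial, dot_single_right, hij, basePoint_succ hi]
  · simp only [frameVec, hi, hj, if_false, dot_single_right, PiLp.single_apply,
      Fin.succ_inj, eq_comm (a := j)]
    split_ifs <;> simp [sq]

theorem dot_basePoint_frameVec (hn : 2 < n) (a t s : ℝ) (i : Fin n) :
    dot (basePoint n t) (frameVec n a t s i) = 0 := by
  by_cases hi : i.val = 0
  · simp [frameVec, hi, radial, dot_basePoint hn]
  · simp [frameVec, hi, dot_single_right, basePoint_succ hi]

theorem dot_conjVec_basePoint_frameVec (hn : 2 < n) (a : ℝ) {t : ℝ} (ht : 0 < t) (s : ℝ) (i : Fin n) :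
    dot (conjVec (basePoint n t)) (frameVec n a t s i) = if i.val = 0 then
      ((t * ((n : ℝ) / ((n - 1) * radius n a (basePoint n t))) : ℝ) : ℂ) else 0 := by
  by_cases hi : i.val = 0
  · simp only [frameVec, hi, if_true, radial, dot_real_smul_right, dot_conjVec_self,
      norm_basePoint_sq hn ht]
    push_cast
    ring
  · simp [frameVec, hi, dot_single_right, conjVec, basePoint_succ hi]

theorem frame_eq (a t s : ℝ) (i : Fin n × Fin 2) : frame n a t s i =
    (if i.2 = 0 then (1 : ℂ) else Complex.I) • frameVec n a t s i.1 := rfl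

theorem ofReal_sq_re (x : ℝ) : ((x : ℂ) ^ 2).re = x ^ 2 := by
  rw [← Complex.ofReal_pow, Complex.ofReal_re]

theorem ofReal_sq_im (x : ℝ) : ((x : ℂ) ^ 2).im = 0 := by
  rw [← Complex.ofReal_pow, Complex.ofReal_im]

theorem isFrame_frame (hn : 2 < n) {a t : ℝ} (ha : 0 < a) (ht : 0 < t) :
    IsFrame n a (basePoint n t) (frame n a t (frameScale n a t)) := by
  have hz := basePoint_mem hn ht
  refine ⟨fun i => ?_, fun i j => ?_⟩
  · change dot _ _ = 0
    rw [frame_eq, dot_smul_right, dot_basePoint_frameVec hn, mul_zero]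
  · have h1 := frameScale_sq hn ha ht
    have h2 := radial_scale_sq hn ha ht
    rw [coneMetric_eq hn a hz.1, frame_eq, frame_eq, conjVec_smul, dot_smul_left, dot_smul_right,
      dot_smul_right, dot_smul_right, frame_gram hn a ht, dot_conjVec_basePoint_frameVec hn a ht,
      dot_conjVec_basePoint_frameVec hn a ht, norm_basePoint_sq hn ht]
    set ρ := (n : ℝ) / ((n - 1) * radius n a (basePoint n t))
    set s := frameScale n a t
    have hn' : (n : ℝ) ≠ 0 := by exact_mod_cast (by omega : n ≠ 0)
    obtain ⟨i1, i2⟩ := i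
    obtain ⟨j1, j2⟩ := j
    by_cases hij : i1 = j1
    · subst hij
      by_cases hi : i1.val = 0
      · fin_cases i2 <;> fin_cases j2 <;> simp [hi, ofReal_sq_re, ofReal_sq_im]
        all_goals
          rw [← h2]
          field_simp
      · fin_cases i2 <;> fin_cases j2 <;> simp [hi, ofReal_sq_re, ofReal_sq_im, h1]
    · have h3 : ¬(i1.val = 0 ∧ j1.val = 0) := fun h => hij (Fin.ext (by omega))
      by_cases hi : i1.val = 0 <;> by_cases hj : j1.val = 0 <;> simp_all

theorem leading_frame (hn : 2 < n) {a t : ℝ} (ha : 0 < a) (ht : 0 < t) (i j : Fin n × Fin 2) :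
    leading n a (basePoint n t) (frame n a t (frameScale n a t) i) (frame n a t (frameScale n a t) j) =
      if i = j then t⁻¹ * diagEntry i else 0 := by
  have hz := basePoint_mem hn ht
  have h1 := frameScale_sq hn ha ht
  rw [leading_eq hn a hz.1, norm_basePoint_sq hn ht, frame_eq, frame_eq, dot_smul_left, dot_smul_right,
    frame_dot hn]
  set s := frameScale n a t
  obtain ⟨i1, i2⟩ := i
  obtain ⟨j1, j2⟩ := j
  by_cases hij : i1 = j1
  · subst hij
    by_cases hi : i1.val = 0
    · fin_cases i2 <;> fin_cases j2 <;> simp [hi, diagEntry]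
    · fin_cases i2 <;> fin_cases j2 <;> simp [hi, diagEntry, ofReal_sq_re, ofReal_sq_im]
      all_goals
        rw [div_mul_eq_mul_div, h1, one_div]
  · simp [hij]

end Explicit

end Stenzel

end

noncomputable section

namespace Stenzel

open Filter Asymptotics Topology Bornology ComplexConjugate

/-! ### Rates -/

section Rate

/-- With r = c t^(p/2), the function 1/t is a multiple of r^(-2/p). If both exponents on the right
were smaller than -2/p, multiplying by t would give 1 ≤ o(1). -/
theorem exponent_le_of_eventually_inv_le {p c K₁ K₂ m l : ℝ} (hp : 0 < p) (hc : 0 < c)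
    (hl : l < -2 / p)
    (h : ∀ᶠ t : ℝ in atTop, t⁻¹ ≤ K₁ * (c * t ^ (p / 2)) ^ m + K₂ * (c * t ^ (p / 2)) ^ l) :
    -2 / p ≤ m := by
  by_contra! hm
  have aux : ∀ (K k : ℝ), k < -2 / p →
      Tendsto (fun t : ℝ => K * (c * t ^ (p / 2)) ^ k * t) atTop (𝓝 0) := by
    intro K k hk
    have h1 : 0 < -(p / 2 * k + 1) := by
      rw [lt_div_iff₀ hp] at hk
      linarith
    have h2 := (tendsto_rpow_neg_atTop h1).const_mul (K * c ^ k)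
    rw [mul_zero, neg_neg] at h2
    refine h2.congr' ?_
    filter_upwards [eventually_gt_atTop 0] with t ht
    rw [Real.mul_rpow hc.le (by positivity), ← Real.rpow_mul ht.le, Real.rpow_add ht,
      Real.rpow_one]
    ring
  have h3 := (aux K₁ m hm).add (aux K₂ l hl)
  rw [add_zero] at h3
  obtain ⟨t, h4, h5, h6⟩ := ((h3.eventually (gt_mem_nhds one_pos)).and
    (h.and (eventually_gt_atTop 0))).exists
  have := mul_le_mul_of_nonneg_right h5 h6.le
  rw [inv_mul_cancel₀ h6.ne'] at this
  linarith

variable {n : ℕ} {a : ℝ}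

theorem HasDecay.bound {b : Amb n → Amb n → Amb n → ℝ} {l : ℝ}
    (h : HasDecay n a (toTensor b) l) : ∃ K R : ℝ, ∀ z ∈ cone n, R < radius n a z →
      ∀ v ∈ tang z, ∀ w ∈ tang z, |b z v w| ≤
        K * radius n a z ^ l * (√(coneMetric n a z v v) * √(coneMetric n a z w w)) := by
  obtain ⟨K, R, h⟩ := h 0
  refine ⟨K, R, fun z hz hr v hv w hw => ?_⟩
  have := h z hz hr ![v, w] (by simp [Fin.forall_fin_two, hv, hw])
  simpa [covDerivIter, toTensor] using this

theorem radius_of_norm_sq (hn : 2 < n) (ha : 0 < a) {z : Amb n} {t : ℝ} (hz : ‖z‖ ^ 2 = t) :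
    radius n a z = radiusConst n a * t ^ ((1 - 1 / (n : ℝ)) / 2) := by
  rw [radius_eq hn ha, ← hz, ← Real.rpow_natCast ‖z‖ 2, ← Real.rpow_mul (norm_nonneg z)]
  congr 2
  push_cast
  ring

theorem eventually_lt_radius (hn : 2 < n) (ha : 0 < a) (R : ℝ) :
    ∀ᶠ t : ℝ in atTop, R < radiusConst n a * t ^ ((1 - 1 / (n : ℝ)) / 2) :=
  ((tendsto_rpow_atTop (half_pos (exponent_pos hn))).const_mul_atTop
    (radiusConst_pos hn ha)).eventually_gt_atTop R

theorem three_rate_lt (hn : 2 < n) : -3 / (1 - 1 / (n : ℝ)) < -2 / (1 - 1 / (n : ℝ)) :=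
  div_lt_div_of_pos_right (by norm_num) (exponent_pos hn)

theorem rate_eq (hn : 2 < n) : -2 * (n / (n - 1) : ℝ) = -2 / (1 - 1 / (n : ℝ)) := by
  have h1 : (2 : ℝ) < n := by exact_mod_cast hn
  have h2 : (n : ℝ) - 1 ≠ 0 := by linarith
  field_simp

theorem exists_frame_leading_eq (hn : 2 < n) (ha : 0 < a) {t : ℝ} (ht : 0 < t) :
    ∃ z ∈ cone n, ‖z‖ ^ 2 = t ∧ ∃ v ∈ tang z, coneMetric n a z v v = 1 ∧
      leading n a z v v = t⁻¹ := by
  have hF := isFrame_frame hn ha ht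
  -- The vector X₃, the first one on which the diagonal entry is +1.
  let i : Fin n × Fin 2 := (⟨1, by omega⟩, 0)
  refine ⟨_, basePoint_mem hn ht, norm_basePoint_sq hn ht, _, hF.1 i, ?_, ?_⟩
  · rw [hF.2, if_pos rfl]
  · rw [leading_frame hn ha ht, if_pos rfl]
    simp [diagEntry, i]

/-- At every large τ there is a g₀-unit vector on which h is 1/τ. If c decays faster than that, b
cannot; the bounds without derivatives already suffice. -/
theorem rate_le_of_hasDecay_add (hn : 2 < n) (ha : 0 < a) {b c : Amb n → Amb n → Amb n → ℝ}
    {m l : ℝ} (hb : HasDecay n a (toTensor b) m) (hc : HasDecay n a (toTensor c) l)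
    (hl : l < -2 / (1 - 1 / (n : ℝ)))
    (hbc : ∀ z v, leading n a z v v ≤ |b z v v| + |c z v v|) : -2 / (1 - 1 / (n : ℝ)) ≤ m := by
  obtain ⟨K₁, R₁, h₁⟩ := hb.bound
  obtain ⟨K₂, R₂, h₂⟩ := hc.bound
  refine exponent_le_of_eventually_inv_le (K₁ := K₁) (K₂ := K₂) (exponent_pos hn)
    (radiusConst_pos hn ha) hl ?_
  filter_upwards [eventually_gt_atTop 0, eventually_lt_radius hn ha R₁,
    eventually_lt_radius hn ha R₂] with t ht hR₁ hR₂
  obtain ⟨z, hz, hzt, v, hv, hg, hlead⟩ := exists_frame_leading_eq hn ha ht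
  have hr := radius_of_norm_sq hn ha hzt
  rw [← hr] at hR₁ hR₂ ⊢
  have e₁ := h₁ z hz hR₁ v hv v hv
  have e₂ := h₂ z hz hR₂ v hv v hv
  rw [hg, Real.sqrt_one, mul_one, mul_one] at e₁ e₂
  linarith [hbc z v]

theorem hasRate_leading (hn : 2 < n) (ha : 0 < a) :
    HasRate n a (toTensor (leading n a)) (-2 * (n / (n - 1) : ℝ)) := by
  rw [rate_eq hn]
  refine ⟨hasDecay_leading hn ha, fun m hm => ?_⟩
  -- The second form is a mere filler here: any faster decaying form would do.
  exact rate_le_of_hasDecay_add hn ha hm (hasDecay_difference_sub_leading hn ha)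
    (three_rate_lt hn) fun z v => (le_abs_self _).trans (le_add_of_nonneg_right (abs_nonneg _))

theorem hasRate_difference (hn : 2 < n) (ha : 0 < a) :
    HasRate n a (toTensor (difference n a)) (-2 * (n / (n - 1) : ℝ)) := by
  rw [rate_eq hn]
  refine ⟨hasDecay_difference hn ha, fun m hm => ?_⟩
  refine rate_le_of_hasDecay_add hn ha hm (hasDecay_difference_sub_leading hn ha)
    (three_rate_lt hn) fun z v => ?_
  linarith [le_abs_self (difference n a z v v), neg_abs_le (difference n a z v v - leading n a z v v)]

end Rate

end Stenzel

end

noncomputable section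

namespace Stenzel

open Filter Asymptotics Topology Bornology ComplexConjugate

/-! ### Optimality among changes of gauge -/

section Gauge

variable {n : ℕ}

/-- By the divergence theorem the integral of ∂_y B - ∂_x A over the square is a boundary term, zero
by periodicity, so the integrand cannot be positive everywhere. -/
theorem exists_fderiv_le_of_periodic {A B : ℝ × ℝ → ℝ} {T : ℝ} (hT : 0 < T) (hA : ContDiff ℝ 1 A)
    (hB : ContDiff ℝ 1 B) (hAT : ∀ y, A (T, y) = A (0, y)) (hBT : ∀ x, B (x, T) = B (x, 0)) :
    ∃ p, fderiv ℝ B p (0, 1) ≤ fderiv ℝ A p (1, 0) := by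
  by_contra! h
  have cA : Continuous fun p => fderiv ℝ A p (1, 0) :=
    (hA.continuous_fderiv one_ne_zero).clm_apply continuous_const
  have cB : Continuous fun p => fderiv ℝ B p (0, 1) :=
    (hB.continuous_fderiv one_ne_zero).clm_apply continuous_const
  have hc : Continuous fun p => fderiv ℝ B p (0, 1) - fderiv ℝ A p (1, 0) := cB.sub cA
  have key := MeasureTheory.integral2_divergence_prod_of_hasFDerivAt (fun p => -A p) B
    (fun p => -fderiv ℝ A p) (fderiv ℝ B) 0 0 T T hA.continuous.neg.continuousOn
    hB.continuous.continuousOn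
    (fun x _ => (hA.differentiable one_ne_zero x).hasFDerivAt.neg)
    (fun x _ => (hB.differentiable one_ne_zero x).hasFDerivAt)
    ((cA.neg.add cB).continuousOn.integrableOn_compact (isCompact_uIcc.prod isCompact_uIcc))
  simp only [hAT, hBT, sub_self, zero_add] at key
  refine absurd key (ne_of_gt ?_)
  refine intervalIntegral.intervalIntegral_pos_of_pos (Continuous.intervalIntegrable ?_ _ _)
    (fun x => intervalIntegral.intervalIntegral_pos_of_pos (Continuous.intervalIntegrable ?_ _ _)
      (fun y => ?_) hT) hT
  · exact intervalIntegral.continuous_parametric_intervalIntegral_of_continuous'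
      (f := fun x y => (-fderiv ℝ A (x, y)) (1, 0) + fderiv ℝ B (x, y) (0, 1)) (cA.neg.add cB) 0 T
  · exact (cA.neg.add cB).comp (Continuous.prodMk_right x)
  · have := h (x, y)
    change 0 < -fderiv ℝ A (x, y) (1, 0) + fderiv ℝ B (x, y) (0, 1)
    linarith

/-- For ⟨z,v⟩ = 0 the rank-one term of g₀ is quadratic in a vanishing quantity and drops out with
its derivative. What remains is the Euclidean expression and the derivative of the conformal factor
along X. -/
theorem lieMetric_self (hn : 2 < n) (a : ℝ) (X : Amb n → Amb n) {z v : Amb n} (hz : z ≠ 0)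
    (hv : dot (conjVec z) v = 0) : lieMetric n a X z v v = 4 * a * coneDeriv n (‖z‖ ^ 2) *
      ((dot (conjVec (fderiv ℝ X z v)) v).re -
        1 / (n * ‖z‖ ^ 2) * ((dot (conjVec z) (X z)).re * (dot (conjVec v) v).re)) := by
  obtain ⟨L, h1, h2⟩ := hasFDerivAt_coneMetric hn (a := a) hz v v
  have h3 := re_dot_conjVec_comm v (fderiv ℝ X z v)
  rw [lieMetric, h1.fderiv, h2, coneMetric_eq hn a hz, coneMetric_eq hn a hz, hv, h3]
  simp
  ring

/-! ### Tori in the cone -/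

/-- The circle through the orthonormal vectors `u` and `w`. -/
def circ (u w : Amb n) (x : ℝ) : Amb n := Real.cos x • u + Real.sin x • w

theorem hasDerivAt_circ (u w : Amb n) (x : ℝ) :
    HasDerivAt (circ u w) (circ u w (x + Real.pi / 2)) x := by
  have := ((Real.hasDerivAt_cos x).smul_const u).add ((Real.hasDerivAt_sin x).smul_const w)
  rwa [circ, Real.cos_add_pi_div_two, Real.sin_add_pi_div_two]

theorem circ_add_pi (u w : Amb n) (x : ℝ) : circ u w (x + Real.pi) = -circ u w x := by
  simp [circ, Real.cos_add_pi, Real.sin_add_pi, add_comm]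

theorem circ_two_pi (u w : Amb n) : circ u w (2 * Real.pi) = circ u w 0 := by
  simp [circ]

theorem circ_two_pi_add (u w : Amb n) (x : ℝ) : circ u w (2 * Real.pi + x) = circ u w x := by
  simp [circ, Real.cos_add, Real.sin_add]

theorem contDiff_circ (u w : Amb n) : ContDiff ℝ ∞ (circ u w) :=
  (Real.contDiff_cos.smul contDiff_const).add (Real.contDiff_sin.smul contDiff_const)

theorem conjVec_circ {u w : Amb n} (hu : conjVec u = u) (hw : conjVec w = w) (x : ℝ) :
    conjVec (circ u w x) = circ u w x := by
  simp [circ, hu, hw]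

theorem dot_circ_circ {u w : Amb n} (hu : dot u u = 1) (hw : dot w w = 1) (huw : dot u w = 0)
    (x y : ℝ) : dot (circ u w x) (circ u w y) = (Real.cos (x - y) : ℂ) := by
  have hwu : dot w u = 0 := by rw [dot_comm, huw]
  simp [circ, hu, hw, huw, hwu, Real.cos_sub, mul_comm]

theorem dot_circ_circ_eq_zero {u w u' w' : Amb n} (h1 : dot u u' = 0) (h2 : dot u w' = 0)
    (h3 : dot w u' = 0) (h4 : dot w w' = 0) (x y : ℝ) : dot (circ u w x) (circ u' w' y) = 0 := by
  simp [circ, h1, h2, h3, h4]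

/-- The standard real unit vectors. -/
def unitVec (n k : ℕ) : Amb n := EuclideanSpace.single (Fin.ofNat (n + 1) k) 1

theorem conjVec_unitVec (k : ℕ) : conjVec (unitVec n k) = unitVec n k := by
  simp [unitVec, conjVec_single]

theorem dot_unitVec {j k : ℕ} (hj : j ≤ n) (hk : k ≤ n) :
    dot (unitVec n j) (unitVec n k) = if j = k then 1 else 0 := by
  rw [unitVec, unitVec, dot_single_right]
  by_cases h : j = k
  · simp [h]
  · have : Fin.ofNat (n + 1) k ≠ Fin.ofNat (n + 1) j := fun h' => h <| by
      have := congrArg Fin.val h'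
      rw [Fin.val_ofNat, Fin.val_ofNat, Nat.mod_eq_of_lt (by omega), Nat.mod_eq_of_lt (by omega)]
        at this
      exact this.symm
    simp only [PiLp.single_apply, if_neg h, if_neg this, zero_mul]

/-- The real part of the torus below. -/
def realCircle (n : ℕ) : ℝ → Amb n := circ (unitVec n 0) (unitVec n 2)

/-- The imaginary part of the torus below. -/
def imagCircle (n : ℕ) : ℝ → Amb n := circ (unitVec n 1) (unitVec n 3)

theorem dot_realCircle (hn : 2 < n) (x y : ℝ) :
    dot (realCircle n x) (realCircle n y) = (Real.cos (x - y) : ℂ) :=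
  dot_circ_circ (by simp [dot_unitVec]) (by simp [dot_unitVec, hn.le])
    (by simp [dot_unitVec, hn.le]) x y

theorem dot_imagCircle (hn : 2 < n) (x y : ℝ) :
    dot (imagCircle n x) (imagCircle n y) = (Real.cos (x - y) : ℂ) := by
  have : 1 ≤ n := by omega
  have : 3 ≤ n := by omega
  exact dot_circ_circ (by simp [dot_unitVec, *]) (by simp [dot_unitVec, *])
    (by simp [dot_unitVec, *]) x y

theorem dot_realCircle_imagCircle (hn : 2 < n) (x y : ℝ) :
    dot (realCircle n x) (imagCircle n y) = 0 := by
  have : 1 ≤ n := by omega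
  have : 2 ≤ n := by omega
  have : 3 ≤ n := by omega
  exact dot_circ_circ_eq_zero (by simp [dot_unitVec, *]) (by simp [dot_unitVec, *])
    (by simp [dot_unitVec, *]) (by simp [dot_unitVec, *]) x y

theorem dot_imagCircle_realCircle (hn : 2 < n) (x y : ℝ) :
    dot (imagCircle n x) (realCircle n y) = 0 := by
  rw [dot_comm, dot_realCircle_imagCircle hn]

theorem conjVec_realCircle (x : ℝ) : conjVec (realCircle n x) = realCircle n x :=
  conjVec_circ (conjVec_unitVec _) (conjVec_unitVec _) x

theorem conjVec_imagCircle (x : ℝ) : conjVec (imagCircle n x) = imagCircle n x :=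
  conjVec_circ (conjVec_unitVec _) (conjVec_unitVec _) x

/-- A torus in the cone. -/
def torus (n : ℕ) (c : ℝ) (p : ℝ × ℝ) : Amb n :=
  c • realCircle n p.1 + c • (Complex.I • imagCircle n p.2)

/-- The derivative of `torus` in the first variable. -/
def torusFst (n : ℕ) (c x : ℝ) : Amb n := c • realCircle n (x + Real.pi / 2)

/-- The derivative of `torus` in the second variable. -/
def torusSnd (n : ℕ) (c y : ℝ) : Amb n := c • (Complex.I • imagCircle n (y + Real.pi / 2))

theorem hasDerivAt_torus_fst (c x y : ℝ) :
    HasDerivAt (fun x => torus n c (x, y)) (torusFst n c x) x :=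
  ((hasDerivAt_circ (unitVec n 0) (unitVec n 2) x).const_smul c).add_const
    (c • (Complex.I • imagCircle n y))

theorem hasDerivAt_torus_snd (c x y : ℝ) :
    HasDerivAt (fun y => torus n c (x, y)) (torusSnd n c y) y :=
  (((hasDerivAt_circ (unitVec n 1) (unitVec n 3) y).const_smul Complex.I).const_smul c).const_add
    (c • realCircle n x)

/-- Differentiating a circle twice gives its negative, here minus the real part of the torus point.
Writing it through z and z̄ prepares the pairing with X. -/
theorem hasDerivAt_torusFst (c x y : ℝ) : HasDerivAt (torusFst n c)
    (-((1 / 2 : ℝ) • (torus n c (x, y) + conjVec (torus n c (x, y))))) x := by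
  have h := ((hasDerivAt_circ (unitVec n 0) (unitVec n 2) (x + Real.pi / 2)).comp_add_const x
    (Real.pi / 2)).const_smul c
  refine HasDerivAt.congr_deriv (f := torusFst n c) h ?_
  rw [add_assoc, add_halves, circ_add_pi]
  simp only [torus, conjVec_add, conjVec_smul, real_smul_eq, conjVec_realCircle, conjVec_imagCircle,
    smul_smul]
  simp [realCircle]
  module

theorem hasDerivAt_torusSnd (c x y : ℝ) : HasDerivAt (torusSnd n c)
    (-((1 / 2 : ℝ) • (torus n c (x, y) - conjVec (torus n c (x, y))))) y := by
  have h := (((hasDerivAt_circ (unitVec n 1) (unitVec n 3) (y + Real.pi / 2)).comp_add_const y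
    (Real.pi / 2)).const_smul Complex.I).const_smul c
  refine HasDerivAt.congr_deriv (f := torusSnd n c) h ?_
  rw [add_assoc, add_halves, circ_add_pi]
  simp only [torus, conjVec_add, conjVec_smul, real_smul_eq, conjVec_realCircle, conjVec_imagCircle,
    smul_smul]
  simp [imagCircle]
  module

theorem contDiff_torus (c : ℝ) : ContDiff ℝ ∞ (torus n c) :=
  (((contDiff_circ (unitVec n 0) (unitVec n 2)).comp contDiff_fst).const_smul c).add
    ((((contDiff_circ (unitVec n 1) (unitVec n 3)).comp contDiff_snd).const_smul Complex.I).const_smul c)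

theorem contDiff_torusFst (c : ℝ) : ContDiff ℝ ∞ (torusFst n c) :=
  ((contDiff_circ (unitVec n 0) (unitVec n 2)).comp (contDiff_id.add contDiff_const)).const_smul c

theorem contDiff_torusSnd (c : ℝ) : ContDiff ℝ ∞ (torusSnd n c) :=
  (((contDiff_circ (unitVec n 1) (unitVec n 3)).comp
    (contDiff_id.add contDiff_const)).const_smul Complex.I).const_smul c

section Products

variable (c : ℝ) (p : ℝ × ℝ) (x : ℝ)

theorem conjVec_torus :
    conjVec (torus n c p) = c • realCircle n p.1 - c • (Complex.I • imagCircle n p.2) := by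
  simp [torus, conjVec_realCircle, conjVec_imagCircle, sub_eq_add_neg]

theorem conjVec_torusFst : conjVec (torusFst n c x) = torusFst n c x := by
  simp [torusFst, conjVec_realCircle]

theorem conjVec_torusSnd : conjVec (torusSnd n c x) = -torusSnd n c x := by
  simp [torusSnd, conjVec_imagCircle]

theorem dot_torus (hn : 2 < n) : dot (torus n c p) (torus n c p) = 0 := by
  simp [torus, dot_realCircle hn, dot_imagCircle hn, dot_realCircle_imagCircle hn,
    dot_imagCircle_realCircle hn]
  linear_combination (c : ℂ) ^ 2 * Complex.I_sq

theorem norm_torus_sq (hn : 2 < n) : ‖torus n c p‖ ^ 2 = 2 * c ^ 2 := by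
  have h : ((‖torus n c p‖ ^ 2 : ℝ) : ℂ) = ((2 * c ^ 2 : ℝ) : ℂ) := by
    rw [← dot_conjVec_self, conjVec_torus, sub_eq_add_neg, ← neg_smul]
    simp [torus, dot_realCircle hn, dot_imagCircle hn, dot_realCircle_imagCircle hn,
      dot_imagCircle_realCircle hn]
    linear_combination -(c : ℂ) ^ 2 * Complex.I_sq
  exact_mod_cast h

theorem torus_mem_cone (hn : 2 < n) {c : ℝ} (hc : 0 < c) : torus n c p ∈ cone n := by
  refine ⟨fun h => ?_, dot_torus c p hn⟩
  have := norm_torus_sq c p hn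
  rw [h] at this
  simp at this
  exact hc.ne' this

theorem dot_torus_torusFst (hn : 2 < n) : dot (torus n c p) (torusFst n c p.1) = 0 := by
  simp [torus, torusFst, dot_realCircle hn, dot_imagCircle_realCircle hn]

theorem dot_torus_torusSnd (hn : 2 < n) : dot (torus n c p) (torusSnd n c p.2) = 0 := by
  simp [torus, torusSnd, dot_imagCircle hn, dot_realCircle_imagCircle hn]

theorem dot_conjVec_torus_torusFst (hn : 2 < n) :
    dot (conjVec (torus n c p)) (torusFst n c p.1) = 0 := by
  rw [conjVec_torus, sub_eq_add_neg, ← neg_smul]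
  simp [torusFst, dot_realCircle hn, dot_imagCircle_realCircle hn]

theorem dot_conjVec_torus_torusSnd (hn : 2 < n) :
    dot (conjVec (torus n c p)) (torusSnd n c p.2) = 0 := by
  rw [conjVec_torus, sub_eq_add_neg, ← neg_smul]
  simp [torusSnd, dot_imagCircle hn, dot_realCircle_imagCircle hn]

theorem dot_torusFst_self (hn : 2 < n) :
    dot (torusFst n c x) (torusFst n c x) = ((c ^ 2 : ℝ) : ℂ) := by
  simp [torusFst, dot_realCircle hn]
  ring

theorem dot_torusSnd_self (hn : 2 < n) :
    dot (torusSnd n c x) (torusSnd n c x) = ((-c ^ 2 : ℝ) : ℂ) := by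
  simp [torusSnd, dot_imagCircle hn]
  linear_combination (c : ℂ) ^ 2 * Complex.I_sq

end Products

theorem frameScale_pos (hn : 2 < n) {a t : ℝ} (ha : 0 < a) (ht : 0 < t) : 0 < frameScale n a t := by
  have := coneDeriv_pos hn ht
  unfold frameScale
  positivity

theorem re_dot_conjVec_of_tang {z X : Amb n} (hX : X ∈ tang z) :
    (dot (conjVec X) (conjVec z)).re = 0 := by
  rw [dot_conjVec_conjVec, dot_comm, show dot z X = 0 from hX]
  simp

/-- Let A = Re⟨X,F⟩ and B = Re⟨X,S⟩ for the coordinate fields F, S. Then ∂_x A and ∂_y B equal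
Re⟨D_F X,F⟩ and Re⟨D_S X,S⟩ up to the same term ½Re⟨z,X⟩, and the conformal term of the Lie
derivative also agrees for F and S. Hence the difference of the Lie derivatives is a positive
constant times ∂_x A - ∂_y B. -/
theorem exists_lieMetric_torus_le (hn : 2 < n) {a c : ℝ} (ha : 0 < a) (hc : 0 < c) {X : Amb n → Amb n}
    (hX : ∀ p, ContDiffAt ℝ ∞ X (torus n c p) ∧ X (torus n c p) ∈ tang (torus n c p)) :
    ∃ p : ℝ × ℝ, lieMetric n a X (torus n c p) (torusSnd n c p.2) (torusSnd n c p.2) ≤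
      lieMetric n a X (torus n c p) (torusFst n c p.1) (torusFst n c p.1) := by
  have hXc : ContDiff ℝ 1 fun p => X (torus n c p) := contDiff_iff_contDiffAt.2 fun p =>
    (((hX p).1.comp p (contDiff_torus c).contDiffAt).of_le (by simp))
  have hA : ContDiff ℝ 1 fun p : ℝ × ℝ => reHerm n (X (torus n c p)) (torusFst n c p.1) :=
    ((reHerm n).contDiff.comp hXc).clm_apply
      (((contDiff_torusFst c).of_le (by simp)).comp contDiff_fst)
  have hB : ContDiff ℝ 1 fun p : ℝ × ℝ => reHerm n (X (torus n c p)) (torusSnd n c p.2) :=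
    ((reHerm n).contDiff.comp hXc).clm_apply
      (((contDiff_torusSnd c).of_le (by simp)).comp contDiff_snd)
  obtain ⟨⟨x, y⟩, hp⟩ := exists_fderiv_le_of_periodic Real.two_pi_pos hA hB
    (fun y => by simp only [torus, torusFst, realCircle, circ_two_pi, circ_two_pi_add, zero_add])
    (fun x => by simp only [torus, torusSnd, imagCircle, circ_two_pi, circ_two_pi_add, zero_add])
  refine ⟨(x, y), ?_⟩
  set z := torus n c (x, y) with hzdef
  have hz := torus_mem_cone (x, y) hn hc
  -- Tangency of X removes the z̄ part of the second derivatives, the only part in which the two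
  -- directions would differ.
  have hX₀ : (dot (conjVec (X z)) (conjVec z)).re = 0 := re_dot_conjVec_of_tang (hX (x, y)).2
  have hXd : HasFDerivAt X (fderiv ℝ X z) z :=
    ((hX (x, y)).1.differentiableAt (by simp)).hasFDerivAt
  have dA : fderiv ℝ (fun p : ℝ × ℝ => reHerm n (X (torus n c p)) (torusFst n c p.1)) (x, y) (1, 0) =
      (dot (conjVec (fderiv ℝ X z (torusFst n c x))) (torusFst n c x)).re -
        1 / 2 * (dot (conjVec z) (X z)).re := by
    have e1 := (hA.differentiable one_ne_zero (x, y)).hasFDerivAt.comp_hasDerivAt x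
      ((hasDerivAt_id x).prodMk (hasDerivAt_const x y))
    have e2 := ((reHerm n).hasFDerivAt.comp_hasDerivAt x
      (hXd.comp_hasDerivAt x (hasDerivAt_torus_fst c x y))).clm_apply
      (hasDerivAt_torusFst c x y)
    refine (e1.unique e2).trans ?_
    simp [← hzdef, hX₀, re_dot_conjVec_comm (X z) z]
    ring
  have dB : fderiv ℝ (fun p : ℝ × ℝ => reHerm n (X (torus n c p)) (torusSnd n c p.2)) (x, y) (0, 1) =
      (dot (conjVec (fderiv ℝ X z (torusSnd n c y))) (torusSnd n c y)).re -
        1 / 2 * (dot (conjVec z) (X z)).re := by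
    have e1 := (hB.differentiable one_ne_zero (x, y)).hasFDerivAt.comp_hasDerivAt y
      ((hasDerivAt_const y x).prodMk (hasDerivAt_id y))
    have e2 := ((reHerm n).hasFDerivAt.comp_hasDerivAt y
      (hXd.comp_hasDerivAt y (hasDerivAt_torus_snd c x y))).clm_apply
      (hasDerivAt_torusSnd c x y)
    refine (e1.unique e2).trans ?_
    simp [← hzdef, hX₀, re_dot_conjVec_comm (X z) z]
    ring
  rw [dA, dB] at hp
  have hpos : 0 < ‖z‖ ^ 2 := by have := norm_pos_iff.2 hz.1; positivity
  have := coneDeriv_pos hn hpos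
  rw [lieMetric_self hn a X hz.1 (dot_conjVec_torus_torusFst c (x, y) hn),
    lieMetric_self hn a X hz.1 (dot_conjVec_torus_torusSnd c (x, y) hn), conjVec_torusFst,
    conjVec_torusSnd, dot_torusFst_self c x hn, dot_neg_left, dot_torusSnd_self c y hn]
  refine mul_le_mul_of_nonneg_left ?_ (by positivity)
  simp only [Complex.neg_re, Complex.ofReal_re]
  linarith

/-- With G the common g₀-square length of F and S, h(F,F) - h(S,S) = 2G/t on the whole torus at τ =
t. At the point where the Lie derivative contributes nonnegatively to this difference, the assumed
bound must dominate 2G/t up to the faster decaying remainder. -/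
theorem rate_le_of_gauge (hn : 2 < n) {a : ℝ} (ha : 0 < a) {X : Amb n → Amb n} {R : ℝ}
    (hX : ∀ z ∈ cone n, R < radius n a z → ContDiffAt ℝ ∞ X z ∧ X z ∈ tang z) {l : ℝ}
    (h : HasDecay n a (toTensor fun z v w => difference n a z v w + lieMetric n a X z v w) l) :
    -2 * (n / (n - 1) : ℝ) ≤ l := by
  rw [rate_eq hn]
  obtain ⟨K₁, R₁, h₁⟩ := h.bound
  obtain ⟨K₂, R₂, h₂⟩ := (hasDecay_difference_sub_leading hn ha).bound
  refine exponent_le_of_eventually_inv_le (K₁ := K₁) (K₂ := K₂) (exponent_pos hn)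
    (radiusConst_pos hn ha) (three_rate_lt hn) ?_
  filter_upwards [eventually_gt_atTop 0, eventually_lt_radius hn ha R, eventually_lt_radius hn ha R₁,
    eventually_lt_radius hn ha R₂] with t ht hR hR₁ hR₂
  -- The torus of scale c lies at τ = 2c², so r is constant on it and all bounds hold along it
  -- simultaneously.
  obtain ⟨c, hc, hct⟩ : ∃ c : ℝ, 0 < c ∧ 2 * c ^ 2 = t :=
    ⟨√(t / 2), by positivity, by rw [Real.sq_sqrt (by positivity)]; ring⟩
  have hr : ∀ p, radius n a (torus n c p) = radiusConst n a * t ^ ((1 - 1 / (n : ℝ)) / 2) := fun p =>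
    radius_of_norm_sq hn ha ((norm_torus_sq c p hn).trans hct)
  obtain ⟨p, hp⟩ := exists_lieMetric_torus_le hn ha hc fun p =>
    hX _ (torus_mem_cone p hn hc) (by rwa [hr p])
  have hz := torus_mem_cone p hn hc
  have hzt := (norm_torus_sq c p hn).trans hct
  rw [← hr p] at hR₁ hR₂ ⊢
  have hD := coneDeriv_pos hn ht
  have gF : coneMetric n a (torus n c p) (torusFst n c p.1) (torusFst n c p.1) =
      2 * a * coneDeriv n t * c ^ 2 := by
    rw [coneMetric_eq hn a hz.1, dot_conjVec_torus_torusFst c p hn, conjVec_torusFst,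
      dot_torusFst_self c _ hn, hzt]
    simp only [Complex.ofReal_re, zero_mul, Complex.zero_re, mul_zero, sub_zero]
  have gS : coneMetric n a (torus n c p) (torusSnd n c p.2) (torusSnd n c p.2) =
      2 * a * coneDeriv n t * c ^ 2 := by
    rw [coneMetric_eq hn a hz.1, dot_conjVec_torus_torusSnd c p hn, conjVec_torusSnd, dot_neg_left,
      dot_torusSnd_self c _ hn, hzt]
    simp only [Complex.neg_re, Complex.ofReal_re, zero_mul, Complex.zero_re, mul_zero, sub_zero,
      neg_neg]
  have lF := leading_eq hn a hz.1 (torusFst n c p.1) (torusFst n c p.1)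
  have lS := leading_eq hn a hz.1 (torusSnd n c p.2) (torusSnd n c p.2)
  rw [dot_torusFst_self c _ hn, hzt, Complex.ofReal_re] at lF
  rw [dot_torusSnd_self c _ hn, hzt, Complex.ofReal_re] at lS
  have tF : torusFst n c p.1 ∈ tang (torus n c p) := dot_torus_torusFst c p hn
  have tS : torusSnd n c p.2 ∈ tang (torus n c p) := dot_torus_torusSnd c p hn
  have a1 := h₁ _ hz hR₁ _ tF _ tF
  have a2 := h₁ _ hz hR₁ _ tS _ tS
  have a3 := h₂ _ hz hR₂ _ tF _ tF
  have a4 := h₂ _ hz hR₂ _ tS _ tS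
  have hG : 0 < 2 * a * coneDeriv n t * c ^ 2 := by positivity
  rw [gF, Real.mul_self_sqrt hG.le] at a1 a3
  rw [gS, Real.mul_self_sqrt hG.le] at a2 a4
  have e1 := (abs_le.1 a1).2
  have e2 := (abs_le.1 a2).1
  have e3 := (abs_le.1 a3).1
  have e4 := (abs_le.1 a4).2
  rw [lF] at e3
  rw [lS] at e4
  refine le_of_mul_le_mul_right ?_ hG
  have e5 : 2 * a * coneDeriv n t / t * c ^ 2 = t⁻¹ * (2 * a * coneDeriv n t * c ^ 2) := by ring
  have e6 : 2 * a * coneDeriv n t / t * -c ^ 2 = -(t⁻¹ * (2 * a * coneDeriv n t * c ^ 2)) := by ring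
  rw [e5] at e3
  rw [e6] at e4
  rw [add_mul]
  linarith

end Gauge

end Stenzel

end

/-! ### Assembly of the proposition -/

open Stenzel in
theorem proposition5p10 (n : ℕ) (hn : 2 < n) (a : ℝ) (ha : 0 < a) :
    -- the explicit form of the leading term `h`
    (∀ t : ℝ, 0 < t → ∃ s : ℝ, 0 < s ∧ IsFrame n a (basePoint n t) (frame n a t s) ∧
      ∀ i j, leading n a (basePoint n t) (frame n a t s i) (frame n a t s j) =
        if i = j then t⁻¹ * diagEntry i else 0) ∧
    (∀ A ∈ Matrix.specialOrthogonalGroup (Fin (n + 1)) ℝ, ∀ z ∈ cone n, ∀ v w : Amb n,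
      leading n a (act A z) (act A v) (act A w) = leading n a z v w) ∧
    -- `h` is symmetric and tracefree
    (∀ z ∈ cone n, ∀ v w : Amb n, leading n a z v w = leading n a z w v) ∧
    (∀ z ∈ cone n, ∀ e, IsFrame n a z e → ∑ i, leading n a z (e i) (e i) = 0) ∧
    -- `Φ^* g - g₀` equals `h` to leading order
    (∃ l : ℝ, l < -2 * (n / (n - 1) : ℝ) ∧
      HasDecay n a (toTensor fun z v w => difference n a z v w - leading n a z v w) l) ∧
    -- the rate
    HasRate n a (toTensor (leading n a)) (-2 * (n / (n - 1) : ℝ)) ∧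
    HasRate n a (toTensor (difference n a)) (-2 * (n / (n - 1) : ℝ)) ∧
    -- the Bianchi gauge condition relative to `g₀`
    (∀ z ∈ cone n, ∀ e, IsFrame n a z e → ∀ w ∈ tang z, bianchi n a (leading n a) z e w = 0) ∧
    -- no infinitesimal change of gauge near infinity improves the rate
    (∀ (X : Amb n → Amb n) (R : ℝ),
      (∀ z ∈ cone n, R < radius n a z → ContDiffAt ℝ ∞ X z ∧ X z ∈ tang z) →
      ∀ l : ℝ, HasDecay n a
        (toTensor fun z v w => difference n a z v w + lieMetric n a X z v w) l →
        -2 * (n / (n - 1) : ℝ) ≤ l) := by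
  have hrate := three_rate_lt hn
  rw [← rate_eq hn] at hrate
  refine ⟨fun t ht => ⟨frameScale n a t, frameScale_pos hn ha ht, isFrame_frame hn ha ht,
    leading_frame hn ha ht⟩, fun A hA z _ v w => leading_act a hA z v w,
    fun z _ v w => ?_, fun z hz e he => sum_leading_eq_zero hn hz.1 he,
    ⟨_, hrate, hasDecay_difference_sub_leading hn ha⟩, hasRate_leading hn ha,
    hasRate_difference hn ha, fun z hz e he w hw => bianchi_leading hn ha hz he hw,
    fun X R hX l hl => rate_le_of_gauge hn ha hX hl⟩
  rw [leading, leading, dot_comm]
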